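/- **Theorem.** Consider a random access machine over $\mathbb{Z}$ on which each arithmetic operation ($+$, $-$, $\times$, integer division), comparison, assignment and (possibly indirect) memory access takes one unit of time. There is a single program for this machine which, given any $(n,w,k)$ with integers $n\ge 1$, $k\ge 0$ and an edge weighting $w:E(K_n)\to\mathbb{Z}$ (given as an $n\times n$ matrix), halts and determines whether the complete graph $K_n$ has a Hamilton cycle $H^*$ with $$w(H^*)\le dn-k,$$ where $w(H^*)=\sum_{e\in E(H^*)}w(e)$ and $d=\binom n2^{-1}\sum_{e\in E(K_n)}w(e)$ is the average weight of an edge; if such a cycle exists, the program outputs the vertices of one in cyclic order. (For $n\le 2$ there is no Hamilton cycle, so the answer is negative.) Its running time is $O(k^3)!+O(k^3n)+O(n^7)$; that is, there is an absolute constant $C$ such that the running time is at most $$(Ck^3)!+Ck^3n+Cn^7$$ for all such $(n,w,k)$. In particular it is at most $f(k)\,n^{c}$ for a computable function $f$ and a constant $c$. Moreover, every integer occurring in the computation has absolute value at most $(M+n+k+1)^{D}$ for an absolute constant $D$, where $M=\max_{e}|w(e)|$ (and $M=0$ if there are no edges), so all these integers have $O(\log(M+n+k+1))$ bits. Hence the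 travelling salesman problem below average is fixed-parameter tractable when parameterised by $k$. -/

import Mathlib

/-! ### A unit-cost random access machine over the integers

A machine has integer registers and an integer-addressed memory of integers. Its programs are
structured (assignment, store, sequence, branch, loop); every arithmetic operation, comparison,
register access, memory access and command counts as one unit of time. -/

namespace IntRAM

/-- The binary operations of the machine. -/
inductive Op where
  | add
  | sub
  | mul
  | div
  | lt
  | eq

/-- `div` is integer division (rounding down for a positive divisor); a comparison returns
`1` (true) or `0` (false). -/
def Op.apply : Op → ℤ → ℤ → ℤ
  | .add, a, b => a + b
  | .sub, a, b => a - b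
  | .mul, a, b => a * b
  | .div, a, b => a / b
  | .lt, a, b => if a < b then 1 else 0
  | .eq, a, b => if a = b then 1 else 0

/-- Expressions: integer constants, registers, memory cells with a computed address (indirect
addressing), and binary operations. -/
inductive Expr where
  | const (c : ℤ)
  | reg (r : ℕ)
  | mem (addr : Expr)
  | op (o : Op) (e₁ e₂ : Expr)

/-- The state of a machine: the contents of its registers and of its memory. -/
structure State where
  reg : ℕ → ℤ
  mem : ℤ → ℤ

/-- The value of an expression in a state. -/
def Expr.eval (s : State) : Expr → ℤ
  | .const c => c
  | .reg r => s.reg r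
  | .mem addr => s.mem (addr.eval s)
  | .op o e₁ e₂ => o.apply (e₁.eval s) (e₂.eval s)

/-- The time to evaluate an expression: one unit per constant, register access, memory access
and operation. -/
def Expr.cost : Expr → ℕ
  | .const _ => 1
  | .reg _ => 1
  | .mem addr => addr.cost + 1
  | .op _ e₁ e₂ => e₁.cost + e₂.cost + 1

/-- All integers that occur during the evaluation of an expression (addresses and intermediate
results included) are at most `B` in absolute value. -/
def Expr.Within (B : ℕ) (s : State) : Expr → Prop
  | .const c => c.natAbs ≤ B
  | .reg r => (s.reg r).natAbs ≤ B
  | .mem addr => addr.Within B s ∧ (s.mem (addr.eval s)).natAbs ≤ B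
  | .op o e₁ e₂ =>
      e₁.Within B s ∧ e₂.Within B s ∧ (o.apply (e₁.eval s) (e₂.eval s)).natAbs ≤ B

/-- Programs. A test succeeds when its expression has a nonzero value. -/
inductive Program where
  | skip
  | assign (r : ℕ) (e : Expr)
  | store (addr e : Expr)
  | seq (p q : Program)
  | ite (test : Expr) (p q : Program)
  | loop (test : Expr) (p : Program)

/-- `Runs B p s t s'`: the program `p`, started in state `s`, halts after exactly `t` units of
time in state `s'`, and every integer that it computes or accesses on the way is at most `B` in
absolute value. -/
inductive Runs (B : ℕ) : Program → State → ℕ → State → Prop where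
  | skip (s : State) : Runs B .skip s 1 s
  | assign (r : ℕ) (e : Expr) (s : State) (he : e.Within B s) :
      Runs B (.assign r e) s (e.cost + 1) { s with reg := Function.update s.reg r (e.eval s) }
  | store (addr e : Expr) (s : State) (ha : addr.Within B s) (he : e.Within B s) :
      Runs B (.store addr e) s (addr.cost + e.cost + 1)
        { s with mem := Function.update s.mem (addr.eval s) (e.eval s) }
  | seq (p q : Program) (s₁ s₂ s₃ : State) (t₁ t₂ : ℕ)
      (hp : Runs B p s₁ t₁ s₂) (hq : Runs B q s₂ t₂ s₃) : Runs B (.seq p q) s₁ (t₁ + t₂) s₃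
  | iteTrue (e : Expr) (p q : Program) (s s' : State) (t : ℕ) (hw : e.Within B s)
      (he : e.eval s ≠ 0) (hp : Runs B p s t s') : Runs B (.ite e p q) s (e.cost + 1 + t) s'
  | iteFalse (e : Expr) (p q : Program) (s s' : State) (t : ℕ) (hw : e.Within B s)
      (he : e.eval s = 0) (hq : Runs B q s t s') : Runs B (.ite e p q) s (e.cost + 1 + t) s'
  | loopStop (e : Expr) (p : Program) (s : State) (hw : e.Within B s) (he : e.eval s = 0) :
      Runs B (.loop e p) s (e.cost + 1) s
  | loopStep (e : Expr) (p : Program) (s₁ s₂ s₃ : State) (t₁ t₂ : ℕ) (hw : e.Within B s₁)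
      (he : e.eval s₁ ≠ 0) (hp : Runs B p s₁ t₁ s₂) (hl : Runs B (.loop e p) s₂ t₂ s₃) :
      Runs B (.loop e p) s₁ (e.cost + 1 + t₁ + t₂) s₃

/-- The machine is deterministic: the running time and the final state of a program are
determined by the initial state. -/
theorem Runs.deterministic {B B' : ℕ} {p : Program} {s s' s'' : State} {t t' : ℕ}
    (h : Runs B p s t s') (h' : Runs B' p s t' s'') : t = t' ∧ s' = s'' := by
  induction h generalizing t' s'' with
  | skip s => cases h'; exact ⟨rfl, rfl⟩
  | assign r e s he => cases h'; exact ⟨rfl, rfl⟩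
  | store addr e s ha he => cases h'; exact ⟨rfl, rfl⟩
  | seq p q s₁ s₂ s₃ t₁ t₂ hp hq ihp ihq =>
    cases h' with
    | seq _ _ _ _ _ _ _ hp' hq' =>
      obtain ⟨rfl, rfl⟩ := ihp hp'
      obtain ⟨rfl, rfl⟩ := ihq hq'
      exact ⟨rfl, rfl⟩
  | iteTrue e p q s s' t hw he hp ih =>
    cases h' with
    | iteTrue _ _ _ _ _ _ _ _ hp' => obtain ⟨rfl, rfl⟩ := ih hp'; exact ⟨rfl, rfl⟩
    | iteFalse _ _ _ _ _ _ _ he' _ => exact absurd he' he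
  | iteFalse e p q s s' t hw he hp ih =>
    cases h' with
    | iteTrue _ _ _ _ _ _ _ he' _ => exact absurd he he'
    | iteFalse _ _ _ _ _ _ _ _ hp' => obtain ⟨rfl, rfl⟩ := ih hp'; exact ⟨rfl, rfl⟩
  | loopStop e p s hw he =>
    cases h' with
    | loopStop => exact ⟨rfl, rfl⟩
    | loopStep _ _ _ _ _ _ _ _ he' _ _ => exact absurd he he'
  | loopStep e p s₁ s₂ s₃ t₁ t₂ hw he hp hl ihp ihl =>
    cases h' with
    | loopStop _ _ _ _ he' => exact absurd he' he
    | loopStep _ _ _ _ _ _ _ _ _ hp' hl' =>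
      obtain ⟨rfl, rfl⟩ := ihp hp'
      obtain ⟨rfl, rfl⟩ := ihl hl'
      exact ⟨rfl, rfl⟩

end IntRAM

/-! ### The travelling salesman problem below average -/

namespace TSP

/-- The complete graph `K_n`, with vertices `0, …, n - 1`. -/
abbrev K (n : ℕ) : SimpleGraph (Fin n) := ⊤

/-- An integer edge weighting `w : E(K_n) → ℤ`. -/
abbrev Weighting (n : ℕ) : Type := (K n).edgeSet → ℤ

open Classical in
/-- The weight `w(G) = ∑_{e ∈ E(G)} w(e)` of a subgraph `G` of `K_n`. -/
noncomputable def weight {n : ℕ} (w : Weighting n) (G : (K n).Subgraph) : ℤ :=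
  ∑ e : (K n).edgeSet, if (e : Sym2 (Fin n)) ∈ G.edgeSet then w e else 0

/-- The density `d = w(K_n) / (n choose 2)`: the average weight of an edge. -/
noncomputable def density {n : ℕ} (w : Weighting n) : ℚ :=
  (weight w ⊤ : ℚ) / (n.choose 2 : ℚ)

/-- `H` is a Hamilton cycle of `K_n` (given as a closed walk) with `w(H) ≤ d n - k`. -/
def BelowAverage {n : ℕ} (w : Weighting n) (k : ℕ) {a : Fin n} (H : (K n).Walk a a) : Prop :=
  H.IsHamiltonianCycle ∧ (weight w H.toSubgraph : ℚ) ≤ density w * n - k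

/-- The largest absolute value `max_e |w(e)|` of an edge weight. -/
noncomputable def maxAbs {n : ℕ} (w : Weighting n) : ℕ :=
  Finset.univ.sup fun e => (w e).natAbs

/-- The entry `(i, j)` of the symmetric weight matrix of `w`: the weight of the edge `ij` if
`i ≠ j` are vertices, and `0` otherwise. -/
def entry {n : ℕ} (w : Weighting n) (i j : ℕ) : ℤ :=
  if h : i < n ∧ j < n ∧ i ≠ j then
    w ⟨s(⟨i, h.1⟩, ⟨j, h.2.1⟩), by simpa using h.2.2⟩
  else 0

/-- The input `(n, w, k)` of the machine: register `0` holds `n`, register `1` holds `k`, the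
memory cells `0, …, n² - 1` hold the weight matrix row by row (cell `i * n + j` holds the entry
`(i, j)`), and everything else is `0`. -/
def input (n : ℕ) (w : Weighting n) (k : ℕ) : IntRAM.State where
  reg r := if r = 0 then n else if r = 1 then k else 0
  mem a := if 0 ≤ a then entry w (a.toNat / n) (a.toNat % n) else 0

/-- The final state `s` is a correct answer to the instance `(n, w, k)`: either register `0`
holds `1` and the memory cells `0, …, n - 1` list, in cyclic order, the vertices of a Hamilton
cycle `H` with `w(H) ≤ d n - k`, or register `0` holds `0` and there is no such cycle. -/
def CorrectOutput {n : ℕ} (w : Weighting n) (k : ℕ) (s : IntRAM.State) : Prop :=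
  (s.reg 0 = 1 ∧ ∃ (a : Fin n) (H : (K n).Walk a a), BelowAverage w k H ∧
      ∀ i : ℕ, i < n → s.mem i = ((H.getVert i : Fin n) : ℕ)) ∨
    (s.reg 0 = 0 ∧ ¬ ∃ (a : Fin n) (H : (K n).Walk a a), BelowAverage w k H)

end TSP

/-! A Hamilton cycle is built by joining vertex-disjoint directed paths, end to beginning. With `N ≥
2` paths left, a uniformly random cyclic arrangement uses each link between different paths with
probability `1/(N-1)`, which gives its mean weight `expWeight`. At the start this mean is `d n`
(`expWeight_one_univ`). For a fixed end, the changes of the mean under its possible merges average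
to zero (`sum_mergeVal_right`), so a best merge never increases the mean. If each of the first
`100k` merges lowers it by at least `1/100`, the cycle obtained at the end weighs at most `d n - k`.

Otherwise the greedy phase stops when every merge changes the mean by more than `-1/100`. The set
`A` of vertices touched so far has fewer than `200k` elements. For untouched `x`, `y` the two
opposite merges together change the mean by `2w(xy) - p(x) - p(y)`, where `p` is a rational
potential. These numbers exceed `-1/50`, and with the other ends included they sum to zero for each
fixed `x`; hence at most a tenth of them are `1/5` or more. A triangle of pairs with small values
shows that `p(x)` lies within `3/10` of an integer `Q(x)` (`pot_near`). By integrality the reduced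
weight `r(x,y) = 2w(xy) - Q(x) - Q(y)` is nonnegative outside `A`, and for each `x` it vanishes for
all but a tenth of the partners `y` (`redWeight_pot_nonneg`, `card_redWeight_pot_ne_zero_le`). On
tours, `r` and `2w` differ by the constant `2 ∑ Q`.

Only the links at `A` matter now. Ignoring the other links cannot raise the reduced cost of a tour
(`restrictCost_tour_le`). Conversely, reversals of segments turn any tour into one whose links
outside `A` have `r = 0`, without changing the total cost of the links at `A` (`exists_canSwap`,
`repair_step`).

To minimise the cost of the links at `A`, it suffices to keep a kernel: `A` and, for each pair `a`,
`a'` in `A`, the `3|A|` vertices `v` with the least `r(a,v) + r(a',v)`. At most `2|A|` vertices are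
next to `A` in a tour, so a vertex outside the kernel that is next to `A` can be exchanged for a
kernel vertex that is not (`exists_tour_not_nextTo`). All vertices outside the kernel can then be
gathered in a fixed order at no cost (`exists_tour_kernel_first`). This leaves at most `K ^ K`
arrangements of a kernel of size `K = O(k^3)`. If `n ≤ 10000k`, all vertices are declared
exceptional and the same search runs through all tours.

The machine side is a calculus of total correctness with time bounds (`Wp`), in which only stored
values need to be bounded (`RunsR.runs`). -/

namespace IntRAM

/-! ### Syntactic measures of programs -/

/-- The largest absolute value of a constant in an expression. -/
def Expr.maxConst : Expr → ℕ
  | .const c => c.natAbs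
  | .reg _ => 0
  | .mem a => a.maxConst
  | .op _ a b => max a.maxConst b.maxConst

/-- The largest absolute value of a constant in a program. -/
def Program.maxConst : Program → ℕ
  | .skip => 0
  | .assign _ e => e.maxConst
  | .store a e => max a.maxConst e.maxConst
  | .seq p q => max p.maxConst q.maxConst
  | .ite e p q => max e.maxConst (max p.maxConst q.maxConst)
  | .loop e p => max e.maxConst p.maxConst

/-- The largest cost of an expression in a program. -/
def Program.maxCost : Program → ℕ
  | .skip => 0
  | .assign _ e => e.cost
  | .store a e => max a.cost e.cost
  | .seq p q => max p.maxCost q.maxCost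
  | .ite e p q => max e.cost (max p.maxCost q.maxCost)
  | .loop e p => max e.cost p.maxCost

/-- Every register and every memory cell holds an integer of absolute value at most `R`. -/
def State.Bdd (R : ℕ) (s : State) : Prop :=
  (∀ r, (s.reg r).natAbs ≤ R) ∧ ∀ a, (s.mem a).natAbs ≤ R

/-- The bound is `(x + 1) * (y + 1)`: it covers all operations at once and is multiplicative in the
shifted bounds. Division by zero gives `0`, so it needs no exception. -/
theorem Op.natAbs_apply_le (o : Op) (a b : ℤ) {x y : ℕ} (ha : a.natAbs ≤ x) (hb : b.natAbs ≤ y) :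
    (o.apply a b).natAbs ≤ x * y + x + y + 1 := by
  have hx : (0 : ℕ) ≤ x * y := Nat.zero_le _
  cases o with
  | add => have := Int.natAbs_add_le a b; simp only [Op.apply]; omega
  | sub => have := Int.natAbs_sub_le a b; simp only [Op.apply]; omega
  | mul =>
    have := Nat.mul_le_mul ha hb
    simp only [Op.apply, Int.natAbs_mul]; omega
  | div => have := Int.natAbs_ediv_le_natAbs a b; simp only [Op.apply]; omega
  | lt => simp only [Op.apply]; split_ifs <;> simp
  | eq => simp only [Op.apply]; split_ifs <;> simp

/-- The values, shifted by one, multiply under each operation. The unit of time that an operation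
itself takes contributes a spare factor `R ^ 2 ≥ 4`, which absorbs the shift. -/
theorem Expr.within_aux {R : ℕ} (hR : 2 ≤ R) {s : State} (hs : s.Bdd R) (e : Expr)
    (hc : e.maxConst ≤ R) :
    (e.eval s).natAbs + 1 ≤ R ^ (2 * e.cost) ∧
      ∀ B, R ^ (2 * e.cost) ≤ B → e.Within B s := by
  have key : ∀ m, 1 ≤ m → R + 1 ≤ R ^ (2 * m) := by
    intro m hm
    calc R + 1 ≤ R ^ 2 := by nlinarith
      _ ≤ R ^ (2 * m) := Nat.pow_le_pow_right (by omega) (by omega)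
  induction e with
  | const c =>
    have h := key 1 le_rfl
    simp only [Expr.maxConst] at hc
    simp only [Expr.eval, Expr.cost, Expr.Within]
    exact ⟨by omega, fun B hB => by omega⟩
  | reg r =>
    have h := key 1 le_rfl
    have := hs.1 r
    simp only [Expr.eval, Expr.cost, Expr.Within]
    exact ⟨by omega, fun B hB => by omega⟩
  | mem a ih =>
    obtain ⟨h1, h2⟩ := ih hc
    have h := key (a.cost + 1) (by omega)
    have := hs.2 (a.eval s)
    simp only [Expr.eval, Expr.cost, Expr.Within]
    refine ⟨by omega, fun B hB => ⟨h2 B (le_trans (Nat.pow_le_pow_right (by omega) (by omega)) hB),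
      by omega⟩⟩
  | op o a b iha ihb =>
    simp only [Expr.maxConst, max_le_iff] at hc
    obtain ⟨h1, h2⟩ := iha hc.1
    obtain ⟨h3, h4⟩ := ihb hc.2
    have h5 := Op.natAbs_apply_le o (a.eval s) (b.eval s) (Nat.le_sub_one_of_lt h1)
      (Nat.le_sub_one_of_lt h3)
    have e1 : R ^ (2 * (a.cost + b.cost + 1)) = R ^ (2 * a.cost) * R ^ (2 * b.cost) * R ^ 2 := by
      rw [← pow_add, ← pow_add]; congr 1; ring
    have h6 : (o.apply (a.eval s) (b.eval s)).natAbs + 1 ≤ R ^ (2 * (a.cost + b.cost + 1)) := by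
      rw [e1]
      obtain ⟨x, hx⟩ : ∃ x, R ^ (2 * a.cost) = x + 1 := ⟨_, (Nat.sub_add_cancel (by omega)).symm⟩
      obtain ⟨y, hy⟩ : ∃ y, R ^ (2 * b.cost) = y + 1 := ⟨_, (Nat.sub_add_cancel (by omega)).symm⟩
      rw [hx, hy] at h5 ⊢
      simp only [Nat.add_sub_cancel] at h5
      have : 4 ≤ R ^ 2 := by nlinarith
      calc _ ≤ (x + 1) * (y + 1) + 1 := by nlinarith
        _ ≤ (x + 1) * (y + 1) * 4 := by nlinarith [Nat.zero_le (x * y)]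
        _ ≤ _ := Nat.mul_le_mul_left _ this
    refine ⟨h6, fun B hB => ⟨h2 B (le_trans (Nat.pow_le_pow_right (by omega) ?_) hB),
      h4 B (le_trans (Nat.pow_le_pow_right (by omega) ?_) hB), ?_⟩⟩
    · simp only [Expr.cost]; omega
    · simp only [Expr.cost]; omega
    · simp only [Expr.cost] at hB; omega

theorem Expr.within {R : ℕ} (hR : 2 ≤ R) {s : State} (hs : s.Bdd R) {e : Expr}
    (hc : e.maxConst ≤ R) {m : ℕ} (hm : e.cost ≤ m) : e.Within (R ^ (2 * m)) s :=
  (e.within_aux hR hs hc).2 _ (Nat.pow_le_pow_right (by omega) (by omega))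

/-! ### State updates and arrays -/

/-- Update of a register. -/
def State.setReg (s : State) (r : ℕ) (v : ℤ) : State := { s with reg := Function.update s.reg r v }

/-- Update of a memory cell. -/
def State.setMem (s : State) (a v : ℤ) : State := { s with mem := Function.update s.mem a v }

/-- The address of the cell `i` of the array `j`: the memory is shared among sixteen interleaved
arrays, whose cells with nonnegative indices have negative addresses. -/
def cellAddr (j : Fin 16) (i : ℤ) : ℤ := (j : ℕ) - 16 * (i + 1)

/-- The contents of the cell `i` of the array `j`. -/
def State.arr (s : State) (j : Fin 16) (i : ℤ) : ℤ := s.mem (cellAddr j i)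

theorem cellAddr_inj {j j' : Fin 16} {i i' : ℤ} : cellAddr j i = cellAddr j' i' ↔ j = j' ∧ i = i' := by
  unfold cellAddr
  constructor
  · intro h
    have h1 := j.2
    have h2 := j'.2
    have : i = i' := by omega
    exact ⟨Fin.ext (by omega), this⟩
  · rintro ⟨rfl, rfl⟩; rfl

@[simp] theorem State.setReg_reg (s : State) (r r' : ℕ) (v : ℤ) :
    (s.setReg r v).reg r' = if r' = r then v else s.reg r' := by
  simp [State.setReg, Function.update_apply]

@[simp] theorem State.setReg_arr (s : State) (r : ℕ) (v : ℤ) : (s.setReg r v).arr = s.arr := rfl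

@[simp] theorem State.setMem_reg (s : State) (a v : ℤ) : (s.setMem a v).reg = s.reg := rfl

theorem State.setMem_mem (s : State) (a v a' : ℤ) :
    (s.setMem a v).mem a' = if a' = a then v else s.mem a' := by
  simp [State.setMem, Function.update_apply]

@[simp] theorem State.setMem_arr (s : State) (j j' : Fin 16) (i i' v : ℤ) :
    (s.setMem (cellAddr j i) v).arr j' i' = if j' = j ∧ i' = i then v else s.arr j' i' := by
  simp [State.arr, State.setMem_mem, cellAddr_inj]

theorem State.Bdd.setReg {R : ℕ} {s : State} (hs : s.Bdd R) (r : ℕ) {v : ℤ} (hv : v.natAbs ≤ R) :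
    (s.setReg r v).Bdd R := by
  refine ⟨fun r' => ?_, hs.2⟩
  rw [State.setReg_reg]; split_ifs
  · exact hv
  · exact hs.1 r'

theorem State.Bdd.setMem {R : ℕ} {s : State} (hs : s.Bdd R) (a : ℤ) {v : ℤ} (hv : v.natAbs ≤ R) :
    (s.setMem a v).Bdd R := by
  refine ⟨hs.1, fun r' => ?_⟩
  rw [State.setMem_mem]; split_ifs
  · exact hv
  · exact hs.2 r'

/-! ### Expression and program notation -/

instance : Add Expr := ⟨.op .add⟩
instance : Sub Expr := ⟨.op .sub⟩
instance : Mul Expr := ⟨.op .mul⟩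
instance : Div Expr := ⟨.op .div⟩
instance (n : ℕ) : OfNat Expr n := ⟨.const n⟩

/-- The contents of a register. -/
abbrev rg (r : ℕ) : Expr := .reg r

/-- Comparison of expressions. -/
def Expr.lt (a b : Expr) : Expr := .op .lt a b

/-- Equality test of expressions. -/
def Expr.eq (a b : Expr) : Expr := .op .eq a b

/-- The address of an array cell. -/
def Expr.addr (j : Fin 16) (e : Expr) : Expr :=
  .op .sub (.const (j : ℕ)) (.op .mul (.const 16) (.op .add e (.const 1)))

/-- The contents of an array cell. -/
def ar (j : Fin 16) (e : Expr) : Expr := .mem (.addr j e)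

section eval
variable (s : State) (a b : Expr)

@[simp] theorem eval_add : (a + b).eval s = a.eval s + b.eval s := rfl
@[simp] theorem eval_sub : (a - b).eval s = a.eval s - b.eval s := rfl
@[simp] theorem eval_mul : (a * b).eval s = a.eval s * b.eval s := rfl
@[simp] theorem eval_div : (a / b).eval s = a.eval s / b.eval s := rfl
@[simp] theorem eval_zero : (0 : Expr).eval s = 0 := rfl
@[simp] theorem eval_one : (1 : Expr).eval s = 1 := rfl
@[simp] theorem eval_ofNat (n : ℕ) [n.AtLeastTwo] : (ofNat(n) : Expr).eval s = ofNat(n) := rfl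
@[simp] theorem eval_rg (r : ℕ) : (rg r).eval s = s.reg r := rfl
@[simp] theorem eval_lt : (a.lt b).eval s = if a.eval s < b.eval s then 1 else 0 := rfl
@[simp] theorem eval_eq : (a.eq b).eval s = if a.eval s = b.eval s then 1 else 0 := rfl
@[simp] theorem eval_addr (j : Fin 16) : (Expr.addr j a).eval s = cellAddr j (a.eval s) := rfl
@[simp] theorem eval_ar (j : Fin 16) : (ar j a).eval s = s.arr j (a.eval s) := rfl

end eval

section cost
variable (a b : Expr)

@[simp] theorem cost_add : (a + b).cost = a.cost + b.cost + 1 := rfl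
@[simp] theorem cost_sub : (a - b).cost = a.cost + b.cost + 1 := rfl
@[simp] theorem cost_mul : (a * b).cost = a.cost + b.cost + 1 := rfl
@[simp] theorem cost_div : (a / b).cost = a.cost + b.cost + 1 := rfl
@[simp] theorem cost_zero : (0 : Expr).cost = 1 := rfl
@[simp] theorem cost_one : (1 : Expr).cost = 1 := rfl
@[simp] theorem cost_ofNat (n : ℕ) [n.AtLeastTwo] : (ofNat(n) : Expr).cost = 1 := rfl
@[simp] theorem cost_rg (r : ℕ) : (rg r).cost = 1 := rfl
@[simp] theorem cost_lt : (a.lt b).cost = a.cost + b.cost + 1 := rfl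
@[simp] theorem cost_eq : (a.eq b).cost = a.cost + b.cost + 1 := rfl
@[simp] theorem cost_addr (j : Fin 16) : (Expr.addr j a).cost = a.cost + 6 := by
  simp only [Expr.addr, Expr.cost]; omega
@[simp] theorem cost_ar (j : Fin 16) : (ar j a).cost = a.cost + 7 := by
  simp only [ar, Expr.addr, Expr.cost]; omega

end cost

/-! ### Runs with bounded stored values -/

/-- `Runs` with the bound imposed on the stored values only. -/
inductive RunsR (R : ℕ) : Program → State → ℕ → State → Prop where
  | skip (s : State) : RunsR R .skip s 1 s
  | assign (r : ℕ) (e : Expr) (s : State) (he : (e.eval s).natAbs ≤ R) :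
      RunsR R (.assign r e) s (e.cost + 1) (s.setReg r (e.eval s))
  | store (a e : Expr) (s : State) (he : (e.eval s).natAbs ≤ R) :
      RunsR R (.store a e) s (a.cost + e.cost + 1) (s.setMem (a.eval s) (e.eval s))
  | seq (p q : Program) (s₁ s₂ s₃ : State) (t₁ t₂ : ℕ)
      (hp : RunsR R p s₁ t₁ s₂) (hq : RunsR R q s₂ t₂ s₃) : RunsR R (.seq p q) s₁ (t₁ + t₂) s₃
  | iteTrue (e : Expr) (p q : Program) (s s' : State) (t : ℕ)
      (he : e.eval s ≠ 0) (hp : RunsR R p s t s') : RunsR R (.ite e p q) s (e.cost + 1 + t) s'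
  | iteFalse (e : Expr) (p q : Program) (s s' : State) (t : ℕ)
      (he : e.eval s = 0) (hq : RunsR R q s t s') : RunsR R (.ite e p q) s (e.cost + 1 + t) s'
  | loopStop (e : Expr) (p : Program) (s : State) (he : e.eval s = 0) :
      RunsR R (.loop e p) s (e.cost + 1) s
  | loopStep (e : Expr) (p : Program) (s₁ s₂ s₃ : State) (t₁ t₂ : ℕ)
      (he : e.eval s₁ ≠ 0) (hp : RunsR R p s₁ t₁ s₂) (hl : RunsR R (.loop e p) s₂ t₂ s₃) :
      RunsR R (.loop e p) s₁ (e.cost + 1 + t₁ + t₂) s₃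

/-- The expressions of a fixed program have bounded cost, so a bound on the stored values bounds all
addresses and intermediate results by a fixed power of it. Specifications therefore need to control
only what is stored. -/
theorem RunsR.runs {R : ℕ} (hR : 2 ≤ R) {m : ℕ} {p : Program} {s s' : State} {t : ℕ}
    (h : RunsR R p s t s') (hc : p.maxConst ≤ R) (hm : p.maxCost ≤ m) (hs : s.Bdd R) :
    Runs (R ^ (2 * m)) p s t s' ∧ s'.Bdd R := by
  induction h with
  | skip s => exact ⟨.skip s, hs⟩
  | assign r e s he => exact ⟨.assign r e s (e.within hR hs hc hm), hs.setReg r he⟩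
  | store a e s he =>
    simp only [Program.maxConst, Program.maxCost, max_le_iff] at hc hm
    exact ⟨.store a e s (a.within hR hs hc.1 hm.1) (e.within hR hs hc.2 hm.2), hs.setMem _ he⟩
  | seq p q s₁ s₂ s₃ t₁ t₂ hp hq ihp ihq =>
    simp only [Program.maxConst, Program.maxCost, max_le_iff] at hc hm
    obtain ⟨h1, h2⟩ := ihp hc.1 hm.1 hs
    obtain ⟨h3, h4⟩ := ihq hc.2 hm.2 h2
    exact ⟨.seq _ _ _ _ _ _ _ h1 h3, h4⟩
  | iteTrue e p q s s' t he hp ih =>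
    simp only [Program.maxConst, Program.maxCost, max_le_iff] at hc hm
    obtain ⟨h1, h2⟩ := ih hc.2.1 hm.2.1 hs
    exact ⟨.iteTrue _ _ _ _ _ _ (e.within hR hs hc.1 hm.1) he h1, h2⟩
  | iteFalse e p q s s' t he hp ih =>
    simp only [Program.maxConst, Program.maxCost, max_le_iff] at hc hm
    obtain ⟨h1, h2⟩ := ih hc.2.2 hm.2.2 hs
    exact ⟨.iteFalse _ _ _ _ _ _ (e.within hR hs hc.1 hm.1) he h1, h2⟩
  | loopStop e p s he =>
    simp only [Program.maxConst, Program.maxCost, max_le_iff] at hc hm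
    exact ⟨.loopStop _ _ _ (e.within hR hs hc.1 hm.1) he, hs⟩
  | loopStep e p s₁ s₂ s₃ t₁ t₂ he hp hl ihp ihl =>
    obtain ⟨h1, h2⟩ := ihp (by simp only [Program.maxConst, max_le_iff] at hc; exact hc.2)
      (by simp only [Program.maxCost, max_le_iff] at hm; exact hm.2) hs
    obtain ⟨h3, h4⟩ := ihl hc hm h2
    simp only [Program.maxConst, Program.maxCost, max_le_iff] at hc hm
    exact ⟨.loopStep _ _ _ _ _ _ _ (e.within hR hs hc.1 hm.1) he h1 h3, h4⟩

/-! ### The frame of a program -/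

/-- Whether a program assigns to a register. -/
def Program.writesReg : Program → ℕ → Bool
  | .skip, _ => false
  | .assign r _, r' => r' == r
  | .store _ _, _ => false
  | .seq p q, r => p.writesReg r || q.writesReg r
  | .ite _ p q, r => p.writesReg r || q.writesReg r
  | .loop _ p, r => p.writesReg r

/-- Whether an address may lie in an array. -/
def Expr.mayAddr : Expr → Fin 16 → Bool
  | .op .sub (.const c) (.op .mul (.const 16) (.op .add _ (.const 1))), j => c % 16 == (j : ℕ)
  | _, _ => true

/-- Whether a program may store into an array. -/
def Program.writesArr : Program → Fin 16 → Bool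
  | .skip, _ => false
  | .assign _ _, _ => false
  | .store a _, j => a.mayAddr j
  | .seq p q, r => p.writesArr r || q.writesArr r
  | .ite _ p q, r => p.writesArr r || q.writesArr r
  | .loop _ p, r => p.writesArr r

/-- The residue of an address modulo `16` identifies its array. -/
theorem Expr.eval_ne_addr {a : Expr} {j : Fin 16} (h : a.mayAddr j = false) (s : State) (i : ℤ) :
    cellAddr j i ≠ a.eval s := by
  unfold Expr.mayAddr at h
  split at h
  · simp only [beq_eq_false_iff_ne, ne_eq] at h
    simp only [Expr.eval, Op.apply, cellAddr]
    have := j.2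
    omega
  · simp at h

/-- Everything that a program does not write is unchanged. -/
structure Frame (p : Program) (s s' : State) : Prop where
  reg : ∀ r, p.writesReg r = false → s'.reg r = s.reg r
  arr : ∀ j, p.writesArr j = false → ∀ i, s'.arr j i = s.arr j i

theorem Frame.refl (p : Program) (s : State) : Frame p s s := ⟨fun _ _ => rfl, fun _ _ _ => rfl⟩

theorem Frame.trans {p : Program} {s₁ s₂ s₃ : State} (h : Frame p s₁ s₂) (h' : Frame p s₂ s₃) :
    Frame p s₁ s₃ :=
  ⟨fun r hr => (h'.reg r hr).trans (h.reg r hr),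
    fun j hj i => (h'.arr j hj i).trans (h.arr j hj i)⟩

theorem Frame.mono {p q : Program} {s s' : State} (h : Frame p s s')
    (hr : ∀ r, q.writesReg r = false → p.writesReg r = false)
    (ha : ∀ j, q.writesArr j = false → p.writesArr j = false) : Frame q s s' :=
  ⟨fun r h' => h.reg r (hr r h'), fun j h' => h.arr j (ha j h')⟩

/-- Invariants about other registers and arrays survive a program by this fact; the side conditions
are syntactic and are settled by computation. -/
theorem RunsR.frame {R : ℕ} {p : Program} {s s' : State} {t : ℕ} (h : RunsR R p s t s') :
    Frame p s s' := by
  induction h with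
  | skip s => exact .refl _ _
  | assign r e s he =>
    refine ⟨fun r' hr => ?_, fun j _ i => rfl⟩
    simp only [Program.writesReg, beq_eq_false_iff_ne, ne_eq] at hr
    simp [hr]
  | store a e s he =>
    refine ⟨fun r' hr => rfl, fun j hj i => ?_⟩
    simp only [State.arr, State.setMem_mem, Expr.eval_ne_addr hj s i, if_false]
  | seq p q s₁ s₂ s₃ t₁ t₂ hp hq ihp ihq =>
    exact (ihp.mono (by simp +contextual [Program.writesReg])
      (by simp +contextual [Program.writesArr])).trans
      (ihq.mono (by simp +contextual [Program.writesReg])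
      (by simp +contextual [Program.writesArr]))
  | iteTrue e p q s s' t he hp ih =>
    exact ih.mono (by simp +contextual [Program.writesReg])
      (by simp +contextual [Program.writesArr])
  | iteFalse e p q s s' t he hp ih =>
    exact ih.mono (by simp +contextual [Program.writesReg])
      (by simp +contextual [Program.writesArr])
  | loopStop e p s he => exact .refl _ _
  | loopStep e p s₁ s₂ s₃ t₁ t₂ he hp hl ihp ihl =>
    exact (ihp.mono (by simp [Program.writesReg]) (by simp [Program.writesArr])).trans ihl

/-! ### Total correctness with time bounds -/

/-- Started in `s`, the program halts within time `τ` in a state that satisfies `Q`, and stores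
only values of absolute value at most `R`. -/
def Wp (R : ℕ) (p : Program) (τ : ℕ) (s : State) (Q : State → Prop) : Prop :=
  ∃ t s', RunsR R p s t s' ∧ t ≤ τ ∧ Q s'

section Wp
variable {R : ℕ} {p q : Program} {τ : ℕ} {s : State} {Q : State → Prop}

/-- The new postcondition may use the frame, so that specifications need not list what they leave
alone. -/
theorem Wp.mono {τ' : ℕ} {Q' : State → Prop} (h : Wp R p τ s Q) (hτ : τ ≤ τ')
    (hQ : ∀ s', Frame p s s' → Q s' → Q' s') : Wp R p τ' s Q' := by
  obtain ⟨t, s', h1, h2, h3⟩ := h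
  exact ⟨t, s', h1, h2.trans hτ, hQ _ h1.frame h3⟩

theorem Wp.skip (hQ : Q s) (hτ : 1 ≤ τ) : Wp R .skip τ s Q := ⟨_, _, .skip s, hτ, hQ⟩

theorem Wp.assign {r : ℕ} {e : Expr} (he : (e.eval s).natAbs ≤ R)
    (hQ : Q (s.setReg r (e.eval s))) (hτ : e.cost + 1 ≤ τ) : Wp R (.assign r e) τ s Q :=
  ⟨_, _, .assign r e s he, hτ, hQ⟩

theorem Wp.store {a e : Expr} (he : (e.eval s).natAbs ≤ R)
    (hQ : Q (s.setMem (a.eval s) (e.eval s))) (hτ : a.cost + e.cost + 1 ≤ τ) :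
    Wp R (.store a e) τ s Q :=
  ⟨_, _, .store a e s he, hτ, hQ⟩

theorem Wp.seq {τ₁ τ₂ : ℕ} (h : Wp R p τ₁ s fun s' => Wp R q τ₂ s' Q) (hτ : τ₁ + τ₂ ≤ τ) :
    Wp R (.seq p q) τ s Q := by
  obtain ⟨t, s', h1, h2, t', s'', h3, h4, h5⟩ := h
  exact ⟨_, _, .seq _ _ _ _ _ _ _ h1 h3, by omega, h5⟩

/-- Sequential composition; the second program may use the frame of the first. -/
theorem Wp.seq' {τ₁ τ₂ : ℕ} {I : State → Prop} (h : Wp R p τ₁ s I)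
    (h' : ∀ s', Frame p s s' → I s' → Wp R q τ₂ s' Q) (hτ : τ₁ + τ₂ ≤ τ) :
    Wp R (.seq p q) τ s Q :=
  (h.mono le_rfl h').seq hτ

theorem Wp.assign_seq {r : ℕ} {e : Expr} (he : (e.eval s).natAbs ≤ R)
    (hQ : Wp R q (τ - (e.cost + 1)) (s.setReg r (e.eval s)) Q) (hτ : e.cost + 1 ≤ τ) :
    Wp R (.seq (.assign r e) q) τ s Q :=
  (Wp.assign he hQ le_rfl).seq (by omega)

theorem Wp.store_seq {a e : Expr} (he : (e.eval s).natAbs ≤ R)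
    (hQ : Wp R q (τ - (a.cost + e.cost + 1)) (s.setMem (a.eval s) (e.eval s)) Q)
    (hτ : a.cost + e.cost + 1 ≤ τ) :
    Wp R (.seq (.store a e) q) τ s Q :=
  (Wp.store he hQ le_rfl).seq (by omega)

theorem Wp.ite {e : Expr} (h : e.eval s ≠ 0 → Wp R p (τ - (e.cost + 1)) s Q)
    (h' : e.eval s = 0 → Wp R q (τ - (e.cost + 1)) s Q) (hτ : e.cost + 1 ≤ τ) :
    Wp R (.ite e p q) τ s Q := by
  by_cases he : e.eval s = 0
  · obtain ⟨t, s', h1, h2, h3⟩ := h' he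
    exact ⟨_, _, .iteFalse _ _ _ _ _ _ he h1, by omega, h3⟩
  · obtain ⟨t, s', h1, h2, h3⟩ := h he
    exact ⟨_, _, .iteTrue _ _ _ _ _ _ he h1, by omega, h3⟩

/-- A loop with a measure that decreases at each iteration. -/
theorem Wp.loop {e : Expr} {τ₁ : ℕ} (I : ℕ → State → Prop)
    (step : ∀ j s', I j s' → e.eval s' ≠ 0 → Wp R p τ₁ s' fun s'' => ∃ i < j, I i s'')
    (hQ : ∀ j s', I j s' → e.eval s' = 0 → Q s') :
    ∀ N s, I N s → N * (τ₁ + e.cost + 1) + e.cost + 1 ≤ τ → Wp R (.loop e p) τ s Q := by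
  have main : ∀ N s, I N s → Wp R (.loop e p) (N * (τ₁ + e.cost + 1) + e.cost + 1) s Q := by
    intro N
    induction N using Nat.strong_induction_on with
    | _ N ih =>
      intro s hs
      by_cases he : e.eval s = 0
      · exact ⟨_, _, .loopStop _ _ _ he, by omega, hQ _ _ hs he⟩
      · obtain ⟨t, s', h1, h2, i, hi, h3⟩ := step _ _ hs he
        obtain ⟨t', s'', h4, h5, h6⟩ := ih i hi s' h3
        refine ⟨_, _, .loopStep _ _ _ _ _ _ _ he h1 h4, ?_, h6⟩
        have : (i + 1) * (τ₁ + e.cost + 1) ≤ N * (τ₁ + e.cost + 1) := Nat.mul_le_mul_right _ hi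
        rw [Nat.succ_mul] at this
        omega
  intro N s hs hτ
  exact (main N s hs).mono hτ fun _ _ h => h

/-- The loop `for i := 0, …, b - 1`. -/
def forUp (i b : ℕ) (p : Program) : Program :=
  .seq (.assign i 0) (.loop ((rg i).lt (rg b)) (.seq p (.assign i (rg i + 1))))

/-- `I j` describes the state at the head of iteration `j`, when the counter already holds `j`;
hence the body must establish `I (j + 1)` after the increment. The summand `10` per iteration pays
for the test and the increment. -/
theorem Wp.forUp {i b : ℕ} {τ₁ : ℕ} (I : ℕ → State → Prop) (N : ℕ) (hN : s.reg b = N) (hR : N ≤ R)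
    (hib : b ≠ i) (hi : p.writesReg i = false) (hb : p.writesReg b = false)
    (h0 : I 0 (s.setReg i 0))
    (step : ∀ j < N, ∀ s', Frame (forUp i b p) s s' → s'.reg i = j → s'.reg b = N → I j s' →
      Wp R p τ₁ s' fun s'' => s''.reg i = j → s''.reg b = N → I (j + 1) (s''.setReg i (j + 1 : ℕ)))
    (hQ : ∀ s', Frame (IntRAM.forUp i b p) s s' → s'.reg i = N → I N s' → Q s')
    (hτ : N * (τ₁ + 10) + 10 ≤ τ) :
    Wp R (forUp i b p) τ s Q := by
  have hfr : ∀ {s s'}, Frame p s s' → Frame (IntRAM.forUp i b p) s s' := fun h => h.mono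
    (by simp +contextual [IntRAM.forUp, Program.writesReg])
    (by simp +contextual [IntRAM.forUp, Program.writesArr])
  have hfi : ∀ s v, Frame (IntRAM.forUp i b p) s (s.setReg i v) := fun s v =>
    ⟨fun r hr => by
      simp only [IntRAM.forUp, Program.writesReg, Bool.or_eq_false_iff, beq_eq_false_iff_ne] at hr
      simp [hr.1], fun _ _ _ => rfl⟩
  refine Wp.assign_seq (by simp) ?_ (by simp; omega)
  refine Wp.loop (τ₁ := τ₁ + 4) (I := fun m s' => ∃ j, m + j = N ∧ s'.reg i = j ∧ s'.reg b = N ∧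
    Frame (IntRAM.forUp i b p) s s' ∧ I j s') ?_ ?_ N _ ⟨0, by simp, by simp, by simp [hib, hN],
      hfi _ _, h0⟩ ?_
  · rintro m s' ⟨j, hm, h1, h2, h3, h4⟩ he
    have hj : j < N := by
      by_contra hc
      simp [h1, h2] at he; omega
    refine (step j hj s' h3 h1 h2 h4).seq' (τ₂ := 4) (fun s'' hf hI => ?_) le_rfl
    have e1 : s''.reg i = j := by rw [hf.reg _ hi, h1]
    have e2 : s''.reg b = N := by rw [hf.reg _ hb, h2]
    refine Wp.assign (by simp [e1]; omega) ⟨m - 1, by omega, j + 1, by omega, ?_, ?_, ?_, ?_⟩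
      (by simp)
    · simp [e1]
    · simp [hib, e2]
    · exact (h3.trans (hfr hf)).trans (hfi _ _)
    · simpa [e1] using hI e1 e2
  · rintro m s' ⟨j, hm, h1, h2, h3, h4⟩ he
    have hj : ¬ j < N := by
      intro hc
      simp [h1, h2] at he; omega
    obtain rfl : j = N := by omega
    exact hQ s' h3 h1 h4
  · simp only [cost_lt, cost_rg, cost_zero]
    have : N * (τ₁ + 4 + (1 + 1 + 1) + 1) ≤ N * (τ₁ + 10) := Nat.mul_le_mul_left _ (by omega)
    omega

/-- The register `acc` is set to the sum of the values of `e` for `i := 0, …, b - 1`. -/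
def sumTo (acc i b : ℕ) (e : Expr) : Program :=
  .seq (.assign acc 0) (IntRAM.forUp i b (.assign acc (rg acc + e)))

theorem natAbs_sum_le {ι : Type*} (t : Finset ι) (f : ι → ℤ) {B : ℕ}
    (h : ∀ i ∈ t, (f i).natAbs ≤ B) : (∑ i ∈ t, f i).natAbs ≤ t.card * B := by
  induction t using Finset.cons_induction with
  | empty => simp
  | cons a t ha ih =>
    rw [Finset.sum_cons, Finset.card_cons]
    have h1 := ih fun i hi => h i (by simp [hi])
    have h2 := h a (by simp)
    have h3 := Int.natAbs_add_le (f a) (∑ i ∈ t, f i)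
    rw [Nat.succ_mul]; omega

/-- In `he` the accumulator holds an arbitrary value, because `e` is evaluated among partial sums.
Each partial sum has at most `N` terms, so `N * B` bounds all of them. -/
theorem Wp.sumTo {acc i b : ℕ} {e : Expr} {N : ℕ} (f : Fin N → ℤ) (B : ℕ) (hN : s.reg b = N)
    (hR : N ≤ R) (hib : b ≠ i) (hai : i ≠ acc) (hab : b ≠ acc)
    (he : ∀ j : Fin N, ∀ v, e.eval ((s.setReg acc v).setReg i (j : ℕ)) = f j)
    (hf : ∀ j, (f j).natAbs ≤ B) (hB : N * B ≤ R)
    (hQ : Q ((s.setReg acc (∑ x, f x)).setReg i N))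
    (hτ : N * (e.cost + 13) + 12 ≤ τ) : Wp R (sumTo acc i b e) τ s Q := by
  have hset : ∀ (s : State) (v v' : ℤ), (s.setReg i v).setReg i v' = s.setReg i v' := by
    intro s v v'; simp [State.setReg]
  have hset2 : ∀ (s : State) (v v' v'' : ℤ), (((s.setReg acc v).setReg i v').setReg acc v'') =
      (s.setReg acc v'').setReg i v' := by
    intro s v v' v''; simp only [State.setReg]
    rw [Function.update_comm hai, Function.update_idem]
  let g : ℕ → ℤ := fun j => if h : j < N then f ⟨j, h⟩ else 0
  have hg : ∑ x ∈ Finset.range N, g x = ∑ x, f x := by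
    rw [Finset.sum_range]; exact Finset.sum_congr rfl fun x _ => by simp [g]
  have hgB : ∀ j ≤ N, (∑ x ∈ Finset.range j, g x).natAbs ≤ R := by
    intro j hj
    refine (natAbs_sum_le _ g (B := B) fun i _ => ?_).trans ?_
    · simp only [g]; split_ifs
      · exact hf _
      · simp
    · rw [Finset.card_range]; exact (Nat.mul_le_mul_right _ hj).trans hB
  refine Wp.assign_seq (by simp) ?_ (by simp; omega)
  refine Wp.forUp (τ₁ := e.cost + 3)
    (fun j s' => s' = (s.setReg acc (∑ x ∈ Finset.range j, g x)).setReg i j) N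
    (by simp [hab, hN]) hR hib (by simp [Program.writesReg, hai]) (by simp [Program.writesReg, hab])
    (by simp) ?_ ?_ ?_
  · rintro j hj s' - h1 h2 rfl
    have e1 : (rg acc + e).eval ((s.setReg acc (∑ x ∈ Finset.range j, g x)).setReg i j) =
        ∑ x ∈ Finset.range (j + 1), g x := by
      rw [Finset.sum_range_succ, eval_add, he ⟨j, hj⟩]; simp [hai.symm, g, hj]
    refine Wp.assign (by rw [e1]; exact hgB _ hj) (fun _ _ => ?_) ?_
    · rw [e1, hset2, hset]
    · simp; omega
  · rintro s' - - rfl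
    rw [hg]; exact hQ
  · rw [cost_zero]
    have : N * (e.cost + 3 + 10) = N * (e.cost + 13) := by ring
    omega

/-- The register `bi` is set to an index `i < b` with `cond ≠ 0` that minimises `val`, and `bv` to
that minimum; if there is no such index, `bi` is set to `-1`. -/
def argmin (bi bv i b : ℕ) (cond val : Expr) : Program :=
  .seq (.assign bi (0 - 1)) (.seq (.assign bv 0) (IntRAM.forUp i b
    (.ite (cond * ((rg bi).lt 0 + val.lt (rg bv)))
      (.seq (.assign bv val) (.assign bi (rg i))) .skip)))

/-- The outcome of a search for a minimum of `f` over the `j < N` with `P j`. -/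
def IsArgminBelow (N : ℕ) (P : ℕ → Prop) (f : ℕ → ℤ) (v v' : ℤ) : Prop :=
  (v = -1 ∧ ∀ j < N, ¬ P j) ∨ (∃ j < N, v = j ∧ P j ∧ v' = f j ∧ ∀ j' < N, P j' → f j ≤ f j')

/-- The outcome of a search for a minimum of `f` over the `j` with `P j`. -/
def IsArgmin {N : ℕ} (P : Fin N → Prop) (f : Fin N → ℤ) (v v' : ℤ) : Prop :=
  (v = -1 ∧ ∀ j, ¬ P j) ∨ (∃ j : Fin N, v = (j : ℕ) ∧ P j ∧ v' = f j ∧ ∀ j', P j' → f j ≤ f j')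

/-- The sentinel `-1` in `bi` lets the first admissible index win regardless of `bv`; afterwards
only a strictly smaller value replaces the current one. -/
theorem Wp.argminBelow {bi bv i b : ℕ} {cond val : Expr} (N : ℕ) (hN : s.reg b = N) (hR : N ≤ R)
    (hR1 : 1 ≤ R) (hib : b ≠ i) (h1 : i ≠ bi) (h2 : i ≠ bv) (h3 : b ≠ bi) (h4 : b ≠ bv)
    (h5 : bi ≠ bv) (P : ℕ → Prop) (f : ℕ → ℤ)
    (hc : ∀ j < N, ∀ v v', cond.eval (((s.setReg bi v).setReg bv v').setReg i j) ≠ 0 ↔ P j)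
    (hv : ∀ j < N, ∀ v v', P j → val.eval (((s.setReg bi v).setReg bv v').setReg i j) = f j)
    (hf : ∀ j < N, P j → (f j).natAbs ≤ R)
    (hQ : ∀ v v', IsArgminBelow N P f v v' → Q (((s.setReg bi v).setReg bv v').setReg i N))
    (hτ : N * (cond.cost + 2 * val.cost + 30) + 20 ≤ τ) : Wp R (IntRAM.argmin bi bv i b cond val) τ s Q := by
  have hset : ∀ (s : State) (v v' : ℤ), (s.setReg i v).setReg i v' = s.setReg i v' := by
    intro s v v'; simp [State.setReg]
  have hset2 : ∀ (s : State) (v v' v'' w w' : ℤ),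
      (((((s.setReg bi v).setReg bv v').setReg i v'').setReg bv w).setReg bi w') =
      ((s.setReg bi w').setReg bv w).setReg i v'' := by
    intro s v v' v'' w w'
    simp only [State.setReg]
    congr 1
    funext r
    simp only [Function.update_apply]
    split_ifs <;> simp_all
  refine Wp.assign_seq (by simpa using hR1) (Wp.assign_seq (by simp) ?_ (by simp; omega))
    (by simp; omega)
  refine Wp.forUp (τ₁ := cond.cost + 2 * val.cost + 18)
    (fun j s' => ∃ v v', IsArgminBelow j P f v v' ∧ s' = ((s.setReg bi v).setReg bv v').setReg i j) N
    (by simp [h3, h4, hN]) hR hib (by simp [Program.writesReg, h1, h2])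
    (by simp [Program.writesReg, h3, h4])
    ⟨-1, 0, Or.inl ⟨rfl, by simp⟩, by simp⟩ ?_ ?_ ?_
  · rintro j hj s' - - - ⟨v, v', hvv, rfl⟩
    have ecost : (cond * ((rg bi).lt 0 + val.lt (rg bv))).cost = cond.cost + val.cost + 7 := by
      simp; omega
    have ebi : ((((s.setReg bi v).setReg bv v').setReg i j)).reg bi = v := by simp [h1.symm, h5]
    have ebv : ((((s.setReg bi v).setReg bv v').setReg i j)).reg bv = v' := by simp [h2.symm]
    have ei : ((((s.setReg bi v).setReg bv v').setReg i j)).reg i = j := by simp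
    refine Wp.ite (fun he => ?_) (fun he => ?_) (by rw [ecost]; omega)
    · simp only [eval_mul, ne_eq, mul_eq_zero, not_or, eval_add, eval_lt, eval_rg, ebi, ebv] at he
      have hP : P j := (hc j hj v v').1 he.1
      have e1 := hv j hj v v' hP
      refine Wp.assign_seq (by rw [e1]; exact hf j hj hP) (Wp.assign ?_ ?_ ?_) ?_
      · simp [h2]; omega
      · intro _ _
        refine ⟨j, f j, ?_, ?_⟩
        · refine Or.inr ⟨j, by omega, rfl, hP, rfl, fun j' hj' hP' => ?_⟩
          rcases Nat.lt_succ_iff_lt_or_eq.1 hj' with h | rfl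
          · rcases hvv with ⟨h6, h7⟩ | ⟨j0, h6, h7, h8, h9, h10⟩
            · exact absurd hP' (h7 _ h)
            · have h11 := h10 _ h hP'
              have h12 : f j < v' := by
                by_contra hcon
                have : ¬ (v < 0) := by omega
                simp [this, e1, hcon] at he
              omega
          · exact le_rfl
        · rw [e1]
          simp only [eval_rg, State.setReg_reg, h2, if_false, if_true]
          rw [hset2, hset]
      · rw [ecost]
        show 1 + 1 ≤ _
        omega
      · rw [ecost]; omega
    · refine Wp.skip (fun _ _ => ?_) (by rw [ecost]; omega)
      refine ⟨v, v', ?_, by rw [hset]⟩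
      simp only [eval_mul, mul_eq_zero, eval_add, eval_lt, eval_rg, ebi, ebv] at he
      rcases he with he | he
      · have hP : ¬ P j := fun h => (hc j hj v v').2 h he
        rcases hvv with ⟨h6, h7⟩ | ⟨j0, h6, h7, h8, h9, h10⟩
        · refine Or.inl ⟨h6, fun j' hj' => ?_⟩
          rcases Nat.lt_succ_iff_lt_or_eq.1 hj' with h | rfl
          · exact h7 _ h
          · exact hP
        · refine Or.inr ⟨j0, by omega, h7, h8, h9, fun j' hj' hP' => ?_⟩
          rcases Nat.lt_succ_iff_lt_or_eq.1 hj' with h | rfl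
          · exact h10 _ h hP'
          · exact absurd hP' hP
      · have e3 : ¬ v < 0 := by
          intro h
          simp only [eval_zero, h, if_true] at he
          split_ifs at he <;> omega
        have e4 : ¬ (val.eval (((s.setReg bi v).setReg bv v').setReg i j) < v') := by
          intro h
          simp only [h, if_true] at he
          split_ifs at he <;> omega
        rcases hvv with ⟨h6, h7⟩ | ⟨j0, h6, h7, h8, h9, h10⟩
        · omega
        · refine Or.inr ⟨j0, by omega, h7, h8, h9, fun j' hj' hP' => ?_⟩
          rcases Nat.lt_succ_iff_lt_or_eq.1 hj' with h | rfl
          · exact h10 _ h hP'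
          · rw [hv _ hj v v' hP'] at e4; omega
  · rintro s' - - ⟨v, v', hvv, rfl⟩
    exact hQ v v' hvv
  · rw [cost_sub, cost_zero, cost_one]
    have : N * (cond.cost + 2 * val.cost + 18 + 10) ≤ N * (cond.cost + 2 * val.cost + 30) :=
      Nat.mul_le_mul_left _ (by omega)
    omega

theorem Wp.argmin {bi bv i b : ℕ} {cond val : Expr} {N : ℕ} (P : Fin N → Prop) (f : Fin N → ℤ)
    (hN : s.reg b = N) (hR : N ≤ R)
    (hR1 : 1 ≤ R) (hib : b ≠ i) (h1 : i ≠ bi) (h2 : i ≠ bv) (h3 : b ≠ bi) (h4 : b ≠ bv)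
    (h5 : bi ≠ bv)
    (hc : ∀ j : Fin N, ∀ v v',
      cond.eval (((s.setReg bi v).setReg bv v').setReg i (j : ℕ)) ≠ 0 ↔ P j)
    (hv : ∀ j : Fin N, ∀ v v', P j →
      val.eval (((s.setReg bi v).setReg bv v').setReg i (j : ℕ)) = f j)
    (hf : ∀ j, P j → (f j).natAbs ≤ R)
    (hQ : ∀ v v', IsArgmin P f v v' → Q (((s.setReg bi v).setReg bv v').setReg i N))
    (hτ : N * (cond.cost + 2 * val.cost + 30) + 20 ≤ τ) :
    Wp R (IntRAM.argmin bi bv i b cond val) τ s Q := by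
  refine Wp.argminBelow N hN hR hR1 hib h1 h2 h3 h4 h5 (fun j => ∃ h : j < N, P ⟨j, h⟩)
    (fun j => if h : j < N then f ⟨j, h⟩ else 0) (fun j hj v v' => ?_) (fun j hj v v' hP => ?_)
    (fun j hj hP => ?_) (fun v v' h => hQ v v' ?_) hτ
  · rw [hc ⟨j, hj⟩]; simp [hj]
  · rw [dif_pos hj]; exact hv ⟨j, hj⟩ v v' hP.2
  · rw [dif_pos hj]; exact hf _ hP.2
  · rcases h with ⟨h6, h7⟩ | ⟨j, hj, h6, ⟨_, h7⟩, h8, h9⟩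
    · exact Or.inl ⟨h6, fun j hP => h7 j j.2 ⟨j.2, hP⟩⟩
    · dsimp only at h8 h9
      rw [dif_pos hj] at h8
      refine Or.inr ⟨⟨j, hj⟩, h6, h7, h8, fun j' hP => ?_⟩
      have := h9 j' j'.2 ⟨j'.2, hP⟩
      rwa [dif_pos hj, dif_pos j'.2] at this

/-- The cells `0, …, b - 1` of the array `j` are set to the values of `e`. -/
def fill (j : Fin 16) (i b : ℕ) (e : Expr) : Program :=
  IntRAM.forUp i b (.store (.addr j (rg i)) e)

/-- The expression is evaluated while the array `j` is partly overwritten. What it may still read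
from that array are the cells of negative index, that is, nonnegative addresses, where the input
lies. -/
theorem Wp.fill {j : Fin 16} {i b : ℕ} {e : Expr} {N : ℕ} (f : Fin N → ℤ) (hN : s.reg b = N)
    (hR : N ≤ R) (hib : b ≠ i)
    (he : ∀ x : Fin N, ∀ s' : State, (∀ r, r ≠ i → s'.reg r = s.reg r) → s'.reg i = (x : ℕ) →
      (∀ j', j' ≠ j → ∀ y, s'.arr j' y = s.arr j' y) → (∀ y < 0, s'.arr j y = s.arr j y) →
      e.eval s' = f x)
    (hf : ∀ x, (f x).natAbs ≤ R)
    (hQ : ∀ s' : State, (∀ r, r ≠ i → s'.reg r = s.reg r) →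
      (∀ j', j' ≠ j → ∀ y, s'.arr j' y = s.arr j' y) → (∀ x : Fin N, s'.arr j (x : ℕ) = f x) → Q s')
    (hτ : N * (e.cost + 20) + 10 ≤ τ) : Wp R (fill j i b e) τ s Q := by
  have hfr : ∀ s', Frame (IntRAM.forUp i b (.store (.addr j (rg i)) e)) s s' →
      (∀ r, r ≠ i → s'.reg r = s.reg r) ∧ (∀ j', j' ≠ j → ∀ y, s'.arr j' y = s.arr j' y) := by
    intro s' h
    refine ⟨fun r hr => h.reg r ?_, fun j' hj' => h.arr j' ?_⟩
    · simp [IntRAM.forUp, Program.writesReg, hr]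
    · have : ¬ ((j : ℕ) : ℤ) % 16 = (j' : ℕ) := by
        have := j.2
        have := j'.2
        have : (j : ℕ) ≠ j' := fun h => hj' (Fin.ext h.symm)
        omega
      simp [IntRAM.forUp, Program.writesArr, Expr.addr, Expr.mayAddr, this]
  refine Wp.forUp (τ₁ := e.cost + 10) (fun m s' => (∀ x : Fin N, (x : ℕ) < m → s'.arr j (x : ℕ) = f x) ∧
    ∀ y < 0, s'.arr j y = s.arr j y) N hN hR hib
    (by simp [Program.writesReg]) (by simp [Program.writesReg]) (by simp) ?_ ?_ hτ
  · intro m hm s' h1 h2 h3 h4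
    have e1 : e.eval s' = f ⟨m, hm⟩ := he ⟨m, hm⟩ s' (hfr s' h1).1 h2 (hfr s' h1).2 h4.2
    refine Wp.store (by rw [e1]; exact hf _) (fun _ _ => ⟨fun x hx => ?_, fun y hy => ?_⟩) ?_
    · rw [e1]
      simp only [eval_addr, eval_rg, h2, State.setReg_arr, State.setMem_arr, true_and, Nat.cast_inj]
      rcases Nat.lt_succ_iff_lt_or_eq.1 hx with h | h
      · rw [if_neg (by omega)]; exact h4.1 x h
      · rw [if_pos h]; congr 1; exact Fin.ext h.symm
    · simp only [eval_addr, eval_rg, h2, State.setReg_arr, State.setMem_arr, true_and]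
      rw [if_neg (by omega)]
      exact h4.2 y hy
    · simp; omega
  · intro s' h1 h2 h3
    exact hQ s' (hfr s' h1).1 (hfr s' h1).2 fun x => h3.1 x x.2

end Wp

end IntRAM

namespace TSP

open IntRAM

set_option linter.unusedSectionVars false

/-! ### Merging cycles greedily

A permutation `σ` in which each cycle carries exactly one vertex of a set `E` describes a system of
vertex-disjoint directed paths: an element `x` of `E` is the last vertex of its path, which begins
at `σ x`. -/

section Merge
variable {V : Type*} [Fintype V] [DecidableEq V] (ω : V → V → ℤ) (σ : Equiv.Perm V) (E : Finset V)

/-- The total weight of the links from the end `x` to the beginnings of the other paths. -/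
def rowSum (x : V) : ℤ := ∑ z ∈ E.erase x, ω x (σ z)

/-- The total weight of the links to the beginning of the path of `z` from the other ends. -/
def colSum (z : V) : ℤ := ∑ x ∈ E.erase z, ω x (σ z)

/-- The total weight of all links between different paths. -/
def linkSum : ℤ := ∑ x ∈ E, rowSum ω σ E x

/-- Up to an increasing affine function that does not depend on `x` and `z`, the expected weight
after joining the end `x` to the beginning of the path of `z`. -/
def mergeVal (x z : V) : ℤ :=
  ((E.card : ℤ) - 1) * ω x (σ z) - ω z (σ x) - rowSum ω σ E x - colSum ω σ E z

/-- The expected weight of a cyclic arrangement of the paths, chosen uniformly at random. -/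
def expWeight : ℚ :=
  ∑ v ∈ Eᶜ, (ω v (σ v) : ℚ) +
    if E.card = 1 then ∑ x ∈ E, (ω x (σ x) : ℚ) else (linkSum ω σ E : ℚ) / ((E.card : ℚ) - 1)

theorem linkSum_eq_sum_colSum : linkSum ω σ E = ∑ z ∈ E, colSum ω σ E z := by
  simp only [linkSum, rowSum, colSum]
  rw [Finset.sum_sigma', Finset.sum_sigma']
  refine Finset.sum_bij' (fun p _ => ⟨p.2, p.1⟩) (fun p _ => ⟨p.2, p.1⟩) ?_ ?_ ?_ ?_ ?_ <;>
    simp +contextual [eq_comm]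

variable {σ E}

theorem linkSum_insert {F : Finset V} {x : V} (hx : x ∉ F) :
    linkSum ω σ (insert x F) =
      linkSum ω σ F + ∑ b ∈ F, ω x (σ b) + ∑ a ∈ F, ω a (σ x) := by
  simp only [linkSum, rowSum]
  rw [Finset.sum_insert hx, Finset.erase_insert hx]
  have : ∀ a ∈ F, ∑ z ∈ (insert x F).erase a, ω a (σ z) =
      ω a (σ x) + ∑ z ∈ F.erase a, ω a (σ z) := by
    intro a ha
    have hne : x ≠ a := fun h => hx (h ▸ ha)
    rw [Finset.erase_insert_of_ne hne, Finset.sum_insert (by simp [hx])]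
  rw [Finset.sum_congr rfl this, Finset.sum_add_distrib]
  ring

theorem linkSum_congr {σ' : Equiv.Perm V} (h : ∀ v ∈ E, σ' v = σ v) :
    linkSum ω σ' E = linkSum ω σ E := by
  simp only [linkSum, rowSum]
  refine Finset.sum_congr rfl fun x _ => Finset.sum_congr rfl fun z hz => ?_
  rw [h z (Finset.mem_of_mem_erase hz)]

/-- The links out of `x` and the links into `σ z` disappear; the link from `x` to `σ z` is in both
groups and is added back once. The link from `z` to `σ x` would close up the new path and is no
longer allowed. -/
theorem linkSum_merge {x z : V} (hx : x ∈ E) (hz : z ∈ E) (hxz : x ≠ z) :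
    linkSum ω (σ * Equiv.swap x z) (E.erase x) =
      linkSum ω σ E - rowSum ω σ E x - colSum ω σ E z + ω x (σ z) - ω z (σ x) := by
  obtain ⟨G, hxG, hzG, rfl⟩ : ∃ G : Finset V, x ∉ G ∧ z ∉ G ∧ E = insert x (insert z G) := by
    refine ⟨(E.erase x).erase z, by simp, by simp, ?_⟩
    rw [Finset.insert_erase (by simp [hz, hxz.symm]), Finset.insert_erase hx]
  have h1 : x ∉ insert z G := by simp [hxz, hxG]
  rw [Finset.erase_insert h1, linkSum_insert ω h1, linkSum_insert ω hzG, linkSum_insert ω hzG]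
  have h2 : ∀ v ∈ G, (σ * Equiv.swap x z) v = σ v := by
    intro v hv
    rw [Equiv.Perm.mul_apply, Equiv.swap_apply_of_ne_of_ne (by rintro rfl; exact hxG hv)
      (by rintro rfl; exact hzG hv)]
  rw [linkSum_congr ω h2, Finset.sum_congr rfl fun b hb => by rw [h2 b hb]]
  have h3 : (σ * Equiv.swap x z) z = σ x := by simp
  have h4 : (insert x (insert z G)).erase z = insert x G := by
    rw [Finset.erase_insert_of_ne hxz, Finset.erase_insert hzG]
  simp only [h3, rowSum, colSum, Finset.erase_insert h1, h4, Finset.sum_insert hzG,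
    Finset.sum_insert hxG]
  ring

/-- The multiples of the row sum of `x` cancel, and what remains is the sum of all column sums with
a minus sign. -/
theorem sum_mergeVal_right {x : V} (hx : x ∈ E) :
    ∑ z ∈ E.erase x, mergeVal ω σ E x z = - linkSum ω σ E := by
  simp only [mergeVal, Finset.sum_sub_distrib, ← Finset.mul_sum, Finset.sum_const]
  have h1 : ∑ z ∈ E.erase x, ω x (σ z) = rowSum ω σ E x := rfl
  have h2 : ∑ z ∈ E.erase x, ω z (σ x) = colSum ω σ E x := rfl
  have h3 := Finset.sum_erase_add E (colSum ω σ E) hx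
  rw [← linkSum_eq_sum_colSum] at h3
  rw [h1, h2, Finset.card_erase_of_mem hx, nsmul_eq_mul,
    Nat.cast_sub (Finset.card_pos.2 ⟨x, hx⟩)]
  push_cast
  linarith

theorem sum_mergeVal_left {z : V} (hz : z ∈ E) :
    ∑ x ∈ E.erase z, mergeVal ω σ E x z = - linkSum ω σ E := by
  simp only [mergeVal, Finset.sum_sub_distrib, ← Finset.mul_sum, Finset.sum_const]
  have h1 : ∑ x ∈ E.erase z, ω z (σ x) = rowSum ω σ E z := rfl
  have h2 : ∑ x ∈ E.erase z, ω x (σ z) = colSum ω σ E z := rfl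
  have h3 := Finset.sum_erase_add E (rowSum ω σ E) hz
  rw [h1, h2, Finset.card_erase_of_mem hz, nsmul_eq_mul,
    Nat.cast_sub (Finset.card_pos.2 ⟨z, hz⟩)]
  rw [← linkSum] at h3
  push_cast
  linarith

/-- Some merge does not increase the expected weight. -/
theorem exists_mergeVal_le (hE : 2 ≤ E.card) :
    ∃ x ∈ E, ∃ z ∈ E, x ≠ z ∧ ((E.card : ℤ) - 1) * mergeVal ω σ E x z + linkSum ω σ E ≤ 0 := by
  obtain ⟨x, hx⟩ := Finset.card_pos.1 (by omega : 0 < E.card)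
  by_contra! hcon
  -- For a fixed end `x`, the changes of the mean weight average to zero over `z`, so they cannot
  -- all be positive.
  have h1 : ∑ z ∈ E.erase x, (((E.card : ℤ) - 1) * mergeVal ω σ E x z + linkSum ω σ E) = 0 := by
    rw [Finset.sum_add_distrib, ← Finset.mul_sum, sum_mergeVal_right ω hx, Finset.sum_const,
      Finset.card_erase_of_mem hx, nsmul_eq_mul, Nat.cast_sub (by omega)]
    push_cast; ring
  have h2 : 0 < ∑ z ∈ E.erase x, (((E.card : ℤ) - 1) * mergeVal ω σ E x z + linkSum ω σ E) := by
    refine Finset.sum_pos (fun z hz => ?_) ?_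
    · rw [Finset.mem_erase] at hz
      exact hcon x hx z hz.2 hz.1.symm
    · rw [← Finset.card_pos, Finset.card_erase_of_mem hx]; omega
  omega

theorem sum_compl_merge {x z : V} (hx : x ∈ E) (hz : z ∈ E) :
    ∑ v ∈ (E.erase x)ᶜ, (ω v ((σ * Equiv.swap x z) v) : ℚ) =
      ω x (σ z) + ∑ v ∈ Eᶜ, (ω v (σ v) : ℚ) := by
  rw [Finset.compl_erase, Finset.sum_insert (by simp [hx])]
  congr 1
  · simp
  · refine Finset.sum_congr rfl fun v hv => ?_
    rw [Finset.mem_compl] at hv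
    rw [Equiv.Perm.mul_apply, Equiv.swap_apply_of_ne_of_ne (by rintro rfl; exact hv hx)
      (by rintro rfl; exact hv hz)]

/-- A link between two of `N` paths has probability `1/(N-1)`, and after the merge `1/(N-2)`; the
change therefore has the common denominator `(N-1)(N-2)`. -/
theorem expWeight_merge {x z : V} (hx : x ∈ E) (hz : z ∈ E) (hxz : x ≠ z) (hE : 3 ≤ E.card) :
    expWeight ω (σ * Equiv.swap x z) (E.erase x) = expWeight ω σ E +
      ((((E.card : ℤ) - 1) * mergeVal ω σ E x z + linkSum ω σ E : ℤ) : ℚ) /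
        (((E.card : ℚ) - 1) * ((E.card : ℚ) - 2)) := by
  have hc : (E.erase x).card = E.card - 1 := Finset.card_erase_of_mem hx
  rw [expWeight, expWeight, if_neg (by omega), if_neg (by omega), sum_compl_merge ω hx hz,
    linkSum_merge ω hx hz hxz, hc, Nat.cast_sub (by omega), mergeVal]
  have h3 : (3 : ℚ) ≤ E.card := by exact_mod_cast hE
  have h1 : (E.card : ℚ) - 1 ≠ 0 := by linarith
  have h2 : (E.card : ℚ) - 2 ≠ 0 := by linarith
  have h4 : (E.card : ℚ) - 1 - 1 ≠ 0 := by intro h; apply h2; linarith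
  push_cast
  rw [show (E.card : ℚ) - 1 - 1 = E.card - 2 by ring]
  field_simp
  ring

/-- Two paths have only one cyclic arrangement, so nothing is random any more. -/
theorem expWeight_merge_two {x z : V} (hx : x ∈ E) (hz : z ∈ E) (hxz : x ≠ z) (hE : E.card = 2) :
    expWeight ω (σ * Equiv.swap x z) (E.erase x) = expWeight ω σ E := by
  have hc : (E.erase x).card = 1 := by rw [Finset.card_erase_of_mem hx, hE]
  have hEx : E = {x, z} := by
    symm; apply Finset.eq_of_subset_of_card_le
    · intro v; simp; rintro (rfl | rfl) <;> assumption
    · rw [hE, Finset.card_pair hxz]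
  have hEz : E.erase x = {z} := by
    rw [hEx, Finset.erase_insert (by simp [hxz])]
  rw [expWeight, expWeight, if_pos hc, if_neg (by omega), sum_compl_merge ω hx hz, hEz, hE]
  have : linkSum ω σ E = ω x (σ z) + ω z (σ x) := by
    rw [hEx, linkSum_insert ω (by simp [hxz])]
    simp [linkSum, rowSum]
  rw [this]
  push_cast
  simp
  ring

theorem expWeight_card_one (hE : E.card = 1) : expWeight ω σ E = ∑ v, (ω v (σ v) : ℚ) := by
  rw [expWeight, if_pos hE, add_comm, Finset.sum_add_sum_compl]

/-- With `n` paths of one vertex each, the mean weight is the mean weight `d n` of a Hamilton cycle.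
-/
theorem expWeight_one_univ (h : 2 ≤ Fintype.card V) (h0 : ∀ x, ω x x = 0) :
    expWeight ω (1 : Equiv.Perm V) Finset.univ = (∑ x, ∑ y, ω x y : ℤ) / ((Fintype.card V : ℚ) - 1) := by
  rw [expWeight, Finset.card_univ, if_neg (by omega)]
  simp only [Finset.compl_univ, Finset.sum_empty, zero_add]
  congr 2
  simp only [linkSum, rowSum, Equiv.Perm.one_apply]
  refine Finset.sum_congr rfl fun x _ => ?_
  rw [← Finset.sum_erase_add _ _ (Finset.mem_univ x), h0, add_zero]

/-- Every cycle of `σ` carries exactly one vertex of `E`: there is a labelling, constant on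
the cycles, which maps each vertex to the element of `E` that it reaches. -/
def IsPathSystem (σ : Equiv.Perm V) (E : Finset V) : Prop :=
  ∃ l : V → V, (∀ v, l (σ v) = l v) ∧ (∀ e ∈ E, l e = e) ∧ (∀ v, l v ∈ E) ∧
    ∀ v, Relation.ReflTransGen (fun a b => σ a = b) v (l v)

theorem isPathSystem_one : IsPathSystem (1 : Equiv.Perm V) Finset.univ :=
  ⟨id, by simp, by simp, by simp, fun v => .refl⟩

theorem IsPathSystem.mem_of_fixed (h : IsPathSystem σ E) {v : V} (hv : σ v = v) : v ∈ E := by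
  obtain ⟨l, -, -, h3, h4⟩ := h
  have : ∀ w, Relation.ReflTransGen (fun a b => σ a = b) v w → w = v := by
    intro w hw
    induction hw with
    | refl => rfl
    | tail _ h ih => rw [← h, ih, hv]
  rw [← this _ (h4 v)]; exact h3 v

/-- The cycles through `x` and `z` become one cycle with the end `z`, so the vertices labelled `x`
receive the label `z`. -/
theorem IsPathSystem.merge (h : IsPathSystem σ E) {x z : V} (hx : x ∈ E) (hz : z ∈ E)
    (hxz : x ≠ z) : IsPathSystem (σ * Equiv.swap x z) (E.erase x) := by
  obtain ⟨l, h1, h2, h3, h4⟩ := h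
  have hlx := h2 x hx
  have hlz := h2 z hz
  have hs : ∀ v, v ≠ x → v ≠ z → (σ * Equiv.swap x z) v = σ v := fun v h h' => by
    rw [Equiv.Perm.mul_apply, Equiv.swap_apply_of_ne_of_ne h h']
  have hsx : (σ * Equiv.swap x z) x = σ z := by simp
  have hsz : (σ * Equiv.swap x z) z = σ x := by simp
  -- paths that end in an end other than `x` survive
  have key : ∀ e v, Relation.ReflTransGen (fun a b => σ a = b) v e → l e = e → e ≠ x →
      Relation.ReflTransGen (fun a b => (σ * Equiv.swap x z) a = b) v e := by
    intro e v hv he hex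
    induction hv using Relation.ReflTransGen.head_induction_on with
    | refl => exact .refl
    | head hab hbc ih =>
      rename_i a b
      have hl : ∀ w, Relation.ReflTransGen (fun a b => σ a = b) w e → l w = l e := by
        intro w hw
        induction hw using Relation.ReflTransGen.head_induction_on with
        | refl => rfl
        | head h' _ ih' => rw [← ih', ← h', h1]
      have hla : l a = e := by rw [hl a (.head hab hbc), he]
      have hax : a ≠ x := by rintro rfl; rw [hlx] at hla; exact hex hla.symm
      by_cases haz : a = z
      · subst haz; rw [hlz] at hla; subst hla; exact .refl
      · exact .head (by rw [hs a hax haz]; exact hab) ih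
  have keyx : ∀ v, Relation.ReflTransGen (fun a b => σ a = b) v x → l v = x →
      Relation.ReflTransGen (fun a b => (σ * Equiv.swap x z) a = b) v x := by
    intro v hv
    induction hv using Relation.ReflTransGen.head_induction_on with
    | refl => exact fun _ => .refl
    | head hab hbc ih =>
      rename_i a b
      intro hla
      by_cases hax : a = x
      · subst hax; exact .refl
      · have haz : a ≠ z := by rintro rfl; rw [hlz] at hla; exact hxz hla.symm
        exact .head (by rw [hs a hax haz]; exact hab) (ih (by rw [← hab, h1, hla]))
  refine ⟨fun v => if l v = x then z else l v, fun v => ?_, fun e he => ?_, fun v => ?_, fun v => ?_⟩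
  · dsimp only
    by_cases hvx : v = x
    · subst hvx; rw [hsx, h1, hlz, hlx]; simp
    · by_cases hvz : v = z
      · subst hvz; rw [hsz, h1, hlz, hlx]; simp
      · rw [hs v hvx hvz, h1]
  · rw [Finset.mem_erase] at he
    simp [h2 e he.2, he.1]
  · dsimp only
    split_ifs with hv
    · simp [hz, hxz.symm]
    · simp [hv, h3 v]
  · dsimp only
    split_ifs with hv
    -- A vertex of the old path of `x` reaches `x`, crosses to `σ z` by the new link, and follows
    -- the old path of `z` to its end.
    · refine (keyx v (hv ▸ h4 v) hv).trans ?_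
      refine .head hsx (key z (σ z) ?_ hlz hxz.symm)
      have := h4 (σ z)
      rwa [h1, hlz] at this
    · exact key _ v (h4 v) (h2 _ (h3 v)) hv

/-- Every vertex reaches the only end, so there is only one cycle. -/
theorem IsPathSystem.isCycleOn (h : IsPathSystem σ E) (hE : E.card = 1) :
    σ.IsCycleOn Set.univ := by
  obtain ⟨l, h1, h2, h3, h4⟩ := h
  obtain ⟨e, rfl⟩ := Finset.card_eq_one.1 hE
  have hs : ∀ v w, Relation.ReflTransGen (fun a b => σ a = b) v w → σ.SameCycle v w := by
    intro v w hw
    induction hw with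
    | refl => exact .refl _ _
    | tail _ h ih => rw [← h]; exact Equiv.Perm.sameCycle_apply_right.2 ih
  have hv : ∀ v, σ.SameCycle v e := fun v => by
    have := hs v _ (h4 v)
    rwa [Finset.mem_singleton.1 (h3 v)] at this
  exact ⟨Set.bijOn_univ.2 σ.bijective, fun x _ y _ => (hv x).trans (hv y).symm⟩

/-- A merge moves at most two fixed points. -/
theorem card_moved_merge (x z : V) :
    (Finset.univ.filter fun v => (σ * Equiv.swap x z) v ≠ v).card ≤
      (Finset.univ.filter fun v => σ v ≠ v).card + 2 := by
  have : (Finset.univ.filter fun v => (σ * Equiv.swap x z) v ≠ v) ⊆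
      (Finset.univ.filter fun v => σ v ≠ v) ∪ {x, z} := by
    intro v hv
    simp only [Finset.mem_filter, Finset.mem_univ, true_and, Finset.mem_union, Finset.mem_insert,
      Finset.mem_singleton] at hv ⊢
    by_cases hvx : v = x
    · exact Or.inr (Or.inl hvx)
    by_cases hvz : v = z
    · exact Or.inr (Or.inr hvz)
    left
    rwa [Equiv.Perm.mul_apply, Equiv.swap_apply_of_ne_of_ne hvx hvz] at hv
  refine (Finset.card_le_card this).trans ((Finset.card_union_le _ _).trans ?_)
  have := Finset.card_le_two (a := x) (b := z)
  omega

end Merge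

/-! ### Integer potentials when no merge gains enough -/

section Potential
variable {V : Type*} [Fintype V] [DecidableEq V] (ω : V → V → ℤ) (σ : Equiv.Perm V) (E : Finset V)

/-- The common denominator of the potentials. -/
def potDen : ℤ := ((E.card : ℤ) - 1) * ((E.card : ℤ) - 2)

/-- The numerator of the potential of a vertex. -/
def potNum (x : V) : ℤ :=
  ((E.card : ℤ) - 1) * (rowSum ω σ E x + colSum ω σ E x) - linkSum ω σ E

/-- The rounded potential of a vertex; it is `0` on the vertices moved by `σ`. -/
def pot (x : V) : ℤ :=
  if σ x = x then (2 * potNum ω σ E x + potDen E) / (2 * potDen E) else 0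

/-- Twice the weight, reduced by a potential `Q`. -/
def redWeight (Q : V → ℤ) (x y : V) : ℤ := 2 * ω x y - Q x - Q y

variable {σ E}

theorem redWeight_comm (hsym : ∀ x y, ω x y = ω y x) (Q : V → ℤ) (x y : V) :
    redWeight ω Q x y = redWeight ω Q y x := by
  rw [redWeight, redWeight, hsym]; ring

/-- Two opposite merges together. -/
def mergeSym (σ : Equiv.Perm V) (E : Finset V) (x z : V) : ℤ :=
  ((E.card : ℤ) - 1) * (mergeVal ω σ E x z + mergeVal ω σ E z x) + 2 * linkSum ω σ E

/-- Fixed points of `σ` are paths with one vertex, so the two opposite merges use the same edge.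
With `p = potNum / potDen`, their joint change of the mean is `2ω(x,z) - p(x) - p(z)`. -/
theorem mergeSym_eq (hsym : ∀ x y, ω x y = ω y x) {x z : V} (hx : σ x = x) (hz : σ z = z) :
    mergeSym ω σ E x z = potDen E * (2 * ω x z) - potNum ω σ E x - potNum ω σ E z := by
  simp only [mergeSym, mergeVal, potDen, potNum, hx, hz, hsym z x]
  ring

theorem sum_mergeSym {x : V} (hx : x ∈ E) : ∑ z ∈ E.erase x, mergeSym ω σ E x z = 0 := by
  simp only [mergeSym]
  rw [Finset.sum_add_distrib, ← Finset.mul_sum, Finset.sum_add_distrib, sum_mergeVal_right ω hx,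
    sum_mergeVal_left ω hx, Finset.sum_const, Finset.card_erase_of_mem hx, nsmul_eq_mul,
    Nat.cast_sub (Finset.card_pos.2 ⟨x, hx⟩)]
  push_cast; ring

variable (hE : 3 ≤ E.card)
  (h : ∀ x ∈ E, ∀ z ∈ E, x ≠ z →
    0 < 100 * (((E.card : ℤ) - 1) * mergeVal ω σ E x z + linkSum ω σ E) + potDen E)

-- The hypothesis `h` says that each merge changes the mean by more than `-1/100`; two of them
-- together change it by more than `-1/50`.
include h in
theorem neg_potDen_lt_mergeSym {x z : V} (hx : x ∈ E) (hz : z ∈ E) (hxz : x ≠ z) :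
    - potDen E < 50 * mergeSym ω σ E x z := by
  have h1 := h x hx z hz hxz
  have h2 := h z hz x hx hxz.symm
  have h3 : 100 * mergeSym ω σ E x z =
    100 * (((E.card : ℤ) - 1) * mergeVal ω σ E x z + linkSum ω σ E) +
    100 * (((E.card : ℤ) - 1) * mergeVal ω σ E z x + linkSum ω σ E) := by
    rw [mergeSym]; ring
  linarith

include hE in
theorem potDen_pos : 0 < potDen E := by
  have : (3 : ℤ) ≤ E.card := by exact_mod_cast hE
  exact mul_pos (by linarith) (by linarith)

-- For a fixed `x` the joint changes sum to zero and each exceeds `-1/50`. One of absolute value at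
-- least `1/5` must then be positive, and there is room for only few of these.
include hE h in
theorem card_far_le {x : V} (hx : x ∈ E) :
    10 * ((E.erase x).filter fun z => potDen E ≤ 5 * |mergeSym ω σ E x z|).card ≤ E.card := by
  set B := (E.erase x).filter fun z => potDen E ≤ 5 * |mergeSym ω σ E x z| with hB
  have hd := potDen_pos hE
  have h0 := sum_mergeSym ω (σ := σ) hx
  have h1 : ∑ z ∈ E.erase x, (50 * mergeSym ω σ E x z + potDen E) =
      ((E.card : ℤ) - 1) * potDen E := by
    rw [Finset.sum_add_distrib, ← Finset.mul_sum, h0, Finset.sum_const,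
      Finset.card_erase_of_mem hx, nsmul_eq_mul, Nat.cast_sub (Finset.card_pos.2 ⟨x, hx⟩)]
    push_cast; ring
  have h2 : ∑ z ∈ B, (10 * potDen E) ≤ ∑ z ∈ B, (50 * mergeSym ω σ E x z + potDen E) := by
    refine Finset.sum_le_sum fun z hz => ?_
    simp only [hB, Finset.mem_filter, Finset.mem_erase] at hz
    have h3 := neg_potDen_lt_mergeSym ω h hx hz.1.2 hz.1.1.symm
    have h4 := hz.2
    rcases abs_cases (mergeSym ω σ E x z) with h5 | h5 <;> omega
  have h3 : ∑ z ∈ B, (50 * mergeSym ω σ E x z + potDen E) ≤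
      ∑ z ∈ E.erase x, (50 * mergeSym ω σ E x z + potDen E) := by
    refine Finset.sum_le_sum_of_subset_of_nonneg (Finset.filter_subset _ _) fun z hz _ => ?_
    rw [Finset.mem_erase] at hz
    have := neg_potDen_lt_mergeSym ω h hx hz.2 hz.1.symm
    linarith
  rw [Finset.sum_const, nsmul_eq_mul] at h2
  have h4 : (B.card * 10 : ℤ) * potDen E ≤ ((E.card : ℤ) - 1) * potDen E := by linarith
  have h5 := le_of_mul_le_mul_right h4 hd
  omega

variable (hsym : ∀ x y, ω x y = ω y x) (hps : IsPathSystem σ E)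
  (hU : 3 * E.card + 30 ≤ 10 * (Finset.univ.filter fun v => σ v = v).card)

-- Choose `y`, `z` such that the three pairs among `x`, `y`, `z` have joint changes below `1/5` in
-- absolute value; `hU` leaves room for this choice. Adding the relations for `xy` and `xz` and
-- subtracting that for `yz` gives `2p(x) ≈ 2(ω(x,y) + ω(x,z) - ω(y,z))` with error below `3/5`, so
-- `p(x)` is within `3/10` of an integer.
include hE h hsym hps hU in
theorem pot_near {x : V} (hx : σ x = x) :
    10 * |potNum ω σ E x - potDen E * pot ω σ E x| < 3 * potDen E := by
  have hd := potDen_pos hE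
  set U := Finset.univ.filter fun v => σ v = v with hUd
  have hUE : ∀ v ∈ U, v ∈ E := fun v hv => hps.mem_of_fixed (by simpa [hUd] using hv)
  have hxU : x ∈ U := by simp [hUd, hx]
  let B : V → Finset V := fun x => (E.erase x).filter fun z => potDen E ≤ 5 * |mergeSym ω σ E x z|
  have hB : ∀ v ∈ U, 10 * (B v).card ≤ E.card := fun v hv => card_far_le ω hE h (hUE v hv)
  have hgood : ∀ v ∈ U, ∀ z ∈ U, z ≠ v → z ∉ B v → 5 * |mergeSym ω σ E v z| < potDen E := by
    intro v hv z hz hne hzB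
    by_contra hcon
    exact hzB (by simp [B, hne, hUE z hz]; linarith)
  obtain ⟨y, hyU, hy⟩ : ∃ y ∈ U, y ∉ insert x (B x) := by
    apply Finset.exists_mem_notMem_of_card_lt_card
    have := Finset.card_insert_le x (B x)
    have := hB x hxU
    omega
  obtain ⟨z, hzU, hz⟩ : ∃ z ∈ U, z ∉ insert x (insert y (B x ∪ B y)) := by
    apply Finset.exists_mem_notMem_of_card_lt_card
    have := Finset.card_insert_le x (insert y (B x ∪ B y))
    have := Finset.card_insert_le y (B x ∪ B y)
    have := Finset.card_union_le (B x) (B y)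
    have := hB x hxU
    have := hB y hyU
    omega
  simp only [Finset.mem_insert, Finset.mem_union, not_or] at hy hz
  have g1 := hgood x hxU y hyU hy.1 hy.2
  have g2 := hgood x hxU z hzU hz.1 hz.2.2.1
  have g3 := hgood y hyU z hzU hz.2.1 hz.2.2.2
  have hfix : ∀ v ∈ U, σ v = v := fun v hv => by simpa [hUd] using hv
  rw [mergeSym_eq ω hsym hx (hfix y hyU)] at g1
  rw [mergeSym_eq ω hsym hx (hfix z hzU)] at g2
  rw [mergeSym_eq ω hsym (hfix y hyU) (hfix z hzU)] at g3
  set q := ω x y + ω x z - ω y z with hq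
  have key : 10 * |potNum ω σ E x - potDen E * q| < 3 * potDen E := by
    have e : potDen E * q = potDen E * ω x y + potDen E * ω x z - potDen E * ω y z := by
      rw [hq]; ring
    rw [e]
    have e1 : potDen E * (2 * ω x y) = 2 * (potDen E * ω x y) := by ring
    have e2 : potDen E * (2 * ω x z) = 2 * (potDen E * ω x z) := by ring
    have e3 : potDen E * (2 * ω y z) = 2 * (potDen E * ω y z) := by ring
    rw [e1] at g1; rw [e2] at g2; rw [e3] at g3
    have a1 := abs_le.1 (le_refl |2 * (potDen E * ω x y) - potNum ω σ E x - potNum ω σ E y|)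
    have a2 := abs_le.1 (le_refl |2 * (potDen E * ω x z) - potNum ω σ E x - potNum ω σ E z|)
    have a3 := abs_le.1 (le_refl |2 * (potDen E * ω y z) - potNum ω σ E y - potNum ω σ E z|)
    rcases abs_cases (potNum ω σ E x -
      (potDen E * ω x y + potDen E * ω x z - potDen E * ω y z)) with h5 | h5 <;> omega
  -- An error below one half means that rounding finds exactly this integer.
  have hpot : pot ω σ E x = q := by
    rw [pot, if_pos hx, Int.ediv_eq_iff_of_pos (by linarith)]
    have a := abs_le.1 (le_refl |potNum ω σ E x - potDen E * q|)
    have e : q * (2 * potDen E) = 2 * (potDen E * q) := by ring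
    have e' : (q + 1) * (2 * potDen E) = 2 * (potDen E * q) + 2 * potDen E := by ring
    constructor <;> nlinarith
  rw [hpot]; exact key

-- Replacing `p` by the rounded potential costs at most `3/10` per end, so the reduced weight
-- exceeds `-1/50 - 6/10 > -1`; it is an integer.
include hE h hsym hps hU in
theorem redWeight_pot_nonneg {x y : V} (hx : σ x = x) (hy : σ y = y) (hxy : x ≠ y) :
    0 ≤ redWeight ω (pot ω σ E) x y := by
  have hd := potDen_pos hE
  have h1 := pot_near ω hE h hsym hps hU hx
  have h2 := pot_near ω hE h hsym hps hU hy
  have h3 := neg_potDen_lt_mergeSym ω h (hps.mem_of_fixed hx) (hps.mem_of_fixed hy) hxy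
  rw [mergeSym_eq ω hsym hx hy] at h3
  have a1 := abs_le.1 (le_refl |potNum ω σ E x - potDen E * pot ω σ E x|)
  have a2 := abs_le.1 (le_refl |potNum ω σ E y - potDen E * pot ω σ E y|)
  have h4 : potDen E * (-1) < potDen E * redWeight ω (pot ω σ E) x y := by
    rw [redWeight]; nlinarith
  have := lt_of_mul_lt_mul_left h4 hd.le
  omega

-- For such a pair the reduced weight is a nonnegative integer below `1/5 + 6/10 < 1`.
include hE h hsym hps hU in
theorem redWeight_pot_eq_zero {x y : V} (hx : σ x = x) (hy : σ y = y) (hxy : x ≠ y)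
    (hg : 5 * |mergeSym ω σ E x y| < potDen E) : redWeight ω (pot ω σ E) x y = 0 := by
  have hd := potDen_pos hE
  have h0 := redWeight_pot_nonneg ω hE h hsym hps hU hx hy hxy
  have h1 := pot_near ω hE h hsym hps hU hx
  have h2 := pot_near ω hE h hsym hps hU hy
  rw [mergeSym_eq ω hsym hx hy] at hg
  have a1 := abs_le.1 (le_refl |potNum ω σ E x - potDen E * pot ω σ E x|)
  have a2 := abs_le.1 (le_refl |potNum ω σ E y - potDen E * pot ω σ E y|)
  have a3 := abs_le.1
    (le_refl |potDen E * (2 * ω x y) - potNum ω σ E x - potNum ω σ E y|)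
  have h4 : potDen E * redWeight ω (pot ω σ E) x y < potDen E * 1 := by
    rw [redWeight]; nlinarith
  have := lt_of_mul_lt_mul_left h4 hd.le
  omega

include hE h hsym hps hU in
theorem card_redWeight_pot_ne_zero_le {x : V} (hx : σ x = x) :
    10 * (Finset.univ.filter fun y => σ y = y ∧ y ≠ x ∧ redWeight ω (pot ω σ E) x y ≠ 0).card ≤
      E.card := by
  refine le_trans (Nat.mul_le_mul_left _ (Finset.card_le_card ?_))
    (card_far_le ω hE h (hps.mem_of_fixed hx))
  intro y hy
  simp only [Finset.mem_filter, Finset.mem_univ, true_and, Finset.mem_erase] at hy ⊢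
  refine ⟨⟨hy.2.1, hps.mem_of_fixed hy.1⟩, ?_⟩
  by_contra hcon
  exact hy.2.2 (redWeight_pot_eq_zero ω hE h hsym hps hU hx hy.1 hy.2.1.symm (not_le.1 hcon))

end Potential

/-! ### Costs of open vertex sequences -/

section PathCost
variable {V : Type*} (c : V → V → ℤ)

/-- The sum of the costs of consecutive elements of a list. -/
def pathCost : List V → ℤ
  | [] => 0
  | [_] => 0
  | x :: y :: l => c x y + pathCost (y :: l)

@[simp] theorem pathCost_cons_cons (x y : V) (l : List V) :
    pathCost c (x :: y :: l) = c x y + pathCost c (y :: l) := rfl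

@[simp] theorem pathCost_singleton (x : V) : pathCost c [x] = 0 := rfl

theorem pathCost_append (l₁ l₂ : List V) (x : V) :
    pathCost c (l₁ ++ x :: l₂) = pathCost c (l₁ ++ [x]) + pathCost c (x :: l₂) := by
  induction l₁ with
  | nil => simp
  | cons y l ih =>
    cases l with
    | nil => simp
    | cons z l => simp only [List.cons_append, pathCost_cons_cons] at ih ⊢; rw [ih]; ring

theorem pathCost_of_forall {A : Set V} (hc : ∀ x ∉ A, ∀ y ∉ A, c x y = 0) (l : List V) (x f : V)
    (hl : ∀ y ∈ l, y ∉ A) (hx : x ∉ A) : pathCost c (l ++ [x] ++ [f]) = c x f := by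
  induction l with
  | nil => simp
  | cons y l ih =>
    have ih := ih fun z hz => hl z (by simp [hz])
    have hy := hl y (by simp)
    cases l with
    | nil => simp [hc y hy x hx]
    | cons z l =>
      simp only [List.cons_append, pathCost_cons_cons] at ih ⊢
      rw [ih, hc y hy z (hl z (by simp)), zero_add]

/-- Deleting elements that lie outside `S ⊇ A` and have both neighbours outside `A` does not
change the cost. -/
theorem pathCost_filter {A : Set V} {S : V → Prop} [DecidablePred S] (hAS : ∀ x ∈ A, S x)
    (hc : ∀ x ∉ A, ∀ y ∉ A, c x y = 0) (u r : V) (hu : ¬ S u) (hr : r ∉ A) :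
    ∀ (l : List V) (p x : V),
      List.IsChain (fun x y => (¬ S x → y ∉ A) ∧ (¬ S y → x ∉ A)) (p :: (l ++ [u])) →
      -- Here `p` is the last element read and `x` the last one kept. They coincide unless `p` was
      -- deleted, and then `x` lies outside `A`, so its next link is free or starts outside `A` as
      -- that of `p` does.
      (p = x ∨ (¬ S p ∧ x ∉ A)) →
      pathCost c (x :: (l.filter (fun y => decide (S y)) ++ [r])) = pathCost c (p :: (l ++ [u])) := by
  have hSA : ∀ x, ¬ S x → x ∉ A := fun x hx hxA => hx (hAS x hxA)
  intro l
  induction l with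
  | nil =>
    intro p x hch hpx
    simp only [List.nil_append, List.isChain_cons_cons] at hch
    have hp : p ∉ A := hch.1.2 hu
    have hx : x ∉ A := by rcases hpx with rfl | h; exacts [hp, h.2]
    simp [hc x hx r hr, hc p hp u (hSA u hu)]
  | cons y l ih =>
    intro p x hch hpx
    simp only [List.cons_append, List.isChain_cons_cons] at hch
    by_cases hy : S y
    · rw [List.filter_cons_of_pos (by simpa using hy)]
      simp only [List.cons_append, pathCost_cons_cons]
      rw [ih y y hch.2 (Or.inl rfl)]
      congr 1
      rcases hpx with rfl | ⟨h1, h2⟩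
      · rfl
      · rw [hc x h2 y (hch.1.1 h1), hc p (hSA p h1) y (hch.1.1 h1)]
    · rw [List.filter_cons_of_neg (by simpa using hy)]
      simp only [List.cons_append, pathCost_cons_cons]
      have hp : p ∉ A := hch.1.2 hy
      have hx : x ∉ A := by rcases hpx with rfl | h; exacts [hp, h.2]
      rw [ih y x hch.2 (Or.inr ⟨hy, hx⟩), hc p hp y (hSA y hy), zero_add]

end PathCost

/-! ### Costs of closed tours -/

section Tour
variable {n : ℕ} [NeZero n] {V : Type*} (c : V → V → ℤ)

/-- The cost of the closed tour `t 0, …, t (n - 1)`. -/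
def tourCost (t : Fin n → V) : ℤ := ∑ i, c (t i) (t (i + 1))

theorem pathCost_ofFn_append {m : ℕ} (t : Fin (m + 1) → V) (y : V) :
    pathCost c (List.ofFn t ++ [y]) =
      ∑ i : Fin m, c (t i.castSucc) (t i.succ) + c (t (Fin.last m)) y := by
  induction m with
  | zero => simp
  | succ m ih =>
    have h2 := ih (fun i => t i.succ)
    rw [List.ofFn_succ, List.ofFn_succ, List.cons_append, List.cons_append, pathCost_cons_cons,
      Fin.sum_univ_succ, ← List.cons_append]
    rw [List.ofFn_succ] at h2
    rw [h2]
    simp only [Fin.castSucc_zero, Fin.succ_castSucc, Fin.succ_last]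
    ring

theorem tourCost_eq_pathCost (t : Fin n → V) :
    tourCost c t = pathCost c (List.ofFn t ++ [t 0]) := by
  obtain ⟨m, rfl⟩ : ∃ m, n = m + 1 := ⟨n - 1, (Nat.succ_pred_eq_of_ne_zero (NeZero.ne n)).symm⟩
  rw [pathCost_ofFn_append, tourCost, Fin.sum_univ_castSucc]
  simp

theorem tourCost_rotate (t : Fin n → V) (a : Fin n) :
    tourCost c (fun i => t (i + a)) = tourCost c t := by
  unfold tourCost
  rw [← Equiv.sum_comp (Equiv.addRight a) fun i => c (t i) (t (i + 1))]
  refine Finset.sum_congr rfl fun i _ => ?_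
  simp only [Equiv.coe_addRight]
  rw [add_right_comm]

end Tour

/-! ### Reduction to a kernel around the exceptional set -/

section Kernel
variable {n : ℕ} [NeZero n] {c : Fin n → Fin n → ℤ} {A S : Finset (Fin n)}

/-- The positions of a tour next to an element of `A`. -/
def NextTo (A : Finset (Fin n)) (t : Equiv.Perm (Fin n)) (i : Fin n) : Prop :=
  t (i - 1) ∈ A ∨ t (i + 1) ∈ A

open Classical in
theorem card_nextTo_le (t : Equiv.Perm (Fin n)) :
    (Finset.univ.filter fun v => NextTo A t (t.symm v)).card ≤ 2 * A.card := by
  have h : (Finset.univ.filter fun v => NextTo A t (t.symm v)) ⊆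
      A.image (fun a => t (t.symm a + 1)) ∪ A.image (fun a => t (t.symm a - 1)) := by
    intro v hv
    rw [Finset.mem_filter] at hv
    simp only [Finset.mem_union, Finset.mem_image]
    rcases hv.2 with h | h
    · exact Or.inl ⟨_, h, by simp⟩
    · exact Or.inr ⟨_, h, by simp⟩
  refine (Finset.card_le_card h).trans ((Finset.card_union_le _ _).trans ?_)
  have h1 := Finset.card_image_le (s := A) (f := fun a => t (t.symm a + 1))
  have h2 := Finset.card_image_le (s := A) (f := fun a => t (t.symm a - 1))
  omega

variable (hn : 3 ≤ n) (hsym : ∀ x y, c x y = c y x) (hAS : A ⊆ S)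
  (hc : ∀ x ∉ A, ∀ y ∉ A, c x y = 0)
  (hS : ∀ u ∉ S, ∀ a ∈ A, ∀ a' ∈ A,
    3 * A.card ≤ ((S \ A).filter fun v => c a v + c a' v ≤ c a u + c a' u).card)

-- Since `v` and its neighbours lie outside `A`, the links at the place of `v` are free before and
-- after the exchange. Only the links at the place of `u` count, and there `hle` compares `v` with
-- `u` over those neighbours that are in `A`.
include hn hsym hc in
theorem tourCost_swap_le (t : Equiv.Perm (Fin n)) {u v : Fin n} (hu : u ∉ A) (hv : v ∉ A)
    (hva : ¬ NextTo A t (t.symm v))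
    (hle : ∀ a a', t (t.symm u - 1) = a → t (t.symm u + 1) = a' →
      (a ∈ A → a' ∈ A → c a v + c a' v ≤ c a u + c a' u) ∧
      (a ∈ A → a' ∉ A → c a v ≤ c a u) ∧ (a' ∈ A → a ∉ A → c a' v ≤ c a' u)) :
    tourCost c (Equiv.swap u v * t) ≤ tourCost c t := by
  set i := t.symm u with hi
  have hti : t i = u := by simp [hi]
  have h1 : i - 1 ≠ i := by
    intro h
    have h3 := sub_eq_self.1 h
    have : (1 : Fin n).val = 1 := by rw [Fin.val_one', Nat.mod_eq_of_lt (by omega)]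
    rw [h3] at this; simp at this
  have h1' : ∀ j : Fin n, j + 1 ≠ j := by
    intro j h
    have h3 := add_eq_left.1 h
    have : (1 : Fin n).val = 1 := by rw [Fin.val_one', Nat.mod_eq_of_lt (by omega)]
    rw [h3] at this; simp at this
  have swA : ∀ w ∈ A, Equiv.swap u v w = w := fun w hw =>
    Equiv.swap_apply_of_ne_of_ne (by rintro rfl; exact hu hw) (by rintro rfl; exact hv hw)
  have swU : ∀ w ∉ A, Equiv.swap u v w ∉ A := fun w hw => by
    rw [Equiv.swap_apply_def]; split_ifs <;> assumption
  rw [← sub_nonpos, tourCost, tourCost, ← Finset.sum_sub_distrib]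
  rw [← Finset.sum_subset (Finset.subset_univ {i - 1, i}), Finset.sum_pair h1]
  · have hL : c ((Equiv.swap u v * t) (i - 1)) ((Equiv.swap u v * t) (i - 1 + 1)) -
        c (t (i - 1)) (t (i - 1 + 1)) =
        if t (i - 1) ∈ A then c (t (i - 1)) v - c (t (i - 1)) u else 0 := by
      simp only [sub_add_cancel, Equiv.Perm.mul_apply, hti, Equiv.swap_apply_left]
      split_ifs with h
      · rw [swA _ h]
      · rw [hc _ (swU _ h) _ hv, hc _ h _ hu, sub_zero]
    have hR : c ((Equiv.swap u v * t) i) ((Equiv.swap u v * t) (i + 1)) -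
        c (t i) (t (i + 1)) =
        if t (i + 1) ∈ A then c (t (i + 1)) v - c (t (i + 1)) u else 0 := by
      simp only [Equiv.Perm.mul_apply, hti, Equiv.swap_apply_left]
      split_ifs with h
      · rw [swA _ h, hsym v, hsym u]
      · rw [hc _ hv _ (swU _ h), hc _ hu _ h, sub_zero]
    rw [hL, hR]
    obtain ⟨h3, h4, h5⟩ := hle _ _ rfl rfl
    split_ifs with h6 h7 h7
    · linarith [h3 h6 h7]
    · linarith [h4 h6 h7]
    · linarith [h5 h7 h6]
    · simp
  -- A link away from `u` changes only if `v` is one of its ends, and then both versions are free.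
  · intro j _ hj
    simp only [Finset.mem_insert, Finset.mem_singleton, not_or] at hj
    have hj1 : t j ≠ u := fun h => hj.2 (by rw [hi, ← h]; simp)
    have hj2 : t (j + 1) ≠ u := fun h => hj.1 (by rw [hi, ← h]; simp)
    simp only [Equiv.Perm.mul_apply]
    by_cases h3 : t j = v
    · have h4 : t (j + 1) ∉ A := fun h => hva (Or.inr (by rw [← h3]; simpa using h))
      rw [h3, hc _ hv _ h4, hc _ (swU _ hv) _ (swU _ h4), sub_zero]
    · by_cases h4 : t (j + 1) = v
      · have h5 : t j ∉ A := fun h => hva (Or.inl (by rw [← h4]; simpa using h))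
        rw [h4, hc _ h5 _ hv, hc _ (swU _ h5) _ (swU _ hv), sub_zero]
      · rw [Equiv.swap_apply_of_ne_of_ne hj1 h3, Equiv.swap_apply_of_ne_of_ne hj2 h4, sub_self]

open Classical in
include hn hsym hAS hc hS in
/-- A tour can be changed, at no cost, so that the vertices outside the kernel are not next
to `A`. -/
theorem exists_tour_not_nextTo (t : Equiv.Perm (Fin n)) :
    ∃ t' : Equiv.Perm (Fin n), tourCost c t' ≤ tourCost c t ∧ ∀ i, t' i ∉ S → ¬ NextTo A t' i := by
  induction hm : (Finset.univ.filter fun i => t i ∉ S ∧ NextTo A t i).card using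
    Nat.strong_induction_on generalizing t with
  | _ m ih =>
    by_cases h0 : ∀ i, t i ∉ S → ¬ NextTo A t i
    · exact ⟨t, le_rfl, h0⟩
    push Not at h0
    obtain ⟨i, hiS, hi⟩ := h0
    set u := t i with hu
    have hti : t.symm u = i := by simp [hu]
    have huA : u ∉ A := fun h => hiS (hAS h)
    -- a suitable pair of neighbours
    obtain ⟨a, ha, a', ha', haa⟩ : ∃ a ∈ A, ∃ a' ∈ A, ∀ v, c a v + c a' v ≤ c a u + c a' u →
        ∀ b b', t (t.symm u - 1) = b → t (t.symm u + 1) = b' →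
      (b ∈ A → b' ∈ A → c b v + c b' v ≤ c b u + c b' u) ∧
      (b ∈ A → b' ∉ A → c b v ≤ c b u) ∧ (b' ∈ A → b ∉ A → c b' v ≤ c b' u) := by
      rw [hti]
      by_cases h1 : t (i - 1) ∈ A
      · by_cases h2 : t (i + 1) ∈ A
        · refine ⟨_, h1, _, h2, ?_⟩
          rintro v hv b b' rfl rfl
          exact ⟨fun _ _ => hv, fun _ h => absurd h2 h, fun _ h => absurd h1 h⟩
        · refine ⟨_, h1, _, h1, ?_⟩
          rintro v hv b b' rfl rfl
          exact ⟨fun _ h => absurd h h2, fun _ _ => by linarith, fun h => absurd h h2⟩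
      · have h2 : t (i + 1) ∈ A := hi.resolve_left h1
        refine ⟨_, h2, _, h2, ?_⟩
        rintro v hv b b' rfl rfl
        exact ⟨fun h => absurd h h1, fun h => absurd h h1, fun _ _ => by linarith⟩
    -- There are `3|A|` candidates that are no more expensive than `u`, and at most `2|A|` vertices
    -- are next to `A`.
    obtain ⟨v, hv, hv'⟩ : ∃ v ∈ (S \ A).filter fun v => c a v + c a' v ≤ c a u + c a' u,
        v ∉ Finset.univ.filter fun v => NextTo A t (t.symm v) := by
      apply Finset.exists_mem_notMem_of_card_lt_card
      have h1 := hS u hiS a ha a' ha'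
      have h2 := card_nextTo_le (A := A) t
      have h3 := Finset.card_pos.2 ⟨a, ha⟩
      omega
    simp only [Finset.mem_filter, Finset.mem_sdiff, Finset.mem_univ, true_and] at hv hv'
    have hvA := hv.1.2
    have hwA : ∀ w, Equiv.swap u v w ∈ A ↔ w ∈ A := fun w => by
      rw [Equiv.swap_apply_def]; split_ifs with h1 h2
      · subst h1; simp [huA, hvA]
      · subst h2; simp [huA, hvA]
      · rfl
    have hnext : ∀ j, NextTo A (Equiv.swap u v * t) j ↔ NextTo A t j := fun j => by
      simp only [NextTo, Equiv.Perm.mul_apply, hwA]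
    -- The exchange puts the kernel vertex `v` at position `i` and sends `u` to a position that is
    -- not next to `A`, so the number of bad positions drops.
    have hcost := tourCost_swap_le hn hsym hc t huA hvA hv' (haa v hv.2)
    have hlt : (Finset.univ.filter fun i => (Equiv.swap u v * t) i ∉ S ∧
        NextTo A (Equiv.swap u v * t) i).card < m := by
      rw [← hm]
      apply Finset.card_lt_card
      rw [Finset.ssubset_iff_of_subset]
      · refine ⟨i, Finset.mem_filter.2 ⟨Finset.mem_univ _, hiS, hi⟩, fun h => ?_⟩
        refine (Finset.mem_filter.1 h).2.1 ?_
        rw [Equiv.Perm.mul_apply, ← hu, Equiv.swap_apply_left]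
        exact hv.1.1
      · intro j hj
        rw [Finset.mem_filter] at hj ⊢
        obtain ⟨h1, h2, h3⟩ := hj
        rw [hnext] at h3
        refine ⟨h1, fun h4 => h2 ?_, h3⟩
        have h5 : t j ≠ u := fun h => hiS (h ▸ h4)
        have h6 : t j ≠ v := fun h => hv' (by rw [← h]; simpa using h3)
        rwa [Equiv.Perm.mul_apply, Equiv.swap_apply_of_ne_of_ne h5 h6]
    obtain ⟨t', h1, h2⟩ := ih _ hlt (Equiv.swap u v * t) rfl
    exact ⟨t', h1.trans hcost, h2⟩

/-- A list without repetitions that contains everything is a tour. -/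
theorem exists_perm_ofFn_eq {L : List (Fin n)} (hL : L.Nodup) (hlen : L.length = n) :
    ∃ t : Equiv.Perm (Fin n), List.ofFn t = L := by
  have hinj : Function.Injective fun i : Fin n => L.get (Fin.cast hlen.symm i) :=
    (List.nodup_iff_injective_get.1 hL).comp (Fin.cast_injective _)
  refine ⟨Equiv.ofBijective _ (Finite.injective_iff_bijective.1 hinj), ?_⟩
  refine List.ext_getElem (by simp [hlen]) fun i h1 h2 => by simp

include hn hsym hAS hc hS in
/-- Up to the order of the vertices of the kernel, there is a best tour that visits the kernel
first. -/
theorem exists_tour_kernel_first (ord : Equiv.Perm (Fin n)) {K : ℕ}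
    (hK : ∀ i, ord i ∈ S ↔ (i : ℕ) < K) (t : Equiv.Perm (Fin n)) :
    ∃ t' : Equiv.Perm (Fin n), tourCost c t' ≤ tourCost c t ∧ ∀ i : Fin n, K ≤ i → t' i = ord i := by
  by_cases hKn : n ≤ K
  · exact ⟨t, le_rfl, fun i hi => absurd i.2 (by omega)⟩
  push Not at hKn
  obtain ⟨t₁, ht₁, hnext⟩ := exists_tour_not_nextTo hn hsym hAS hc hS t
  set u := ord ⟨K, hKn⟩ with hu
  have huS : u ∉ S := by rw [hK]; simp
  -- rotate so that the tour starts at `u`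
  set t₂ : Equiv.Perm (Fin n) := (Equiv.addRight (t₁.symm u)).trans t₁ with ht₂
  have h20 : t₂ 0 = u := by simp [ht₂]
  have hcost2 : tourCost c t₂ = tourCost c t₁ := tourCost_rotate c t₁ (t₁.symm u)
  have hnext2 : ∀ i, (t₂ i ∉ S → t₂ (i + 1) ∉ A) ∧ (t₂ (i + 1) ∉ S → t₂ i ∉ A) := by
    intro i
    have e : t₂ (i + 1) = t₁ (i + t₁.symm u + 1) := by
      simp only [ht₂, Equiv.trans_apply, Equiv.coe_addRight]; rw [add_right_comm]
    have e' : t₂ i = t₁ (i + t₁.symm u) := rfl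
    rw [e, e']
    constructor
    · intro h h'
      exact hnext _ h (Or.inr h')
    · intro h h'
      exact hnext _ h (Or.inl (by simpa using h'))
  obtain ⟨l, hl⟩ : ∃ l, List.ofFn t₂ = u :: l := by
    obtain ⟨m, rfl⟩ : ∃ m, n = m + 1 := ⟨n - 1, by omega⟩
    exact ⟨_, by rw [List.ofFn_succ, h20]⟩
  obtain ⟨rest, hrest⟩ : ∃ rest, (List.ofFn ord).drop K = rest := ⟨_, rfl⟩
  have hrestlen : rest.length = n - K := by rw [← hrest]; simp
  have hordnd : (List.ofFn ord).Nodup := List.nodup_ofFn.2 ord.injective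
  have hmemrest : ∀ v, v ∈ rest ↔ v ∉ S := by
    intro v
    rw [← hrest, List.mem_drop_iff_getElem]
    constructor
    · rintro ⟨i, hi, rfl⟩
      simp [hK]
    · intro hv
      have h3 : K ≤ (ord.symm v : ℕ) := by
        by_contra h
        exact hv (by rw [← ord.apply_symm_apply v, hK]; omega)
      have h4 := (ord.symm v).2
      refine ⟨(ord.symm v : ℕ) - K, by simp; omega, ?_⟩
      have h5 : K + ((ord.symm v : ℕ) - K) = (ord.symm v : ℕ) := by omega
      simp [h5]
  have hlnd : (u :: l).Nodup := hl ▸ List.nodup_ofFn.2 t₂.injective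
  -- The new tour visits the kernel in the old order, `F`, and then the other vertices in the order
  -- of `ord`.
  set F := l.filter (fun y => decide (y ∈ S)) with hF
  have hLnd : (F ++ rest).Nodup := by
    rw [List.nodup_append]
    refine ⟨(List.nodup_cons.1 hlnd).2.filter _, hrest ▸ hordnd.sublist (List.drop_sublist _ _), ?_⟩
    intro a ha b hb hab
    subst hab
    exact (hmemrest a).1 hb (by simpa using (List.mem_filter.1 ha).2)
  have hmem : ∀ v, v ∈ F ++ rest := by
    intro v
    rw [List.mem_append, hmemrest]
    by_cases hv : v ∈ S
    · left
      have : v ∈ u :: l := by rw [← hl, List.mem_ofFn]; exact ⟨t₂.symm v, by simp⟩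
      rcases List.mem_cons.1 this with rfl | h
      · exact absurd hv huS
      · exact List.mem_filter.2 ⟨h, by simpa using hv⟩
    · exact Or.inr hv
  have hLlen : (F ++ rest).length = n := by
    rw [← List.toFinset_card_of_nodup hLnd,
      (Finset.eq_univ_iff_forall.2 fun v => List.mem_toFinset.2 (hmem v)), Finset.card_univ,
      Fintype.card_fin]
  have hFlen : F.length = K := by rw [List.length_append, hrestlen] at hLlen; omega
  obtain ⟨t', ht'⟩ := exists_perm_ofFn_eq hLnd hLlen
  have hget : ∀ i : Fin n, t' i = (F ++ rest)[(i : ℕ)]'(by omega) := by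
    intro i
    have : (List.ofFn t')[(i : ℕ)]'(by simp) = t' i := by simp
    rw [← this]; congr 1
  refine ⟨t', ?_, fun i hi => ?_⟩
  · refine le_trans (le_of_eq ?_) ht₁
    rw [← hcost2, tourCost_eq_pathCost, tourCost_eq_pathCost, hl, h20, ht']
    have hr0 : ∃ rest', rest = u :: rest' := by
      refine ⟨(List.ofFn ord).drop (K + 1), ?_⟩
      rw [← hrest, List.drop_eq_getElem_cons (by simpa using hKn)]
      simp [hu]
    obtain ⟨rest', hr0⟩ := hr0
    have hchain : List.IsChain (fun x y => (¬ x ∈ S → y ∉ (A : Set (Fin n))) ∧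
        (¬ y ∈ S → x ∉ (A : Set (Fin n)))) (u :: (l ++ [u])) := by
      rw [← List.cons_append, ← hl, ← h20, List.isChain_iff_getElem]
      intro i hi
      simp only [List.length_append, List.length_ofFn, List.length_singleton] at hi
      have hi' : i < n := by omega
      have e1 : (List.ofFn t₂ ++ [t₂ 0])[i]'(by simp; omega) = t₂ ⟨i, hi'⟩ := by
        rw [List.getElem_append_left (by simpa using hi')]; simp
      have e2 : (List.ofFn t₂ ++ [t₂ 0])[i + 1]'(by simp; omega) = t₂ (⟨i, hi'⟩ + 1) := by
        by_cases h : i + 1 < n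
        · rw [List.getElem_append_left (by simpa using h)]
          simp only [List.getElem_ofFn]
          congr 1
          apply Fin.ext
          simp [Fin.val_add, Nat.mod_eq_of_lt h]
        · rw [List.getElem_append_right (by simp; omega)]
          simp only [List.getElem_singleton]
          congr 1
          apply Fin.ext
          have : i + 1 = n := by omega
          simp [Fin.val_add, this]
      rw [e1, e2]
      simpa using hnext2 ⟨i, hi'⟩
    have hcA : ∀ x ∉ (A : Set (Fin n)), ∀ y ∉ (A : Set (Fin n)), c x y = 0 := by
      simpa using hc
    have hrestA : ∀ y ∈ rest, y ∉ (A : Set (Fin n)) := fun y hy h =>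
      (hmemrest y).1 hy (hAS (by simpa using h))
    have huA : u ∉ (A : Set (Fin n)) := fun h => huS (hAS (by simpa using h))
    obtain ⟨x, rs, hxr⟩ : ∃ x rs, rest = rs ++ [x] := by
      rcases List.eq_nil_or_concat rest with h | ⟨rs, x, h⟩
      · rw [h] at hr0; simp at hr0
      · exact ⟨x, rs, by simpa using h⟩
    have hxA : x ∉ (A : Set (Fin n)) := hrestA x (by simp [hxr])
    -- The links inside `rest` are free. What remains of the new tour leads from the last vertex `x`
    -- of `rest` through `F` back to its first vertex `u`, which is the old tour with the vertices
    -- outside the kernel deleted.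
    have main := pathCost_filter c (A := (A : Set (Fin n))) (S := fun x => x ∈ S)
      (fun x hx => hAS (by simpa using hx)) hcA u u huS huA l u x hchain
    rw [← hF] at main
    have ht0 : t' 0 = (F ++ rest).head (by simp [hr0]) := by
      rw [hget, List.head_eq_getElem]; rfl
    have hmain := main (by
      by_cases h : u = x
      · exact Or.inl h
      · exact Or.inr ⟨huS, hxA⟩)
    rw [List.cons_append, ← hmain, ht0]
    cases hFc : F with
    | nil =>
      have : ∀ y ∈ rs, y ∉ (A : Set (Fin n)) := fun y hy => hrestA y (by simp [hxr, hy])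
      simp only [List.nil_append, hr0, List.head_cons, pathCost_cons_cons, pathCost_singleton]
      rw [← hr0, hxr, pathCost_of_forall c hcA rs x u this hxA]
      simp
    | cons f F' =>
      have : ∀ y ∈ rs, y ∉ (A : Set (Fin n)) := fun y hy => hrestA y (by simp [hxr, hy])
      have e := pathCost_of_forall c hcA rs x f this hxA
      rw [← hxr] at e
      have e2 : (f :: F') ++ rest ++ [(f :: F' ++ rest).head (by simp)] =
          (f :: F') ++ u :: (rest' ++ [f]) := by simp [hr0]
      rw [e2, pathCost_append]
      have e3 : u :: (rest' ++ [f]) = rest ++ [f] := by simp [hr0]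
      rw [e3, e]
      simp only [List.cons_append, pathCost_cons_cons]
      ring
  · rw [hget, List.getElem_append_right (by omega)]
    simp only [← hrest, List.getElem_drop, List.getElem_ofFn]
    congr 1
    apply Fin.ext
    simp; omega

end Kernel

/-! ### Reversal of a segment of a tour -/

section Reverse

/-- The reversal of the positions `a + 1, …, b`. -/
def rev (a b q : ℕ) : ℕ := if a < q ∧ q ≤ b then a + 1 + b - q else q

theorem rev_rev (a b q : ℕ) : rev a b (rev a b q) = q := by
  unfold rev; split_ifs <;> omega

theorem rev_lt {n a b q : ℕ} (hb : b < n) (hq : q < n) : rev a b q < n := by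
  unfold rev; split_ifs <;> omega

/-- The reversal as a permutation of the positions of a tour. -/
def revPerm {n : ℕ} (a b : Fin n) : Equiv.Perm (Fin n) :=
  Function.Involutive.toPerm (fun q => ⟨rev a b q, rev_lt b.2 q.2⟩)
    fun _ => Fin.ext (rev_rev _ _ _)

theorem revPerm_apply {n : ℕ} (a b q : Fin n) : ((revPerm a b q : Fin n) : ℕ) = rev a b q := rfl

variable {n : ℕ} [NeZero n] {V : Type*}

theorem val_succ_of_lt {i : Fin n} (h : (i : ℕ) + 1 < n) : ((i + 1 : Fin n) : ℕ) = i + 1 := by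
  rw [Fin.val_add, Fin.val_one', Nat.add_mod_mod, Nat.mod_eq_of_lt h]

theorem val_succ_of_eq {i : Fin n} (h : (i : ℕ) + 1 = n) : ((i + 1 : Fin n) : ℕ) = 0 := by
  rw [Fin.val_add, Fin.val_one', Nat.add_mod_mod, h, Nat.mod_self]

theorem revPerm_outside {a b q : Fin n} (hq : q < a ∨ b < q) :
    revPerm a b q = q ∧ revPerm a b (q + 1) = q + 1 := by
  have hq2 := q.2
  constructor
  · apply Fin.ext
    rw [revPerm_apply, rev, if_neg]
    rcases hq with h | h <;> rw [Fin.lt_def] at h <;> omega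
  · apply Fin.ext
    rw [revPerm_apply]
    by_cases h : (q : ℕ) + 1 < n
    · rw [val_succ_of_lt h, rev, if_neg]
      rcases hq with h | h <;> rw [Fin.lt_def] at h <;> omega
    · rw [val_succ_of_eq (by omega), rev, if_neg (by omega)]

theorem revPerm_left {a b : Fin n} (hab : a < b) :
    revPerm a b a = a ∧ revPerm a b (a + 1) = b := by
  have h1 := b.2
  rw [Fin.lt_def] at hab
  constructor
  · apply Fin.ext
    rw [revPerm_apply, rev, if_neg (by omega)]
  · apply Fin.ext
    rw [revPerm_apply, val_succ_of_lt (by omega), rev, if_pos (by omega)]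
    omega

theorem revPerm_right {a b : Fin n} (hab : a < b) :
    revPerm a b b = a + 1 ∧ revPerm a b (b + 1) = b + 1 := by
  have h1 := b.2
  rw [Fin.lt_def] at hab
  constructor
  · apply Fin.ext
    rw [revPerm_apply, val_succ_of_lt (by omega), rev, if_pos (by omega)]
    omega
  · apply Fin.ext
    rw [revPerm_apply]
    by_cases h : (b : ℕ) + 1 < n
    · rw [val_succ_of_lt h, rev, if_neg (by omega)]
    · rw [val_succ_of_eq (by omega), rev, if_neg (by omega)]

theorem revPerm_inside {a b q : Fin n} (h1 : a < q) (h2 : q < b) :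
    ∃ q' : Fin n, (q' : ℕ) = a + b - q ∧ a < q' ∧ q' < b ∧
      revPerm a b q = q' + 1 ∧ revPerm a b (q + 1) = q' := by
  have hb := b.2
  rw [Fin.lt_def] at h1 h2
  refine ⟨⟨a + b - q, by omega⟩, rfl, by rw [Fin.lt_def]; dsimp only; omega,
    by rw [Fin.lt_def]; dsimp only; omega, ?_, ?_⟩
  · apply Fin.ext
    rw [revPerm_apply, val_succ_of_lt (by dsimp only; omega), rev, if_pos (by omega)]
    dsimp only; omega
  · apply Fin.ext
    rw [revPerm_apply, val_succ_of_lt (by omega), rev, if_pos (by omega)]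
    dsimp only; omega

/-- Reversing a segment whose two end links cost nothing before and after does not change
the cost of a tour. -/
theorem tourCost_revPerm {c : V → V → ℤ} (hsym : ∀ x y, c x y = c y x) (t : Fin n → V)
    {a b : Fin n} (hab : a < b) (h1 : c (t a) (t (a + 1)) = 0) (h2 : c (t b) (t (b + 1)) = 0)
    (h3 : c (t a) (t b) = 0) (h4 : c (t (a + 1)) (t (b + 1)) = 0) :
    tourCost c (fun q => t (revPerm a b q)) = tourCost c t := by
  have hinv : ∀ q : Fin n, (if a < q ∧ q < b then (a + b - q : ℕ) else q) < n := by
    intro q; have := q.2; have := b.2; simp only [Fin.lt_def]; split_ifs <;> omega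
  -- Inside the segment, the new link at `q` is the old link at `a + b - q` traversed backwards;
  -- only the links at `a` and `b` are really new.
  let κ : Equiv.Perm (Fin n) := Function.Involutive.toPerm
    (fun q => ⟨if a < q ∧ q < b then (a + b - q : ℕ) else q, hinv q⟩) (by
      intro q
      apply Fin.ext
      simp only [Fin.lt_def]
      have := a.2; have := b.2
      split_ifs <;> omega)
  unfold tourCost
  rw [← Equiv.sum_comp κ fun i => c (t i) (t (i + 1))]
  refine Finset.sum_congr rfl fun q _ => ?_
  dsimp only
  by_cases hq1 : a < q ∧ q < b
  · obtain ⟨q', e, -, -, e1, e2⟩ := revPerm_inside hq1.1 hq1.2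
    have hκ : κ q = q' := by
      apply Fin.ext
      show (if a < q ∧ q < b then (a + b - q : ℕ) else q) = _
      rw [if_pos hq1, e]
    rw [hκ, e1, e2, hsym]
  · have hκ : κ q = q := by
      apply Fin.ext
      show (if a < q ∧ q < b then (a + b - q : ℕ) else q) = _
      rw [if_neg hq1]
    rw [hκ]
    by_cases hqa : q = a
    · subst hqa
      rw [(revPerm_left hab).1, (revPerm_left hab).2, h1, h3]
    · by_cases hqb : q = b
      · subst hqb
        rw [(revPerm_right hab).1, (revPerm_right hab).2, h2, h4]
      · have : q < a ∨ b < q := by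
          simp only [Fin.lt_def, Fin.ext_iff] at *; omega
        rw [(revPerm_outside this).1, (revPerm_outside this).2]

end Reverse

/-! ### Repairing the links outside the exceptional set -/

section Repair
variable {n : ℕ} [NeZero n] (A : Finset (Fin n)) (r : Fin n → Fin n → ℤ)

/-- The cost that ignores the pairs outside `A`. -/
def restrictCost (x y : Fin n) : ℤ := if x ∈ A ∨ y ∈ A then r x y else 0

/-- A pair is good if it meets `A` or costs nothing. -/
def Good (x y : Fin n) : Prop := x ∈ A ∨ y ∈ A ∨ r x y = 0

/-- The link `j` can be exchanged with the link `i`. -/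
def CanSwap (t : Fin n → Fin n) (i j : Fin n) : Prop :=
  j ≠ i ∧ t j ∉ A ∧ t (j + 1) ∉ A ∧ r (t i) (t j) = 0 ∧ r (t (i + 1)) (t (j + 1)) = 0

variable {A r}

theorem restrictCost_comm (hsym : ∀ x y, r x y = r y x) (x y : Fin n) :
    restrictCost A r x y = restrictCost A r y x := by
  simp only [restrictCost, hsym x y, or_comm (a := x ∈ A)]

theorem tourCost_eq_of_good {t : Fin n → Fin n} (h : ∀ i, Good A r (t i) (t (i + 1))) :
    tourCost r t = tourCost (restrictCost A r) t := by
  refine Finset.sum_congr rfl fun i _ => ?_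
  rw [restrictCost]
  split_ifs with h1
  · rfl
  · push Not at h1
    rcases h i with h2 | h2 | h2
    exacts [absurd h2 h1.1, absurd h2 h1.2, h2]

/-- The ignored links are nonnegative. The assumption `3 ≤ n` ensures that consecutive vertices of a
tour are distinct. -/
theorem restrictCost_tour_le {t : Equiv.Perm (Fin n)} (hn : 3 ≤ n)
    (hr : ∀ x ∉ A, ∀ y ∉ A, x ≠ y → 0 ≤ r x y) :
    tourCost (restrictCost A r) t ≤ tourCost r t := by
  refine Finset.sum_le_sum fun i _ => ?_
  rw [restrictCost]
  split_ifs with h1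
  · exact le_rfl
  · push Not at h1
    refine hr _ h1.1 _ h1.2 fun h => ?_
    have h3 := add_eq_left.1 (t.injective h).symm
    have : (1 : Fin n).val = 1 := by rw [Fin.val_one', Nat.mod_eq_of_lt (by omega)]
    rw [h3] at this; simp at this

/-- Each of the two ends of link `i` rules out at most `n/10 + |A| + 1` positions `j`: the end
itself, the elements of `A`, and the partners of nonzero cost. Together these are fewer than `n`. -/
theorem exists_canSwap (t : Equiv.Perm (Fin n)) (i : Fin n) (hi : t i ∉ A) (hi' : t (i + 1) ∉ A)
    (hr : ∀ x ∉ A, 10 * (Finset.univ.filter fun y => y ∉ A ∧ y ≠ x ∧ r x y ≠ 0).card ≤ n)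
    (hA : 20 * A.card + 20 ≤ 5 * n) : ∃ j, CanSwap A r t i j := by
  set B : Fin n → Finset (Fin n) := fun x =>
    insert x (A ∪ Finset.univ.filter fun y => y ∉ A ∧ y ≠ x ∧ r x y ≠ 0) with hB
  have hBc : ∀ x ∉ A, 10 * (B x).card ≤ n + 10 * A.card + 10 := by
    intro x hx
    have h1 := hr x hx
    have h2 := Finset.card_insert_le x
      (A ∪ Finset.univ.filter fun y => y ∉ A ∧ y ≠ x ∧ r x y ≠ 0)
    have h3 := Finset.card_union_le A (Finset.univ.filter fun y => y ∉ A ∧ y ≠ x ∧ r x y ≠ 0)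
    simp only [hB]
    omega
  have h1 := hBc _ hi
  have h2 := hBc _ hi'
  have hn : 0 < n := Nat.pos_of_ne_zero (NeZero.ne n)
  obtain ⟨j, -, hj⟩ : ∃ j ∈ (Finset.univ : Finset (Fin n)), j ∉
      (B (t i)).image t.symm ∪ (B (t (i + 1))).image (fun v => t.symm v - 1) := by
    apply Finset.exists_mem_notMem_of_card_lt_card
    rw [Finset.card_univ, Fintype.card_fin]
    refine lt_of_le_of_lt ((Finset.card_union_le _ _).trans
      (Nat.add_le_add Finset.card_image_le Finset.card_image_le)) ?_
    omega
  simp only [Finset.mem_union, Finset.mem_image, not_or, not_exists, not_and] at hj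
  have hj1 : t j ∉ B (t i) := fun h => hj.1 _ h (by simp)
  have hj2 : t (j + 1) ∉ B (t (i + 1)) := fun h => hj.2 _ h (by simp)
  simp only [hB, Finset.mem_insert, Finset.mem_union, Finset.mem_filter, Finset.mem_univ,
    true_and, not_or, not_and, not_not] at hj1 hj2
  refine ⟨j, fun h => hj1.1 (by rw [h]), hj1.2.1, hj2.2.1, hj1.2.2 hj1.2.1 hj1.1,
    hj2.2.2 hj2.2.1 hj2.1⟩

/-- Exchanging the bad link `i` with a suitable link `j` repairs it, and keeps the links before
`i` good and the cost of the links at `A` unchanged. -/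
theorem repair_step (hsym : ∀ x y, r x y = r y x) (t : Fin n → Fin n) {i j : Fin n}
    (hi : t i ∉ A) (hi' : t (i + 1) ∉ A) (hj : CanSwap A r t i j)
    (hgood : ∀ q < i, Good A r (t q) (t (q + 1))) :
    tourCost (restrictCost A r) (fun q => t (revPerm (min i j) (max i j) q)) =
        tourCost (restrictCost A r) t ∧
      ∀ q ≤ i, Good A r (t (revPerm (min i j) (max i j) q))
        (t (revPerm (min i j) (max i j) (q + 1))) := by
  obtain ⟨hne, h1, h2, h3, h4⟩ := hj
  have hgsym : ∀ x y, Good A r x y → Good A r y x := by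
    intro x y h
    rcases h with h | h | h
    exacts [Or.inr (Or.inl h), Or.inl h, Or.inr (Or.inr (by rw [hsym, h]))]
  have hc0 : ∀ x ∉ A, ∀ y ∉ A, restrictCost A r x y = 0 := fun x hx y hy => by
    rw [restrictCost, if_neg (by simp [hx, hy])]
  -- If `j` precedes `i`, the good links between them are run backwards and stay good, as goodness
  -- is symmetric. If `j` follows `i`, the links before `i` are not touched.
  rcases lt_or_gt_of_ne hne with hlt | hlt
  · rw [min_eq_right hlt.le, max_eq_left hlt.le]
    refine ⟨tourCost_revPerm (restrictCost_comm hsym) t hlt (hc0 _ h1 _ h2) (hc0 _ hi _ hi')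
      (hc0 _ h1 _ hi) (hc0 _ h2 _ hi'), fun q hq => ?_⟩
    rcases lt_trichotomy q j with hqj | rfl | hqj
    · rw [(revPerm_outside (Or.inl hqj)).1, (revPerm_outside (Or.inl hqj)).2]
      exact hgood q (hqj.trans hlt)
    · rw [(revPerm_left hlt).1, (revPerm_left hlt).2]
      exact Or.inr (Or.inr (by rw [hsym, h3]))
    · rcases hq.lt_or_eq with hqi | rfl
      · obtain ⟨q', -, h5, h6, e1, e2⟩ := revPerm_inside hqj hqi
        rw [e1, e2]
        exact hgsym _ _ (hgood q' h6)
      · rw [(revPerm_right hlt).1, (revPerm_right hlt).2]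
        exact Or.inr (Or.inr (by rw [hsym, h4]))
  · rw [min_eq_left hlt.le, max_eq_right hlt.le]
    refine ⟨tourCost_revPerm (restrictCost_comm hsym) t hlt (hc0 _ hi _ hi') (hc0 _ h1 _ h2)
      (hc0 _ hi _ h1) (hc0 _ hi' _ h2), fun q hq => ?_⟩
    rcases hq.lt_or_eq with hqi | rfl
    · rw [(revPerm_outside (Or.inl hqi)).1, (revPerm_outside (Or.inl hqi)).2]
      exact hgood q hqi
    · rw [(revPerm_left hlt).1, (revPerm_left hlt).2]
      exact Or.inr (Or.inr h3)

end Repair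

/-! ### Hamilton cycles as permutations, and their weights -/

section HamiltonCycle
variable {n : ℕ} (w : Weighting n)

/-- The weight matrix of a weighting. -/
def wt (x y : Fin n) : ℤ := entry w x y

theorem wt_self (x : Fin n) : wt w x x = 0 := by simp [wt, entry]

theorem wt_of_ne {x y : Fin n} (h : x ≠ y) : wt w x y = w ⟨s(x, y), by simpa using h⟩ := by
  have : (x : ℕ) ≠ y := fun h' => h (Fin.ext h')
  simp [wt, entry, this]

theorem wt_comm (x y : Fin n) : wt w x y = wt w y x := by
  by_cases h : x = y
  · rw [h]
  · rw [wt_of_ne w h, wt_of_ne w (Ne.symm h)]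
    congr 2
    exact Sym2.eq_swap

theorem natAbs_wt_le (x y : Fin n) : (wt w x y).natAbs ≤ maxAbs w := by
  by_cases h : x = y
  · rw [h, wt_self]; simp
  · rw [wt_of_ne w h]
    exact Finset.le_sup (f := fun e => (w e).natAbs) (Finset.mem_univ _)

theorem two_mul_weight_top : 2 * weight w ⊤ = ∑ x, ∑ y, wt w x y := by
  classical
  let f : Sym2 (Fin n) → ℤ := fun e => if h : e ∈ (K n).edgeSet then w ⟨e, h⟩ else 0
  have hf : ∀ x y, x ≠ y → f s(x, y) = wt w x y := by
    intro x y h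
    rw [wt_of_ne w h]
    have : s(x, y) ∈ (K n).edgeSet := by simpa using h
    simp only [f, dif_pos this]
  have h1 : weight w ⊤ = ∑ p ∈ Finset.univ.offDiag with p.1 < p.2, f s(p.1, p.2) := by
    rw [← Finset.sum_sym2_filter_not_isDiag, weight]
    rw [Finset.sum_subtype (p := fun e => e ∈ (K n).edgeSet)
      (F := inferInstanceAs (Fintype (K n).edgeSet))
      (Finset.univ.sym2.filter fun e : Sym2 (Fin n) => ¬ e.IsDiag) (by simp) f]
    refine Finset.sum_congr (by ext; simp) fun e _ => ?_
    have := e.2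
    simp only [SimpleGraph.Subgraph.edgeSet_top, Subtype.coe_prop, if_true, f, dif_pos]
  have h2 : ∑ p ∈ Finset.univ.offDiag with p.1 < p.2, f s(p.1, p.2) =
      ∑ p : Fin n × Fin n with p.1 < p.2, wt w p.1 p.2 := by
    refine Finset.sum_congr ?_ fun p hp => ?_
    · ext p
      simp only [Finset.mem_filter, Finset.mem_offDiag, Finset.mem_univ, true_and,
        and_iff_right_iff_imp]
      exact fun h => h.ne
    · simp only [Finset.mem_filter] at hp
      exact hf _ _ hp.2.ne
  have h3 : ∑ p : Fin n × Fin n with p.1 < p.2, wt w p.1 p.2 =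
      ∑ p : Fin n × Fin n with p.2 < p.1, wt w p.1 p.2 := by
    refine Finset.sum_bij' (fun p _ => p.swap) (fun p _ => p.swap) ?_ ?_ ?_ ?_ ?_ <;>
      simp [wt_comm w]
  rw [← Fintype.sum_prod_type' (f := fun x y => wt w x y), h1, h2]
  have h4 := Finset.sum_filter_add_sum_filter_not (Finset.univ : Finset (Fin n × Fin n))
    (fun p => p.1 < p.2) fun p => wt w p.1 p.2
  have h5 := Finset.sum_filter_add_sum_filter_not
    ((Finset.univ : Finset (Fin n × Fin n)).filter fun p => ¬ p.1 < p.2)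
    (fun p => p.2 < p.1) fun p => wt w p.1 p.2
  rw [Finset.filter_filter, Finset.filter_filter] at h5
  have h6 : ∑ p : Fin n × Fin n with ¬ p.1 < p.2 ∧ ¬ p.2 < p.1, wt w p.1 p.2 = 0 := by
    refine Finset.sum_eq_zero fun p hp => ?_
    simp only [Finset.mem_filter, Finset.mem_univ, true_and] at hp
    rw [le_antisymm (not_lt.1 hp.2) (not_lt.1 hp.1), wt_self]
  have h7 : (Finset.univ.filter fun p : Fin n × Fin n => ¬ p.1 < p.2 ∧ p.2 < p.1) =
      Finset.univ.filter fun p : Fin n × Fin n => p.2 < p.1 := by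
    ext p
    simp only [Finset.mem_filter, Finset.mem_univ, true_and, and_iff_right_iff_imp]
    exact fun h => h.le.not_gt
  rw [h7] at h5
  linarith

/-- The double sum counts each edge twice and `n.choose 2 = n(n-1)/2`, so one factor `n` cancels.
This turns the condition on the cycle into an inequality between integers. -/
theorem density_mul (hn : 3 ≤ n) :
    density w * n = ((∑ x, ∑ y, wt w x y : ℤ) : ℚ) / ((n : ℚ) - 1) := by
  rw [density, ← two_mul_weight_top, Nat.cast_choose_two]
  have h3 : (3 : ℚ) ≤ n := by exact_mod_cast hn
  have h1 : (n : ℚ) ≠ 0 := by linarith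
  have h2 : (n : ℚ) - 1 ≠ 0 := by linarith
  push_cast
  field_simp

variable [NeZero n]

theorem weight_hamiltonianCycle {a : Fin n} {H : (K n).Walk a a} (hH : H.IsHamiltonianCycle)
    {t : Fin n → Fin n} (ht : ∀ i : Fin n, H.getVert i = t i) :
    weight w H.toSubgraph = tourCost (wt w) t := by
  classical
  have hlen : H.length = n := by rw [hH.length_eq, Fintype.card_fin]
  have hsucc : ∀ i : Fin n, H.getVert (i + 1 : ℕ) = t (i + 1) := by
    intro i
    by_cases h : (i : ℕ) + 1 < n
    · rw [← ht, val_succ_of_lt h]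
    · have h' : (i : ℕ) + 1 = n := by have := i.2; omega
      rw [← ht, val_succ_of_eq h', h', SimpleGraph.Walk.getVert_zero]
      exact SimpleGraph.Walk.getVert_of_length_le _ hlen.le
  have hadj : ∀ i : Fin n, (K n).Adj (t i) (t (i + 1)) := by
    intro i
    rw [← hsucc, ← ht]
    exact H.adj_getVert_succ (by rw [hlen]; exact i.2)
  have hedge : ∀ i (h : i < H.edges.length), H.edges[i] = s(t ⟨i, by simpa [hlen] using h⟩,
      t (⟨i, by simpa [hlen] using h⟩ + 1)) := by
    intro i h
    have hi : i < n := by simpa [hlen] using h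
    rw [← hsucc ⟨i, hi⟩, ← ht ⟨i, hi⟩]
    simp only [SimpleGraph.Walk.edges, List.getElem_map, SimpleGraph.Walk.darts_getElem_eq_getVert]
    rfl
  let φ : Fin n → (K n).edgeSet := fun i => ⟨s(t i, t (i + 1)), hadj i⟩
  -- A cycle repeats no edge, so the weight of the subgraph counts each link of the tour once.
  have hφ : Function.Injective φ := by
    intro i j hij
    have hnd := hH.isCycle.isCircuit.isTrail.edges_nodup
    have hi : (i : ℕ) < H.edges.length := by simp [hlen]
    have hj : (j : ℕ) < H.edges.length := by simp [hlen]
    have e : H.edges[(i : ℕ)] = H.edges[(j : ℕ)] := by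
      rw [hedge i hi, hedge j hj]; exact congrArg Subtype.val hij
    exact Fin.ext ((hnd.getElem_inj_iff).1 e)
  have himg : (Finset.univ.filter fun e : (K n).edgeSet => (e : Sym2 (Fin n)) ∈ H.toSubgraph.edgeSet) =
      Finset.univ.image φ := by
    ext e
    simp only [Finset.mem_filter, Finset.mem_univ, true_and, Finset.mem_image,
      SimpleGraph.Walk.mem_edges_toSubgraph]
    constructor
    · intro h
      obtain ⟨i, hi, he⟩ := List.getElem_of_mem h
      refine ⟨⟨i, by simpa [hlen] using hi⟩, Subtype.ext ?_⟩
      rw [← he, hedge i hi]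
    · rintro ⟨i, rfl⟩
      have hi : (i : ℕ) < H.edges.length := by simp [hlen]
      have := List.getElem_mem hi
      rw [hedge i hi] at this
      exact this
  have hw : weight w H.toSubgraph =
      ∑ e ∈ Finset.univ.filter fun e : (K n).edgeSet => (e : Sym2 (Fin n)) ∈ H.toSubgraph.edgeSet,
        w e := by
    rw [Finset.sum_filter]; rfl
  rw [hw, himg, Finset.sum_image fun i _ j _ h => hφ h, tourCost]
  refine Finset.sum_congr rfl fun i _ => ?_
  rw [wt_of_ne w (hadj i)]

theorem exists_perm_of_hamiltonianCycle {a : Fin n} {H : (K n).Walk a a}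
    (hH : H.IsHamiltonianCycle) :
    ∃ t : Equiv.Perm (Fin n), ∀ i : Fin n, H.getVert i = t i := by
  have hlen : H.length = n := by rw [hH.length_eq, Fintype.card_fin]
  have hinj : Function.Injective fun i : Fin n => H.getVert i := by
    intro i j hij
    exact Fin.ext (hH.isCycle.getVert_injOn' (by simp; omega) (by simp; omega) hij)
  exact ⟨Equiv.ofBijective _ (Finite.injective_iff_bijective.1 hinj), fun i => rfl⟩

theorem exists_hamiltonianCycle (hn : 3 ≤ n) (t : Equiv.Perm (Fin n)) :
    ∃ (a : Fin n) (H : (K n).Walk a a), H.IsHamiltonianCycle ∧ ∀ i : Fin n, H.getVert i = t i := by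
  obtain ⟨m, rfl⟩ : ∃ m, n = m + 3 := ⟨n - 3, by omega⟩
  -- The standard closed walk in the cycle graph descends from `0`, so the labels are negated to
  -- visit `t 0, t 1, …` in this order.
  let f : SimpleGraph.cycleGraph (m + 3) →g K (m + 3) :=
    { toFun := fun i => t (-i)
      map_rel' := fun {x y} h => by
        simp only [SimpleGraph.top_adj, ne_eq, EmbeddingLike.apply_eq_iff_eq, neg_inj]
        exact h.ne }
  have hf : Function.Injective f := fun x y h => by simpa [f] using h
  refine ⟨_, (SimpleGraph.cycleGraph.cycle m).map f, ?_, fun i => ?_⟩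
  · rw [SimpleGraph.Walk.isHamiltonianCycle_iff_isCycle_and_length_eq]
    refine ⟨SimpleGraph.cycleGraph.isCycle_cycle.map hf, ?_⟩
    simp
  · rw [SimpleGraph.Walk.getVert_map, SimpleGraph.cycleGraph.getVert_cycle i.2.le]
    show t (- _) = t i
    congr 1
    rw [neg_eq_iff_add_eq_zero]
    apply Fin.ext
    rw [Fin.val_add]
    simp only [Nat.mod_add_mod]
    have := i.2
    rw [Nat.sub_add_cancel (by omega), Nat.mod_self]
    rfl

theorem belowAverage_iff (hn : 3 ≤ n) (k : ℕ) {a : Fin n} {H : (K n).Walk a a}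
    (hH : H.IsHamiltonianCycle) {t : Fin n → Fin n} (ht : ∀ i : Fin n, H.getVert i = t i) :
    BelowAverage w k H ↔ ((n : ℤ) - 1) * (tourCost (wt w) t + k) ≤ ∑ x, ∑ y, wt w x y := by
  rw [BelowAverage, weight_hamiltonianCycle w hH ht, density_mul w hn, and_iff_right hH,
    le_sub_iff_add_le, le_div_iff₀ (by have : (3 : ℚ) ≤ n := by exact_mod_cast hn
                                       linarith)]
  rw [mul_comm]
  exact_mod_cast Iff.rfl

theorem exists_belowAverage_iff (hn : 3 ≤ n) (k : ℕ) :
    (∃ (a : Fin n) (H : (K n).Walk a a), BelowAverage w k H) ↔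
      ∃ t : Equiv.Perm (Fin n),
        ((n : ℤ) - 1) * (tourCost (wt w) t + k) ≤ ∑ x, ∑ y, wt w x y := by
  constructor
  · rintro ⟨a, H, hH⟩
    obtain ⟨t, ht⟩ := exists_perm_of_hamiltonianCycle hH.1
    exact ⟨t, (belowAverage_iff w hn k hH.1 ht).1 hH⟩
  · rintro ⟨t, ht⟩
    obtain ⟨a, H, hH, ht'⟩ := exists_hamiltonianCycle hn t
    exact ⟨a, H, (belowAverage_iff w hn k hH ht').2 ht⟩

end HamiltonCycle

/-! ### The program: merging -/

/-- The cell of the weight matrix. -/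
def wE (x z : Expr) : Expr := ar 0 (x * rg 0 + z)

/-- Copies the weight matrix, and sets up the trivial path system. -/
def initProg : Program :=
  .seq (.assign 6 (rg 0 * rg 0)) (.seq (fill 0 4 6 (.mem (rg 4)))
    (.seq (fill 1 4 0 (rg 4)) (.seq (fill 2 4 0 1) (.assign 2 (rg 0)))))

/-- Computes the row sums, the column sums and the link sum. -/
def sumsProg : Program :=
  .seq (IntRAM.forUp 4 0
    (.seq (sumTo 3 5 0 (ar 2 (rg 5) * (1 - (rg 4).eq (rg 5)) * wE (rg 4) (ar 1 (rg 5))))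
    (.seq (.store (.addr 3 (rg 4)) (rg 3))
    (.seq (sumTo 3 5 0 (ar 2 (rg 5) * (1 - (rg 4).eq (rg 5)) * wE (rg 5) (ar 1 (rg 4))))
    (.store (.addr 4 (rg 4)) (rg 3))))))
    (sumTo 8 4 0 (ar 2 (rg 4) * ar 3 (rg 4)))

/-- The first component of the pair with the code `p`. -/
def fstE (p : Expr) : Expr := p / rg 0

/-- The second component of the pair with the code `p`. -/
def sndE (p : Expr) : Expr := p - rg 0 * (p / rg 0)

/-- Finds the best merge. -/
def bestProg : Program :=
  argmin 9 10 5 6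
    (ar 2 (fstE (rg 5)) * ar 2 (sndE (rg 5)) * (1 - (fstE (rg 5)).eq (sndE (rg 5))))
    ((rg 2 - 1) * wE (fstE (rg 5)) (ar 1 (sndE (rg 5)))
      - wE (sndE (rg 5)) (ar 1 (fstE (rg 5))) - ar 3 (fstE (rg 5)) - ar 4 (sndE (rg 5)))

/-- Merges the cycles of the vertices in the registers `4` and `12`. -/
def mergeProg : Program :=
  .seq (.assign 13 (ar 1 (rg 4)))
    (.seq (.store (.addr 1 (rg 4)) (ar 1 (rg 12)))
    (.seq (.store (.addr 1 (rg 12)) (rg 13))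
    (.seq (.store (.addr 2 (rg 4)) 0) (.assign 2 (rg 2 - 1)))))

/-- One step of the greedy phase: a merge, unless the best merge in one of the first steps gains too
little. -/
def greedyStep : Program :=
  .seq sumsProg (.seq bestProg (.seq (.assign 4 (fstE (rg 9))) (.seq (.assign 12 (sndE (rg 9)))
    (.ite ((rg 0 - rg 2).lt (100 * rg 1) *
        Expr.lt 0 (100 * ((rg 2 - 1) * rg 10 + rg 8) + (rg 2 - 1) * (rg 2 - 2)))
      (.assign 7 1) mergeProg))))

/-- The greedy phase. -/
def greedyProg : Program :=
  .seq (.assign 17 (rg 0 - 1)) (IntRAM.forUp 11 17 (.ite (rg 7) .skip greedyStep))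

/-! ### Correctness of the greedy phase -/

section Specs
variable {n : ℕ} {ω : Fin n → Fin n → ℤ} {σ : Equiv.Perm (Fin n)} {E : Finset (Fin n)}
  {s s' : State} {R X : ℕ}

/-- The state holds the weight matrix. -/
structure HasWt (n : ℕ) (ω : Fin n → Fin n → ℤ) (s : State) : Prop where
  reg0 : s.reg 0 = n
  reg6 : s.reg 6 = (n * n : ℕ)
  arr0 : ∀ x y : Fin n, s.arr 0 ((x : ℕ) * n + (y : ℕ)) = ω x y

/-- The state holds the path system `(σ, E)`. -/
structure HasSys (σ : Equiv.Perm (Fin n)) (E : Finset (Fin n)) (s : State) : Prop where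
  reg2 : s.reg 2 = E.card
  arr1 : ∀ x : Fin n, s.arr 1 (x : ℕ) = (σ x : ℕ)
  arr2 : ∀ x : Fin n, s.arr 2 (x : ℕ) = if x ∈ E then 1 else 0

/-- The state holds the sums of a path system. -/
structure HasSums (ω : Fin n → Fin n → ℤ) (σ : Equiv.Perm (Fin n)) (E : Finset (Fin n))
    (s : State) : Prop where
  reg8 : s.reg 8 = linkSum ω σ E
  arr3 : ∀ x : Fin n, s.arr 3 (x : ℕ) = rowSum ω σ E x
  arr4 : ∀ x : Fin n, s.arr 4 (x : ℕ) = colSum ω σ E x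

theorem HasWt.frame {p : Program} (h : HasWt n ω s) (hf : Frame p s s')
    (h0 : p.writesReg 0 = false := by rfl) (h6 : p.writesReg 6 = false := by rfl)
    (ha : p.writesArr 0 = false := by rfl) : HasWt n ω s' :=
  ⟨by rw [hf.reg _ h0, h.reg0], by rw [hf.reg _ h6, h.reg6], fun x y => by
    rw [hf.arr _ ha, h.arr0]⟩

theorem HasSys.frame {p : Program} (h : HasSys σ E s) (hf : Frame p s s')
    (h2 : p.writesReg 2 = false := by rfl) (ha1 : p.writesArr 1 = false := by rfl)
    (ha2 : p.writesArr 2 = false := by rfl) : HasSys σ E s' :=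
  ⟨by rw [hf.reg _ h2, h.reg2], fun x => by rw [hf.arr _ ha1, h.arr1], fun x => by
    rw [hf.arr _ ha2, h.arr2]⟩

theorem HasSums.frame {p : Program} (h : HasSums ω σ E s) (hf : Frame p s s')
    (h8 : p.writesReg 8 = false := by rfl) (ha3 : p.writesArr 3 = false := by rfl)
    (ha4 : p.writesArr 4 = false := by rfl) : HasSums ω σ E s' :=
  ⟨by rw [hf.reg _ h8, h.reg8], fun x => by rw [hf.arr _ ha3, h.arr3], fun x => by
    rw [hf.arr _ ha4, h.arr4]⟩

/-- The standing assumptions on the bounds. -/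
structure Bounds (n : ℕ) (ω : Fin n → Fin n → ℤ) (X R : ℕ) : Prop where
  pos : 1 ≤ X
  n_le : n ≤ X
  wt_le : ∀ x y, (ω x y).natAbs ≤ X
  le_R : 1000000 * X ^ 6 ≤ R

theorem Bounds.pow_le (hb : Bounds n ω X R) {j : ℕ} (hj : j ≤ 6 := by norm_num) :
    1000000 * X ^ j ≤ R :=
  (Nat.mul_le_mul_left _ (Nat.pow_le_pow_right hb.pos hj)).trans hb.le_R

theorem Bounds.n_le_R (hb : Bounds n ω X R) : n ≤ R := by
  have := hb.pow_le (j := 1); have := hb.n_le; rw [pow_one] at *; omega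

theorem Bounds.one_le_R (hb : Bounds n ω X R) : 1 ≤ R := by
  have := hb.pow_le (j := 0); rw [pow_zero] at *; omega

theorem Bounds.nn_le_R (hb : Bounds n ω X R) : n * n ≤ R := by
  have := hb.pow_le (j := 2); have := Nat.mul_le_mul hb.n_le hb.n_le
  rw [pow_two] at *; omega

/-- `X` bounds `n` and the weights. The sums, potentials and costs below are polynomially bounded in
`X`, and `1000000 * X ^ 6` is a generous common bound for them. -/
theorem Bounds.natAbs_le (hb : Bounds n ω X R) {v : ℤ} {m j : ℕ} (h : v.natAbs ≤ m * X ^ j)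
    (hm : m ≤ 1000000 := by norm_num) (hj : j ≤ 6 := by norm_num) : v.natAbs ≤ R :=
  h.trans ((Nat.mul_le_mul_right _ hm).trans (hb.pow_le hj))

theorem Bounds.fin_le (hb : Bounds n ω X R) (x : Fin n) : ((x : ℕ) : ℤ).natAbs ≤ R := by
  have := hb.n_le_R; have := x.2; simp; omega

theorem Bounds.card_le (hb : Bounds n ω X R) (F : Finset (Fin n)) : F.card ≤ X :=
  (Finset.card_le_univ F).trans (by rw [Fintype.card_fin]; exact hb.n_le)

theorem Bounds.rowSum_le (hb : Bounds n ω X R) (x : Fin n) : (rowSum ω σ E x).natAbs ≤ X ^ 2 := by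
  refine (natAbs_sum_le _ _ fun z _ => hb.wt_le _ _).trans ?_
  rw [pow_two]; exact Nat.mul_le_mul_right _ (hb.card_le _)

theorem Bounds.colSum_le (hb : Bounds n ω X R) (x : Fin n) : (colSum ω σ E x).natAbs ≤ X ^ 2 := by
  refine (natAbs_sum_le _ _ fun z _ => hb.wt_le _ _).trans ?_
  rw [pow_two]; exact Nat.mul_le_mul_right _ (hb.card_le _)

theorem Bounds.linkSum_le (hb : Bounds n ω X R) : (linkSum ω σ E).natAbs ≤ X ^ 3 := by
  refine (natAbs_sum_le _ _ fun z _ => hb.rowSum_le _).trans ?_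
  rw [pow_succ' X 2]; exact Nat.mul_le_mul_right _ (hb.card_le _)

theorem Bounds.mergeVal_le (hb : Bounds n ω X R) (x z : Fin n) :
    (mergeVal ω σ E x z).natAbs ≤ 5 * X ^ 2 := by
  have h1 : (((E.card : ℤ) - 1) * ω x (σ z)).natAbs ≤ (X + 1) * X := by
    rw [Int.natAbs_mul]
    refine Nat.mul_le_mul ?_ (hb.wt_le _ _)
    have := hb.card_le E; omega
  have h2 := hb.wt_le z (σ x)
  have h3 := hb.rowSum_le (σ := σ) (E := E) x
  have h4 := hb.colSum_le (σ := σ) (E := E) z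
  have h5 : X ≤ X ^ 2 := Nat.le_self_pow (by norm_num) X
  have h6 : (X + 1) * X = X ^ 2 + X := by ring
  rw [mergeVal]
  generalize ((E.card : ℤ) - 1) * ω x (σ z) = a at *
  omega

@[simp] theorem eval_wE (x z : Expr) :
    (wE x z).eval s = s.arr 0 (x.eval s * s.reg 0 + z.eval s) := rfl

@[simp] theorem cost_wE (x z : Expr) : (wE x z).cost = x.cost + z.cost + 10 := by
  simp [wE]; omega

theorem sumsProg_spec (hb : Bounds n ω X R) (hW : HasWt n ω s) (hS : HasSys σ E s) :
    Wp R sumsProg (1000 * (n + 1) ^ 2) s fun s' => HasSums ω σ E s' := by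
  -- Membership in `E` and the condition `x ≠ z` enter as factors `0` or `1`, so that a sum over a
  -- subset becomes a sum over all indices.
  have hsum : ∀ (x : Fin n) (g : Fin n → ℤ), ∑ z, (if z ∈ E then 1 else 0) * (1 - if x = z then 1 else 0) * g z
      = ∑ z ∈ E.erase x, g z := by
    intro x g
    rw [← Finset.sum_filter_add_sum_filter_not Finset.univ (fun z => z ∈ E.erase x)]
    rw [Finset.sum_eq_zero (s := Finset.univ.filter fun z => ¬ z ∈ E.erase x), add_zero]
    · refine Finset.sum_congr (by ext; simp) fun z hz => ?_
      rw [Finset.mem_erase] at hz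
      simp [hz.1.symm, hz.2]
    · intro z hz
      simp only [Finset.mem_filter, Finset.mem_erase, Finset.mem_univ, true_and, not_and] at hz
      by_cases h : x = z
      · simp [h]
      · simp [hz (Ne.symm h)]
  have hX2 : n * X ≤ R := by
    have := hb.pow_le (j := 2); have := Nat.mul_le_mul_right X hb.n_le
    rw [pow_two] at *; omega
  have hterm : ∀ x z u v : Fin n, ((if z ∈ E then 1 else 0) * (1 - if x = z then 1 else 0) * ω u v).natAbs ≤ X := by
    intro x z u v
    have := hb.wt_le u v
    split_ifs <;> simp [this]
  refine Wp.seq' (τ₁ := n * (100 * n + 100) + 10) (τ₂ := 30 * n + 12)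
    (I := fun s' => (∀ x : Fin n, s'.arr 3 (x : ℕ) = rowSum ω σ E x) ∧
      (∀ x : Fin n, s'.arr 4 (x : ℕ) = colSum ω σ E x)) ?_ ?_ (by nlinarith)
  · refine Wp.forUp (τ₁ := 100 * n + 90) (fun m s' =>
      (∀ x : Fin n, (x : ℕ) < m → s'.arr 3 (x : ℕ) = rowSum ω σ E x) ∧
      (∀ x : Fin n, (x : ℕ) < m → s'.arr 4 (x : ℕ) = colSum ω σ E x)) n hW.reg0 hb.n_le_R
      (by norm_num) (by rfl) (by rfl) (by simp) ?_ (fun s' hf _ h => ⟨fun x => h.1 x x.2, fun x => h.2 x x.2⟩)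
      (by nlinarith)
    rintro m hm s₁ hf h4 h0 ⟨hI1, hI2⟩
    have hW1 := hW.frame hf
    have hS1 := hS.frame hf
    obtain ⟨x, rfl⟩ : ∃ x : Fin n, (x : ℕ) = m := ⟨⟨m, hm⟩, rfl⟩
    refine Wp.seq (τ₁ := 50 * n + 20) (τ₂ := 50 * n + 70) (Wp.sumTo (N := n)
      (fun z => (if z ∈ E then 1 else 0) * (1 - if x = z then 1 else 0) * ω x (σ z)) X h0
      hb.n_le_R (by norm_num) (by norm_num) (by norm_num) ?_ (fun z => hterm _ _ _ _) hX2 ?_ ?_)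
      (by omega)
    · intro z v
      simp [h4, h0, hS1.arr1, hS1.arr2, hW1.arr0, Fin.val_inj]
    · rw [hsum x fun z => ω x (σ z)]
      change Wp R _ _ ((s₁.setReg 3 (rowSum ω σ E x)).setReg 5 n) _
      refine Wp.store_seq (by simpa using hb.natAbs_le (m := 1) (j := 2) (by simpa using hb.rowSum_le x)) ?_ (by simp)
      refine Wp.seq (τ₁ := 50 * n + 20) (τ₂ := 20) (Wp.sumTo (N := n)
        (fun z => (if z ∈ E then 1 else 0) * (1 - if x = z then 1 else 0) * ω z (σ x)) X (by simp [h0])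
        hb.n_le_R (by norm_num) (by norm_num) (by norm_num) ?_ (fun z => hterm _ _ _ _) hX2 ?_ ?_)
        (by simp)
      · intro z v
        simp [h4, h0, hS1.arr1, hS1.arr2, hW1.arr0, Fin.val_inj]
      · rw [hsum x fun z => ω z (σ x)]
        change Wp R _ _ (State.setReg (State.setReg _ 3 (colSum ω σ E x)) 5 n) _
        refine Wp.store (by simpa using hb.natAbs_le (m := 1) (j := 2) (by simpa using hb.colSum_le x)) ?_ (by simp)
        intro _ _
        constructor
        · intro y hy
          rcases Nat.lt_succ_iff_lt_or_eq.1 hy with h | h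
          · simp [h4, hI1 y h, h.ne]
          · simp [h4, Fin.ext h]
        · intro y hy
          rcases Nat.lt_succ_iff_lt_or_eq.1 hy with h | h
          · simp [h4, hI2 y h, h.ne]
          · simp [h4, Fin.ext h]
      · simp; omega
    · simp; omega
  · rintro s₁ hf ⟨h3, h4⟩
    have hW1 := hW.frame hf
    have hS1 := hS.frame hf
    refine Wp.sumTo (N := n) (fun x => (if x ∈ E then 1 else 0) * rowSum ω σ E x) (X ^ 2) hW1.reg0
      hb.n_le_R (by norm_num) (by norm_num) (by norm_num) ?_ ?_ ?_ ?_ ?_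
    · intro x v
      simp [h3, hS1.arr2]
    · intro x
      have := hb.rowSum_le (σ := σ) (E := E) x
      split_ifs <;> simp [this]
    · have := hb.pow_le (j := 3); have := Nat.mul_le_mul_right (X ^ 2) hb.n_le
      rw [pow_succ' X 2] at *; omega
    · refine ⟨?_, by simpa using h3, by simpa using h4⟩
      simp [linkSum]
    · simp; omega

theorem HasWt.setReg (h : HasWt n ω s) {r : ℕ} {v : ℤ} (h0 : r ≠ 0 := by norm_num)
    (h6 : r ≠ 6 := by norm_num) : HasWt n ω (s.setReg r v) :=
  ⟨by simp [h0.symm, h.reg0], by simp [h6.symm, h.reg6], by simpa using h.arr0⟩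

theorem HasSys.setReg (h : HasSys σ E s) {r : ℕ} {v : ℤ} (h2 : r ≠ 2 := by norm_num) :
    HasSys σ E (s.setReg r v) :=
  ⟨by simp [h2.symm, h.reg2], by simpa using h.arr1, by simpa using h.arr2⟩

theorem HasSums.setReg (h : HasSums ω σ E s) {r : ℕ} {v : ℤ} (h8 : r ≠ 8 := by norm_num) :
    HasSums ω σ E (s.setReg r v) :=
  ⟨by simp [h8.symm, h.reg8], by simpa using h.arr3, by simpa using h.arr4⟩

theorem fin_mul_add_div (x z : Fin n) : (((x : ℕ) : ℤ) * n + (z : ℕ)) / n = (x : ℕ) := by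
  have hz := z.2
  rw [mul_comm, Int.mul_add_ediv_left _ _ (by omega), Int.ediv_eq_zero_of_lt (by omega) (by omega),
    add_zero]

/-- A pair is coded by `x * n + z`, so one loop over `n * n` codes searches all pairs. -/
theorem exists_divNat_modNat (x z : Fin n) : ∃ p : Fin (n * n), p.divNat = x ∧ p.modNat = z :=
  ⟨finProdFinEquiv (x, z), by
    have := finProdFinEquiv.symm_apply_apply (x, z)
    rwa [finProdFinEquiv_symm_apply, Prod.mk.injEq] at this⟩

theorem divNat_div (p : Fin (n * n)) : ((p : ℕ) : ℤ) / n = (p.divNat : ℕ) := by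
  simp [Fin.coe_divNat]

theorem modNat_sub (p : Fin (n * n)) :
    ((p : ℕ) : ℤ) - n * (((p.divNat : Fin n) : ℕ) : ℤ) = (p.modNat : ℕ) := by
  rw [← divNat_div, Fin.coe_modNat, Int.natCast_mod, Int.emod_def]

theorem divNat_mul_add (p : Fin (n * n)) :
    ((p : ℕ) : ℤ) = ((p.divNat : Fin n) : ℕ) * n + ((p.modNat : Fin n) : ℕ) := by
  rw [← modNat_sub]; ring

theorem bestProg_spec (hb : Bounds n ω X R) (hW : HasWt n ω s) (hS : HasSys σ E s)
    (hs : HasSums ω σ E s) (hE : 2 ≤ E.card) :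
    Wp R bestProg (300 * (n * n) + 20) s fun s' => ∃ x ∈ E, ∃ z ∈ E, x ≠ z ∧
      s'.reg 9 = (x : ℕ) * n + (z : ℕ) ∧ s'.reg 10 = mergeVal ω σ E x z ∧
      ∀ x' ∈ E, ∀ z' ∈ E, x' ≠ z' → mergeVal ω σ E x z ≤ mergeVal ω σ E x' z' := by
  have h0 := hW.reg0
  have key : ∀ (p : Fin (n * n)) v v', let s' := ((s.setReg 9 v).setReg 10 v').setReg 5 (p : ℕ)
      (fstE (rg 5)).eval s' = (p.divNat : ℕ) ∧ (sndE (rg 5)).eval s' = (p.modNat : ℕ) := by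
    intro p v v'
    have e0 : (((s.setReg 9 v).setReg 10 v').setReg 5 (p : ℕ)).reg 0 = n := h0
    have e5 : (((s.setReg 9 v).setReg 10 v').setReg 5 (p : ℕ)).reg 5 = (p : ℕ) := rfl
    simp only [fstE, sndE, eval_div, eval_sub, eval_mul, eval_rg, e0, e5, divNat_div, modNat_sub,
      and_self]
  refine Wp.argmin (N := n * n) (fun p => p.divNat ∈ E ∧ p.modNat ∈ E ∧ p.divNat ≠ p.modNat)
    (fun p => mergeVal ω σ E p.divNat p.modNat) hW.reg6 hb.nn_le_R hb.one_le_R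
    (by norm_num) (by norm_num) (by norm_num) (by norm_num) (by norm_num) (by norm_num) ?_ ?_ ?_ ?_ ?_
  · intro p v v'
    obtain ⟨h1, h2⟩ := key p v v'
    simp only [eval_mul, eval_sub, eval_eq, eval_one, eval_ar, h1, h2, State.setReg_arr, hS.arr2,
      Nat.cast_inj, Fin.val_inj]
    split_ifs <;> simp_all
  · intro p v v' _
    obtain ⟨h1, h2⟩ := key p v v'
    simp only [eval_mul, eval_sub, eval_wE, eval_one, eval_ar, h1, h2, State.setReg_arr, hS.arr1,
      hs.arr3, hs.arr4, mergeVal, eval_rg, State.setReg_reg]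
    simp [h0, hS.reg2, hW.arr0, -Fin.coe_divNat, -Fin.coe_modNat]
  · intro p _
    exact hb.natAbs_le (m := 5) (j := 2) (hb.mergeVal_le _ _)
  · rintro v v' (⟨-, h1⟩ | ⟨p, rfl, ⟨h1, h2, h3⟩, rfl, h4⟩)
    -- A failed search is impossible, since two distinct ends exist.
    · exfalso
      obtain ⟨x, hx, z, hz, hxz, -⟩ := exists_mergeVal_le ω hE (σ := σ)
      obtain ⟨p, rfl, rfl⟩ := exists_divNat_modNat x z
      exact h1 p ⟨hx, hz, hxz⟩
    · refine ⟨_, h1, _, h2, h3, divNat_mul_add p, rfl, fun x hx z hz hxz => ?_⟩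
      obtain ⟨p', rfl, rfl⟩ := exists_divNat_modNat x z
      exact h4 p' ⟨hx, hz, hxz⟩
  · simp only [cost_mul, cost_sub, cost_eq, cost_ar, cost_rg, cost_one, cost_wE, fstE, sndE, cost_div]
    omega

theorem mergeProg_spec (hb : Bounds n ω X R) (hS : HasSys σ E s) {x z : Fin n} (h4 : s.reg 4 = (x : ℕ))
    (h12 : s.reg 12 = (z : ℕ)) (hx : x ∈ E) (hxz : x ≠ z) :
    Wp R mergeProg 100 s fun s' => HasSys (σ * Equiv.swap x z) (E.erase x) s' := by
  have hc : 1 ≤ E.card := Finset.card_pos.2 ⟨x, hx⟩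
  have hR := hb.one_le_R
  have hEn : E.card ≤ R := (Finset.card_le_univ E).trans (by simpa using hb.n_le_R)
  refine Wp.assign_seq (by simpa [h4, hS.arr1] using hb.fin_le (σ x)) ?_ (by simp)
  refine Wp.store_seq (by simpa [h12, hS.arr1] using hb.fin_le (σ z)) ?_ (by simp)
  refine Wp.store_seq (by simpa [h4, hS.arr1] using hb.fin_le (σ x)) ?_ (by simp)
  refine Wp.store_seq (by simp) (Wp.assign (by simp [hS.reg2]; omega) ?_ (by simp)) (by simp)
  refine ⟨?_, fun y => ?_, fun y => ?_⟩
  · simp [hS.reg2, Finset.card_erase_of_mem hx, hc]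
  · by_cases hy : y = x
    · subst hy; simp [h4, h12, hS.arr1, Fin.val_inj, hxz]
    · by_cases hy' : y = z
      · subst hy'; simp [h4, h12, hS.arr1]
      · simp [h4, h12, hS.arr1, hy, hy', Fin.val_inj, Equiv.swap_apply_of_ne_of_ne]
  · by_cases hy : y = x
    · subst hy; simp [h4, h12]
    · simp [h4, h12, hS.arr2, hy, Fin.val_inj]

/-- The condition under which the greedy phase stops. -/
def StopsAt (ω : Fin n → Fin n → ℤ) (σ : Equiv.Perm (Fin n)) (E : Finset (Fin n)) (k : ℕ)
    (x z : Fin n) : Prop :=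
  n < E.card + 100 * k ∧ 0 < 100 * (((E.card : ℤ) - 1) * mergeVal ω σ E x z + linkSum ω σ E) + potDen E

theorem greedyStep_spec (hb : Bounds n ω X R) (hW : HasWt n ω s) (hS : HasSys σ E s) {k : ℕ}
    (hk : s.reg 1 = k) (hE : 2 ≤ E.card) :
    Wp R greedyStep (2000 * (n + 1) ^ 2) s fun s' => ∃ x ∈ E, ∃ z ∈ E, x ≠ z ∧
      (∀ x' ∈ E, ∀ z' ∈ E, x' ≠ z' → mergeVal ω σ E x z ≤ mergeVal ω σ E x' z') ∧
      ((StopsAt ω σ E k x z ∧ s'.reg 7 = 1 ∧ HasSys σ E s' ∧ HasSums ω σ E s') ∨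
        (¬ StopsAt ω σ E k x z ∧ s'.reg 7 = s.reg 7 ∧
          HasSys (σ * Equiv.swap x z) (E.erase x) s')) := by
  refine (sumsProg_spec hb hW hS).seq' (τ₂ := 300 * (n * n) + 400) (fun s₁ hf₁ hs₁ => ?_) (by nlinarith)
  have hW₁ := hW.frame hf₁
  have hS₁ := hS.frame hf₁
  refine (bestProg_spec hb hW₁ hS₁ hs₁ hE).seq' (τ₂ := 380) (fun s₂ hf₂ => ?_) (by omega)
  rintro ⟨x, hx, z, hz, hxz, h9, h10, hmin⟩
  have hW₂ := hW₁.frame hf₂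
  have hS₂ := hS₁.frame hf₂
  have hs₂ := hs₁.frame hf₂
  have hk₂ : s₂.reg 1 = k := by rw [hf₂.reg _ (by rfl), hf₁.reg _ (by rfl), hk]
  have h7₂ : s₂.reg 7 = s.reg 7 := by rw [hf₂.reg _ (by rfl), hf₁.reg _ (by rfl)]
  have e1 : (fstE (rg 9)).eval s₂ = (x : ℕ) := by
    simp [fstE, h9, hW₂.reg0, fin_mul_add_div]
  refine Wp.assign_seq (by rw [e1]; exact hb.fin_le x) ?_ (by simp [fstE])
  rw [e1]
  have e2 : (sndE (rg 9)).eval (s₂.setReg 4 (x : ℕ)) = (z : ℕ) := by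
    simp [sndE, h9, hW₂.reg0, fin_mul_add_div]; ring
  refine Wp.assign_seq (by rw [e2]; exact hb.fin_le z) ?_ (by simp [fstE, sndE])
  rw [e2]
  have hS₃ : HasSys σ E ((s₂.setReg 4 (x : ℕ)).setReg 12 (z : ℕ)) := hS₂.setReg.setReg
  have hc : (((rg 0 - rg 2).lt (100 * rg 1) *
        Expr.lt 0 (100 * ((rg 2 - 1) * rg 10 + rg 8) + (rg 2 - 1) * (rg 2 - 2))).eval
          ((s₂.setReg 4 (x : ℕ)).setReg 12 (z : ℕ)) ≠ 0) ↔ StopsAt ω σ E k x z := by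
    simp [StopsAt, hW₂.reg0, hS₂.reg2, hk₂, h10, hs₂.reg8, potDen]
    constructor <;> rintro ⟨h1, h2⟩ <;> exact ⟨by first | assumption | omega, by first | assumption | omega⟩
  refine Wp.ite (fun h => ?_) (fun h => ?_) ?_
  · rw [hc] at h
    refine Wp.assign (by simpa using hb.one_le_R) ?_ ?_
    · exact ⟨x, hx, z, hz, hxz, hmin, Or.inl ⟨h, by simp, hS₂.setReg.setReg.setReg,
        hs₂.setReg.setReg.setReg⟩⟩
    · simp [fstE, sndE]
  · have h : ¬ StopsAt ω σ E k x z := fun h' => hc.2 h' h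
    refine (mergeProg_spec hb hS₃ (by simp) (by simp) hx hxz).mono ?_ ?_
    · simp [fstE, sndE]
    · intro s' hf h'
      refine ⟨x, hx, z, hz, hxz, hmin, Or.inr ⟨h, ?_, h'⟩⟩
      rw [hf.reg _ (by rfl), ← h7₂]; simp
  · simp [fstE, sndE]

/-- The greedy phase has stopped before the path system is a Hamilton cycle. -/
def IsStuck (ω : Fin n → Fin n → ℤ) (k : ℕ) (σ : Equiv.Perm (Fin n)) (E : Finset (Fin n)) : Prop :=
  3 ≤ E.card ∧ n < E.card + 100 * k ∧ ∀ x ∈ E, ∀ z ∈ E, x ≠ z →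
    0 < 100 * (((E.card : ℤ) - 1) * mergeVal ω σ E x z + linkSum ω σ E) + potDen E

/-- Invariant: unless the phase has stopped, `j` merges have lowered the mean weight by at least
`min j (100k) / 100`, because each of the first `100k` merges gains `1/100` and no later one loses.
Each merge removes one end and moves at most two more vertices, which bounds the number of moved
vertices in terms of `E`. -/
theorem greedyProg_spec (hb : Bounds n ω X R) (hn : 3 ≤ n) (hW : HasWt n ω s)
    (hS : HasSys (1 : Equiv.Perm (Fin n)) Finset.univ s) {k : ℕ} (hk : s.reg 1 = k) (hkn : 10000 * k + 1 ≤ n)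
    (h7 : s.reg 7 = 0) :
    Wp R greedyProg (3000 * (n * (n + 1) ^ 2)) s fun s' => ∃ σ E, HasSys σ E s' ∧ IsPathSystem σ E ∧
      (Finset.univ.filter fun v => σ v ≠ v).card + 2 * E.card ≤ 2 * n ∧
      ((s'.reg 7 = 0 ∧ E.card = 1 ∧
          expWeight ω σ E ≤ expWeight ω 1 Finset.univ - k) ∨
        (s'.reg 7 = 1 ∧ HasSums ω σ E s' ∧ IsStuck ω k σ E)) := by
  have hR := hb.n_le_R
  refine Wp.assign_seq (by simp [hW.reg0]; omega) ?_ (by simp; nlinarith)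
  have e17 : (rg 0 - 1).eval s = (n - 1 : ℕ) := by simp [hW.reg0]; omega
  rw [e17]
  refine Wp.forUp (τ₁ := 2000 * (n + 1) ^ 2 + 10) (fun j s' => ∃ σ E, HasSys σ E s' ∧ IsPathSystem σ E ∧
      (Finset.univ.filter fun v => σ v ≠ v).card + 2 * E.card ≤ 2 * n ∧
      ((s'.reg 7 = 0 ∧ E.card + j = n ∧
          expWeight ω σ E ≤ expWeight ω 1 Finset.univ - min (j : ℚ) (100 * k) / 100) ∨
        (s'.reg 7 = 1 ∧ HasSums ω σ E s' ∧ IsStuck ω k σ E))) (n - 1) (by simp) (by omega) (by norm_num)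
    (by rfl) (by rfl) ?_ ?_ ?_ ?_
  · refine ⟨1, Finset.univ, hS.setReg.setReg, isPathSystem_one, by simp, Or.inl ⟨by simp [h7], by simp, ?_⟩⟩
    rw [min_eq_left (by positivity)]; simp
  · rintro j hj s₁ hf h11 h17 ⟨σ, E, hS₁, hps, hmv, hcase⟩
    have hW₁ : HasWt n ω s₁ := (hW.setReg (r := 17) (v := (n - 1 : ℕ))).frame hf
    have hk₁ : s₁.reg 1 = k := by rw [hf.reg _ (by rfl)]; simpa using hk
    refine Wp.ite (fun h => ?_) (fun h => ?_) (by simp)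
    · simp only [eval_rg] at h
      rcases hcase with hcase | hcase
      · exact absurd hcase.1 h
      · exact Wp.skip (fun _ _ => ⟨σ, E, hS₁.setReg, hps, hmv, Or.inr ⟨by simp [hcase.1],
          hcase.2.1.setReg, hcase.2.2⟩⟩) (by simp)
    · simp only [eval_rg] at h
      rcases hcase with ⟨-, hcard, hexp⟩ | hcase
      swap
      · rw [hcase.1] at h; norm_num at h
      have hE2 : 2 ≤ E.card := by omega
      refine (greedyStep_spec hb hW₁ hS₁ hk₁ hE2).mono (by simp) ?_
      rintro s₂ hf₂ ⟨x, hx, z, hz, hxz, hmin, ⟨⟨hst1, hst2⟩, h7', hS₂, hs₂⟩ | ⟨hst, h7', hS₂⟩⟩ - -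
      · refine ⟨σ, E, hS₂.setReg, hps, hmv, Or.inr ⟨by simp [h7'], hs₂.setReg, by omega, hst1, ?_⟩⟩
        -- The stopping inequality was tested for a pair with the least `mergeVal`, so it holds for
        -- all pairs.
        intro x' hx' z' hz' hxz'
        have := hmin x' hx' z' hz' hxz'
        have h1 : ((E.card : ℤ) - 1) * mergeVal ω σ E x z ≤ ((E.card : ℤ) - 1) * mergeVal ω σ E x' z' :=
          mul_le_mul_of_nonneg_left this (by omega)
        linarith
      · have hce : (E.erase x).card = E.card - 1 := Finset.card_erase_of_mem hx
        refine ⟨σ * Equiv.swap x z, E.erase x, hS₂.setReg, hps.merge hx hz hxz, ?_,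
          Or.inl ⟨by simp [h7', h], by omega, ?_⟩⟩
        · have := card_moved_merge (σ := σ) x z
          omega
        · obtain ⟨x', hx', z', hz', hxz', hle⟩ := exists_mergeVal_le ω hE2 (σ := σ)
          have h1 : ((E.card : ℤ) - 1) * mergeVal ω σ E x z ≤ ((E.card : ℤ) - 1) * mergeVal ω σ E x' z' :=
            mul_le_mul_of_nonneg_left (hmin x' hx' z' hz' hxz') (by omega)
          have h2 : ((E.card : ℤ) - 1) * mergeVal ω σ E x z + linkSum ω σ E ≤ 0 := by linarith
          by_cases hE3 : 3 ≤ E.card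
          · rw [expWeight_merge ω hx hz hxz hE3]
            have hN : (3 : ℚ) ≤ E.card := by exact_mod_cast hE3
            have hpos : (0 : ℚ) < ((E.card : ℚ) - 1) * ((E.card : ℚ) - 2) := by
              apply mul_pos <;> linarith
            by_cases hjk : j < 100 * k
            · have h3 : 100 * (((E.card : ℤ) - 1) * mergeVal ω σ E x z + linkSum ω σ E) +
                  ((E.card : ℤ) - 1) * ((E.card : ℤ) - 2) ≤ 0 := by
                by_contra hcon
                exact hst ⟨by omega, by rw [potDen]; linarith⟩
              have h4 : ((((E.card : ℤ) - 1) * mergeVal ω σ E x z + linkSum ω σ E : ℤ) : ℚ) /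
                  (((E.card : ℚ) - 1) * ((E.card : ℚ) - 2)) ≤ - (1 / 100) := by
                rw [div_le_iff₀ hpos]
                have h5 : (100 * (((E.card : ℤ) - 1) * mergeVal ω σ E x z + linkSum ω σ E) +
                  ((E.card : ℤ) - 1) * ((E.card : ℤ) - 2) : ℚ) ≤ 0 := by exact_mod_cast h3
                push_cast at h5 ⊢
                linarith
              rw [min_eq_left (by exact_mod_cast hjk.le)] at hexp
              rw [min_eq_left (by exact_mod_cast hjk)]
              push_cast at h4 ⊢
              linarith
            · have h4 : ((((E.card : ℤ) - 1) * mergeVal ω σ E x z + linkSum ω σ E : ℤ) : ℚ) /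
                  (((E.card : ℚ) - 1) * ((E.card : ℚ) - 2)) ≤ 0 :=
                div_nonpos_of_nonpos_of_nonneg (by exact_mod_cast h2) hpos.le
              have h5 : ((100 * k : ℕ) : ℚ) ≤ j := by exact_mod_cast (by omega : 100 * k ≤ j)
              push_cast at h5
              rw [min_eq_right h5] at hexp
              rw [min_eq_right (by push_cast; linarith)]
              linarith
          -- Two ends are left, so `j = n - 2 ≥ 100k`: the whole gain has been collected before this
          -- neutral merge.
          · rw [expWeight_merge_two ω hx hz hxz (by omega)]
            have h5 : ((100 * k : ℕ) : ℚ) ≤ j := by exact_mod_cast (by omega : 100 * k ≤ j)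
            push_cast at h5
            rw [min_eq_right h5] at hexp
            rw [min_eq_right (by push_cast; linarith)]
            exact hexp
  · rintro s₁ hf h11 ⟨σ, E, hS₁, hps, hmv, hcase⟩
    refine ⟨σ, E, hS₁, hps, hmv, hcase.imp_left fun ⟨h1, h2, h3⟩ => ⟨h1, by omega, ?_⟩⟩
    have h5 : ((100 * k : ℕ) : ℚ) ≤ (n - 1 : ℕ) := by exact_mod_cast (by omega : 100 * k ≤ n - 1)
    push_cast at h5
    rw [min_eq_right h5] at h3
    linarith
  · simp only [cost_sub, cost_rg, cost_one]
    obtain ⟨m, rfl⟩ : ∃ m, n = m + 1 := ⟨n - 1, by omega⟩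
    rw [Nat.add_sub_cancel]
    have : 3000 * ((m + 1) * (m + 1 + 1) ^ 2) = 3000 * (m * (m + 2) ^ 2) + 3000 * (m + 2) ^ 2 := by ring
    have h2 : 4 ≤ (m + 1 + 1) ^ 2 := by nlinarith
    have h3 : m * (2000 * (m + 1 + 1) ^ 2 + 10 + 10) ≤ m * (3000 * (m + 2) ^ 2) :=
      Nat.mul_le_mul_left _ (by nlinarith)
    rw [Nat.mul_left_comm m 3000] at h3
    rw [show m + 1 + 1 = m + 2 from rfl] at *
    rw [show m * (2000 * (m + 2) ^ 2 + 10 + 10) = m * (2000 * (m + 2) ^ 2 + 20) from rfl] at *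
    omega

end Specs

/-! ### The program: the kernel -/

/-- Copies the input, and computes twice the total weight and the flag of a small instance. -/
def startProg : Program :=
  .seq initProg (.seq sumsProg (.seq (.assign 14 (rg 8))
    (.seq (.assign 15 ((rg 0).lt (10000 * rg 1 + 1))) (.assign 7 (rg 15)))))

/-- Computes the exceptional set and the potentials. -/
def potProg : Program :=
  .seq (fill 6 4 0 (1 - (ar 1 (rg 4)).eq (rg 4) * (rg 15).eq 0))
    (.seq (fill 5 4 0 ((ar 6 (rg 4)).eq 0 *
      ((2 * ((rg 2 - 1) * (ar 3 (rg 4) + ar 4 (rg 4)) - rg 8) + (rg 2 - 1) * (rg 2 - 2)) /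
        (2 * ((rg 2 - 1) * (rg 2 - 2))))))
    (sumTo 18 4 0 (ar 5 (rg 4))))

/-- Moves the vertex at the position in the register `r` into the kernel. -/
def swapIn (r : ℕ) : Program :=
  .seq (.assign 12 (ar 7 (rg 13))) (.seq (.store (.addr 7 (rg 13)) (ar 7 (rg r)))
    (.seq (.store (.addr 7 (rg r)) (rg 12)) (.assign 13 (rg 13 + 1))))

/-- Orders the vertices so that the exceptional ones come first. -/
def partProg : Program :=
  .seq (fill 7 4 0 (rg 4)) (.seq (.assign 13 0)
    (IntRAM.forUp 11 0 (.ite (ar 6 (ar 7 (rg 11))) (swapIn 11) .skip)))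

/-- Twice the reduced weight of a pair. -/
def rE (x y : Expr) : Expr := 2 * wE x y - ar 5 x - ar 5 y

/-- Chooses the kernel. -/
def selProg : Program :=
  .seq (.assign 16 (rg 13)) (.seq (.assign 17 (3 * rg 16 * rg 16 * rg 16))
    (IntRAM.forUp 11 17
      (.seq (.assign 25 (ar 7 (rg 11 / (3 * rg 16 * rg 16))))
      (.seq (.assign 26 (ar 7 (rg 11 / (3 * rg 16) - rg 16 * (rg 11 / (3 * rg 16 * rg 16)))))
      (.seq (argmin 9 10 5 0 (1 - (rg 5).lt (rg 13))
        (rE (rg 25) (ar 7 (rg 5)) + rE (rg 26) (ar 7 (rg 5))))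
      (.ite ((rg 9).lt 0) .skip (swapIn 9)))))))

/-! ### Correctness of the set-up, the potentials and the kernel -/

section Specs
variable {n : ℕ} {ω : Fin n → Fin n → ℤ} {σ : Equiv.Perm (Fin n)} {E A : Finset (Fin n)}
  {Q : Fin n → ℤ} {ord : Equiv.Perm (Fin n)} {K : ℕ} {s s' : State} {R X : ℕ}

theorem linkSum_one (h0 : ∀ x, ω x x = 0) : linkSum ω 1 Finset.univ = ∑ x, ∑ y, ω x y := by
  simp only [linkSum, rowSum, Equiv.Perm.one_apply]
  refine Finset.sum_congr rfl fun x _ => ?_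
  rw [← Finset.sum_erase_add _ _ (Finset.mem_univ x), h0, add_zero]

/-- The arrays cover the whole memory; nonnegative addresses are their cells of negative index. -/
theorem mem_eq_arr (s : State) (a : ℤ) :
    s.mem a = s.arr ⟨(a % 16).toNat, by omega⟩ (-(a / 16) - 1) := by
  unfold State.arr cellAddr
  congr 1
  dsimp only
  omega

theorem initProg_spec (hb : Bounds n ω X R) (h0 : s.reg 0 = n)
    (hmem : ∀ x y : Fin n, s.mem ((x : ℕ) * n + (y : ℕ)) = ω x y) :
    Wp R initProg (200 * (n + 1) ^ 2) s fun s' =>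
      HasWt n ω s' ∧ HasSys (1 : Equiv.Perm (Fin n)) Finset.univ s' := by
  have hR1 := hb.one_le_R
  refine Wp.assign_seq (by simpa [h0, Int.natAbs_mul] using hb.nn_le_R) ?_ (by simp; nlinarith)
  refine Wp.seq (τ₁ := 22 * (n * n) + 10) (τ₂ := 100 * (n + 1)) (Wp.fill (N := n * n)
    (fun p => ω p.divNat p.modNat) (by simp [h0]) hb.nn_le_R (by norm_num) ?_
    (fun p => by simpa using hb.natAbs_le (m := 1) (j := 1) (by simpa using hb.wt_le _ _)) ?_ ?_) ?_
  · intro p s₁ _ h4 ha hneg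
    -- The input lies in cells of negative index, which the copying does not overwrite.
    have e : s₁.mem (p : ℕ) = s.mem (p : ℕ) := by
      rw [mem_eq_arr, mem_eq_arr]
      by_cases hj : (⟨(((p : ℕ) : ℤ) % 16).toNat, by omega⟩ : Fin 16) = 0
      · rw [hj, hneg _ (by omega)]; rfl
      · rw [ha _ hj]; rfl
    simp only [Expr.eval, h4, e]
    rw [divNat_mul_add, hmem]
  · intro s₁ hr₁ ha₁ h₁
    have h0₁ : s₁.reg 0 = n := by rw [hr₁ _ (by norm_num)]; simpa using h0
    have hW₁ : HasWt n ω s₁ := by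
      refine ⟨h0₁, by rw [hr₁ _ (by norm_num)]; simp [h0], fun x y => ?_⟩
      obtain ⟨p, rfl, rfl⟩ := exists_divNat_modNat x y
      rw [← divNat_mul_add]
      exact h₁ p
    refine Wp.seq' (τ₁ := 21 * n + 10) (τ₂ := 60 * (n + 1))
      (I := fun s' => ∀ x : Fin n, s'.arr 1 (x : ℕ) = (x : ℕ))
      (Wp.fill (N := n) (fun x => (x : ℕ)) h0₁ hb.n_le_R (by norm_num)
        (fun x s' _ h4 _ _ => h4) hb.fin_le (fun s' _ _ h => h) (by simp; omega)) ?_ (by omega)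
    intro s₂ hf₂ h₂
    have hW₂ := hW₁.frame hf₂
    refine Wp.seq' (τ₁ := 21 * n + 10) (τ₂ := 2)
      (I := fun s' => ∀ x : Fin n, s'.arr 2 (x : ℕ) = 1)
      (Wp.fill (N := n) (fun x => 1) hW₂.reg0 hb.n_le_R (by norm_num)
        (fun x s' _ h4 _ _ => by simp) (fun _ => by simpa using hR1) (fun s' _ _ h => h)
        (by simp; omega)) ?_ (by omega)
    intro s₃ hf₃ h₃
    have hW₃ := hW₂.frame hf₃
    refine Wp.assign (by simpa [hW₃.reg0] using hb.n_le_R) ⟨hW₃.setReg, ?_, ?_, ?_⟩ (by simp)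
    · simp [hW₃.reg0]
    · intro x
      simp [hf₃.arr 1 (by rfl), h₂]
    · simpa using h₃
  · simp [Expr.cost]
    rw [mul_comm]
  · simp only [cost_mul, cost_rg]
    have : (n + 1) ^ 2 = n * n + 2 * n + 1 := by ring
    rw [this]; omega

theorem startProg_spec (hb : Bounds n ω X R) {k : ℕ} (h0 : s.reg 0 = n) (h1 : s.reg 1 = k)
    (hmem : ∀ x y : Fin n, s.mem ((x : ℕ) * n + (y : ℕ)) = ω x y) (hω : ∀ x, ω x x = 0) :
    Wp R startProg (1300 * (n + 1) ^ 2) s fun s' =>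
      HasWt n ω s' ∧ HasSys (1 : Equiv.Perm (Fin n)) Finset.univ s' ∧
      HasSums ω (1 : Equiv.Perm (Fin n)) Finset.univ s' ∧ s'.reg 1 = k ∧
      s'.reg 14 = ∑ x, ∑ y, ω x y ∧ s'.reg 15 = (if n < 10000 * k + 1 then 1 else 0) ∧
      s'.reg 7 = if n < 10000 * k + 1 then 1 else 0 := by
  have hR1 := hb.one_le_R
  refine (initProg_spec hb h0 hmem).seq' (τ₂ := 1000 * (n + 1) ^ 2 + 20) ?_ (by nlinarith)
  rintro s₁ hf₁ ⟨hW₁, hS₁⟩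
  refine (sumsProg_spec hb hW₁ hS₁).seq' (τ₂ := 20) ?_ (by nlinarith)
  intro s₂ hf₂ hs₂
  have hW₂ := hW₁.frame hf₂
  have hS₂ := hS₁.frame hf₂
  have hk₂ : s₂.reg 1 = k := by rw [hf₂.reg _ (by rfl), hf₁.reg _ (by rfl), h1]
  refine Wp.assign_seq ?_ (Wp.assign_seq ?_ (Wp.assign ?_ ?_ (by simp)) (by simp)) (by simp)
  · simpa [hs₂.reg8] using hb.natAbs_le (m := 1) (j := 3) (by simpa using hb.linkSum_le)
  · simp; split_ifs <;> simp [hR1]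
  · simp; split_ifs <;> simp [hR1]
  · have e : (n : ℤ) < 10000 * k + 1 ↔ n < 10000 * k + 1 := by omega
    refine ⟨hW₂.setReg.setReg.setReg, hS₂.setReg.setReg.setReg, hs₂.setReg.setReg.setReg, ?_, ?_, ?_, ?_⟩
    · simpa using hk₂
    · simp [hs₂.reg8, linkSum_one hω]
    · simp [hW₂.reg0, hk₂, e]
    · simp [hW₂.reg0, hk₂, e]

/-- The state holds the exceptional set `A` and the potentials `Q`. -/
structure HasPot (A : Finset (Fin n)) (Q : Fin n → ℤ) (s : State) : Prop where
  arr5 : ∀ x : Fin n, s.arr 5 (x : ℕ) = Q x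
  arr6 : ∀ x : Fin n, s.arr 6 (x : ℕ) = if x ∈ A then 1 else 0

theorem HasPot.frame {p : Program} (h : HasPot A Q s) (hf : Frame p s s')
    (ha5 : p.writesArr 5 = false := by rfl) (ha6 : p.writesArr 6 = false := by rfl) :
    HasPot A Q s' :=
  ⟨fun x => by rw [hf.arr _ ha5, h.arr5], fun x => by rw [hf.arr _ ha6, h.arr6]⟩

theorem HasPot.setReg (h : HasPot A Q s) {r : ℕ} {v : ℤ} : HasPot A Q (s.setReg r v) :=
  ⟨by simpa using h.arr5, by simpa using h.arr6⟩

/-- The rounded potentials, cut off on the exceptional set. -/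
def cutPot (ω : Fin n → Fin n → ℤ) (σ : Equiv.Perm (Fin n)) (E A : Finset (Fin n)) (x : Fin n) : ℤ :=
  if x ∈ A then 0 else (2 * potNum ω σ E x + potDen E) / (2 * potDen E)

/-- A quotient of integers is no larger than its numerator in absolute value, also when the
denominator is zero. -/
theorem Bounds.cutPot_le (hb : Bounds n ω X R) (x : Fin n) :
    (cutPot ω σ E A x).natAbs ≤ 10 * X ^ 3 := by
  unfold cutPot
  split_ifs
  · simp
  refine (Int.natAbs_ediv_le_natAbs _ _).trans ?_
  have hX := hb.pos
  have hE := hb.card_le E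
  have hc : ((E.card : ℤ) - 1).natAbs ≤ X := by omega
  have h1 : (((E.card : ℤ) - 1) * (rowSum ω σ E x + colSum ω σ E x)).natAbs ≤ 2 * X ^ 3 := by
    rw [Int.natAbs_mul]
    calc _ ≤ X * (2 * X ^ 2) := Nat.mul_le_mul hc (by
          have := hb.rowSum_le (σ := σ) (E := E) x
          have := hb.colSum_le (σ := σ) (E := E) x
          omega)
      _ = _ := by ring
  have h2 := hb.linkSum_le (σ := σ) (E := E)
  have h3 : (potDen E).natAbs ≤ 2 * X ^ 3 := by
    rw [potDen, Int.natAbs_mul]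
    calc _ ≤ X * (2 * X) := Nat.mul_le_mul hc (by omega)
      _ = 2 * X ^ 2 := by ring
      _ ≤ _ := Nat.mul_le_mul_left _ (Nat.pow_le_pow_right hX (by norm_num))
  rw [potNum]
  omega

/-- Register `15` flags a small instance; there every vertex is made exceptional. -/
theorem potProg_spec (hb : Bounds n ω X R) (hW : HasWt n ω s) (hS : HasSys σ E s)
    (hs : HasSums ω σ E s) (hA : ∀ x, x ∈ A ↔ (σ x ≠ x ∨ s.reg 15 ≠ 0)) :
    Wp R potProg (300 * (n + 1)) s fun s' => HasPot A (cutPot ω σ E A) s' ∧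
      s'.reg 18 = ∑ x, cutPot ω σ E A x := by
  have hR1 := hb.one_le_R
  refine Wp.seq' (τ₁ := 50 * n + 10) (τ₂ := 200 * (n + 1))
    (I := fun s' => ∀ x : Fin n, s'.arr 6 (x : ℕ) = if x ∈ A then 1 else 0)
    (Wp.fill (N := n) (fun x => if x ∈ A then 1 else 0) hW.reg0 hb.n_le_R (by norm_num)
      ?_ (fun _ => by split_ifs <;> simp [hR1]) (fun s' _ _ h => h) (by simp; omega)) ?_ (by omega)
  · intro x s₁ hr h4 ha _
    simp only [eval_sub, eval_one, eval_mul, eval_eq, eval_ar, eval_rg, h4, hr 15 (by norm_num),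
      ha 1 (by decide), hS.arr1, Nat.cast_inj, Fin.val_inj, eval_zero, hA]
    by_cases h1 : σ x = x <;> by_cases h2 : s.reg 15 = 0 <;> simp [h1, h2]
  · intro s₁ hf₁ h₁
    have hW₁ := hW.frame hf₁
    have hS₁ := hS.frame hf₁
    have hs₁ := hs.frame hf₁
    refine Wp.seq' (τ₁ := 90 * n + 10) (τ₂ := 50 * (n + 1))
      (I := fun s' => ∀ x : Fin n, s'.arr 5 (x : ℕ) = cutPot ω σ E A x)
      (Wp.fill (N := n) (fun x => cutPot ω σ E A x) hW₁.reg0 hb.n_le_R (by norm_num)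
        ?_ (fun x => hb.natAbs_le (hb.cutPot_le x)) (fun s' _ _ h => h)
        (by simp; omega)) ?_ (by omega)
    · intro x s₂ hr h4 ha _
      simp only [eval_sub, eval_one, eval_mul, eval_eq, eval_ar, eval_rg, h4, hr 8 (by norm_num),
        hr 2 (by norm_num), eval_add, eval_div, eval_ofNat, hS₁.reg2, hs₁.reg8,
        ha 6 (by decide), ha 3 (by decide), ha 4 (by decide), hs₁.arr3, hs₁.arr4, h₁, eval_zero,
        cutPot, potNum, potDen]
      by_cases h1 : x ∈ A <;> simp [h1]
    · intro s₂ hf₂ h₂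
      refine Wp.sumTo (N := n) (fun x => cutPot ω σ E A x) (10 * X ^ 3) (hW₁.frame hf₂).reg0 hb.n_le_R
        (by norm_num) (by norm_num) (by norm_num) (fun x v => by simp [h₂])
        (fun x => hb.cutPot_le x) ?_ ⟨⟨by simpa using h₂, ?_⟩, by simp⟩ (by simp; omega)
      · have := hb.pow_le (j := 4); have := Nat.mul_le_mul_right (X ^ 3) hb.n_le
        have e : n * (10 * X ^ 3) = 10 * (n * X ^ 3) := by ring
        rw [pow_succ' X 3] at *; omega
      · intro x; simp [hf₂.arr 6 (by rfl), h₁]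

/-- The state holds the order `ord` of the vertices and the size `K` of the kernel. -/
structure HasOrd (ord : Equiv.Perm (Fin n)) (K : ℕ) (s : State) : Prop where
  reg13 : s.reg 13 = K
  arr7 : ∀ i : Fin n, s.arr 7 (i : ℕ) = (ord i : ℕ)

theorem HasOrd.frame {p : Program} (h : HasOrd ord K s) (hf : Frame p s s')
    (h13 : p.writesReg 13 = false := by rfl) (ha7 : p.writesArr 7 = false := by rfl) :
    HasOrd ord K s' :=
  ⟨by rw [hf.reg _ h13, h.reg13], fun x => by rw [hf.arr _ ha7, h.arr7]⟩

theorem HasOrd.setReg (h : HasOrd ord K s) {r : ℕ} {v : ℤ} (h13 : r ≠ 13 := by norm_num) :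
    HasOrd ord K (s.setReg r v) :=
  ⟨by simp [h13.symm, h.reg13], by simpa using h.arr7⟩

theorem swapIn_spec (hb : Bounds n ω X R) (hO : HasOrd ord K s) {r : ℕ} {p : Fin n}
    (hr : s.reg r = (p : ℕ)) (hr12 : r ≠ 12) (hK : K < n) :
    Wp R (swapIn r) 60 s fun s' => HasOrd (ord * Equiv.swap ⟨K, hK⟩ p) (K + 1) s' := by
  have hR := hb.n_le_R
  obtain ⟨q, rfl⟩ : ∃ q : Fin n, (q : ℕ) = K := ⟨⟨K, hK⟩, rfl⟩
  refine Wp.assign_seq (by simpa [hO.reg13, hO.arr7] using hb.fin_le (ord q)) ?_ (by simp)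
  refine Wp.store_seq (by simpa [hr, hr12, hO.arr7] using hb.fin_le (ord p)) ?_ (by simp)
  refine Wp.store_seq (by simpa [hO.reg13, hO.arr7] using hb.fin_le (ord q)) ?_ (by simp)
  refine Wp.assign (by simp [hO.reg13]; omega) ⟨by simp [hO.reg13], fun i => ?_⟩ (by simp)
  simp only [eval_ar, eval_rg, eval_addr, State.setMem_arr, State.setReg_arr, State.setMem_reg,
    State.setReg_reg, hO.reg13, hr, hr12, if_true, if_false, hO.arr7, Nat.cast_inj, Fin.val_inj,
    true_and, Equiv.Perm.mul_apply, Fin.eta]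
  by_cases h1 : i = p
  · subst h1; simp
  · by_cases h2 : i = q
    · subst h2; simp [h1]
    · simp [h1, h2, Equiv.swap_apply_of_ne_of_ne, Fin.val_inj]

theorem partProg_spec (hb : Bounds n ω X R) (hW : HasWt n ω s) (hP : HasPot A Q s) :
    Wp R partProg (200 * (n + 1)) s fun s' => ∃ ord : Equiv.Perm (Fin n), HasOrd ord A.card s' ∧
      ∀ i, ord i ∈ A ↔ (i : ℕ) < A.card := by
  refine Wp.seq' (τ₁ := 21 * n + 10) (τ₂ := 100 * (n + 1))
    (I := fun s' => ∀ i : Fin n, s'.arr 7 (i : ℕ) = (i : ℕ))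
    (Wp.fill (N := n) (fun x => (x : ℕ)) hW.reg0 hb.n_le_R (by norm_num)
      (fun x s' _ h4 _ _ => h4) hb.fin_le (fun s' _ _ h => h) (by simp; omega)) ?_ (by omega)
  intro s₁ hf₁ h₁
  refine Wp.assign_seq (by simp) ?_ (by simp; omega)
  have hP₁ := hP.frame hf₁
  refine Wp.forUp (τ₁ := 80) (fun j s' => ∃ ord K, HasOrd ord K s' ∧ K ≤ j ∧
      ∀ i : Fin n, (i : ℕ) < j → (ord i ∈ A ↔ (i : ℕ) < K)) n ((hW.frame hf₁).setReg (r := 13)).reg0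
    hb.n_le_R (by norm_num) (by rfl) (by rfl) ?_ ?_ ?_ (by simp; omega)
  · exact ⟨1, 0, ⟨by simp, by simpa using h₁⟩, le_rfl, by simp⟩
  · rintro j hj s₂ hf₂ h11 h0 ⟨ord, K, hO, hKj, h⟩
    have hP₂ : HasPot A Q s₂ := (hP₁.setReg (r := 13) (v := 0)).frame hf₂
    obtain ⟨p, rfl⟩ : ∃ p : Fin n, (p : ℕ) = j := ⟨⟨j, hj⟩, rfl⟩
    have hc : (ar 6 (ar 7 (rg 11))).eval s₂ = if ord p ∈ A then 1 else 0 := by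
      simp [h11, hO.arr7, hP₂.arr6]
    have hKn : K < n := by omega
    refine Wp.ite (fun hne => ?_) (fun heq => ?_) (by simp)
    · have hpA : ord p ∈ A := by by_contra hcon; simp [hc, hcon] at hne
      refine (swapIn_spec hb hO h11 (by norm_num) hKn).mono (by simp) ?_
      intro s₃ _ hO' _ _
      refine ⟨_, _, hO'.setReg, by omega, fun i hi => ?_⟩
      by_cases h1 : i = ⟨K, hKn⟩
      · subst h1; simp [hpA]
      · have h1' : (i : ℕ) ≠ K := fun h => h1 (Fin.ext h)
        by_cases h2 : i = p
        · subst h2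
          have := h ⟨K, hKn⟩ (show K < (i : ℕ) by omega)
          simp only [Equiv.Perm.mul_apply, Equiv.swap_apply_right]
          rw [this]; dsimp only; omega
        · have h2' : (i : ℕ) ≠ p := fun h => h2 (Fin.ext h)
          rw [Equiv.Perm.mul_apply, Equiv.swap_apply_of_ne_of_ne h1 h2, h i (by omega)]
          omega
    · have hpA : ord p ∉ A := by intro hcon; simp [hc, hcon] at heq
      refine Wp.skip (fun _ _ => ⟨ord, K, hO.setReg, by omega, fun i hi => ?_⟩) (by simp)
      by_cases h2 : i = p
      · subst h2; simp [hpA]; omega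
      · have h2' : (i : ℕ) ≠ p := fun h => h2 (Fin.ext h)
        exact h i (by omega)
  · rintro s₂ - - ⟨ord, K, hO, hKn, h⟩
    -- The vertices in the first `K` positions are exactly those of `A`.
    have hcard : A.card = K := by
      have : A = (Finset.univ.filter fun i : Fin n => (i : ℕ) < K).map ord.toEmbedding := by
        ext v
        simp only [Finset.mem_map, Finset.mem_filter, Finset.mem_univ, true_and,
          Equiv.coe_toEmbedding]
        constructor
        · intro hv; exact ⟨ord.symm v, by rw [← h _ (ord.symm v).2]; simpa using hv, by simp⟩
        · rintro ⟨i, hi, rfl⟩; exact (h i i.2).2 hi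
      rw [this, Finset.card_map, Fin.card_filter_val_lt, min_eq_right hKn]
    rw [hcard]
    exact ⟨ord, hO, fun i => h i i.2⟩

theorem eval_rE (hW : HasWt n ω s) (hP : HasPot A Q s) {x y : Expr} {a b : Fin n}
    (hx : x.eval s = (a : ℕ)) (hy : y.eval s = (b : ℕ)) : (rE x y).eval s = redWeight ω Q a b := by
  simp [rE, hx, hy, hW.reg0, hW.arr0, hP.arr5, redWeight]

@[simp] theorem cost_rE (x y : Expr) : (rE x y).cost = 2 * x.cost + 2 * y.cost + 28 := by
  simp [rE]; omega

/-- The vertices in the first `K` positions. -/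
def firsts (ord : Equiv.Perm (Fin n)) (K : ℕ) : Finset (Fin n) :=
  Finset.univ.filter fun v => (ord.symm v : ℕ) < K

theorem mem_firsts {v : Fin n} : v ∈ firsts ord K ↔ (ord.symm v : ℕ) < K := by simp [firsts]

theorem firsts_swap (hK : K < n) {p : Fin n} (hp : K ≤ p) :
    firsts (ord * Equiv.swap ⟨K, hK⟩ p) (K + 1) = insert (ord p) (firsts ord K) := by
  ext v
  rw [Finset.mem_insert, mem_firsts, mem_firsts]
  obtain ⟨i, rfl⟩ := ord.surjective v
  have e : (ord * Equiv.swap ⟨K, hK⟩ p).symm (ord i) = Equiv.swap ⟨K, hK⟩ p i := by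
    rw [Equiv.symm_apply_eq]; simp
  rw [e, Equiv.symm_apply_apply, ord.injective.eq_iff]
  by_cases h2 : i = p
  · subst h2; simp
  · by_cases h1 : i = ⟨K, hK⟩
    · subst h1
      have : (p : ℕ) ≠ K := fun h => h2 (Fin.ext h.symm)
      simp [h2]; omega
    · rw [Equiv.swap_apply_of_ne_of_ne h1 h2]
      have : (i : ℕ) ≠ K := fun h => h1 (Fin.ext h)
      simp [h2]; omega

/-- The bound on the potentials. -/
def PotLe (Q : Fin n → ℤ) (X : ℕ) : Prop := ∀ x, (Q x).natAbs ≤ 10 * X ^ 3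

theorem Bounds.redWeight_le (hb : Bounds n ω X R) (hQ : PotLe Q X) (x y : Fin n) :
    (redWeight ω Q x y).natAbs ≤ 22 * X ^ 3 := by
  have h1 := hb.wt_le x y
  have h2 := hQ x
  have h3 := hQ y
  have h4 : X ≤ X ^ 3 := Nat.le_self_pow (by norm_num) X
  rw [redWeight]; omega

/-- The kernel contains, for each pair of exceptional vertices, enough of the vertices closest to
this pair. -/
def IsKernel (A S : Finset (Fin n)) (r : Fin n → Fin n → ℤ) : Prop :=
  A ⊆ S ∧ ∀ u ∉ S, ∀ a ∈ A, ∀ a' ∈ A,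
    3 * A.card ≤ ((S \ A).filter fun v => r a v + r a' v ≤ r a u + r a' u).card

/-- With `c = |A|` there are `c * c` ordered pairs of exceptional vertices, and the `3c³` iterations
give each pair `3c` turns. Every turn moves into the kernel a vertex, among those still outside,
that is closest to the pair. As the kernel only grows, later turns do not spoil what earlier ones
achieved. -/
theorem selProg_spec (hb : Bounds n ω X R) (hW : HasWt n ω s) (hP : HasPot A Q s)
    (hQ : PotLe Q X) {ord₀ : Equiv.Perm (Fin n)}
    (hO : HasOrd ord₀ A.card s) (hA : ∀ i, ord₀ i ∈ A ↔ (i : ℕ) < A.card) :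
    Wp R selProg (1000 * (n + 1) ^ 4) s fun s' => ∃ ord K, HasOrd ord K s' ∧ K ≤ n ∧
      K ≤ A.card + 3 * A.card ^ 3 ∧ IsKernel A (firsts ord K) (redWeight ω Q) := by
  set c := A.card with hc
  have hcn : c ≤ n := (Finset.card_le_univ A).trans (by simp)
  have hR := hb.n_le_R
  have hcX : c ≤ X := hcn.trans hb.n_le
  have hc3 : 3 * c * c * c ≤ 3 * X ^ 3 := by
    calc 3 * c * c * c = 3 * c ^ 3 := by ring
      _ ≤ _ := Nat.mul_le_mul_left _ (Nat.pow_le_pow_left hcX 3)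
  have hcR : 3 * c * c * c ≤ R := by have := hb.pow_le (j := 3); omega
  have hcn3 : 3 * c * c * c ≤ 3 * n ^ 3 := by
    calc 3 * c * c * c = 3 * c ^ 3 := by ring
      _ ≤ _ := Nat.mul_le_mul_left _ (Nat.pow_le_pow_left hcn 3)
  -- The code `q` stands for the exceptional vertices at positions `q / c` and `q % c`; the default
  -- `0` is not met for `q < c * c`.
  let V : ℕ → Fin n → ℤ := fun q v => if h : q / c < n ∧ q % c < n then
    redWeight ω Q (ord₀ ⟨q / c, h.1⟩) v + redWeight ω Q (ord₀ ⟨q % c, h.2⟩) v else 0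
  have h4 : (n + 1) ^ 4 = n ^ 4 + 4 * n ^ 3 + 6 * n ^ 2 + 4 * n + 1 := by ring
  refine Wp.assign_seq (by simp [hO.reg13]; omega) ?_ (by simp; omega)
  have e17 : (3 * rg 16 * rg 16 * rg 16).eval (s.setReg 16 ((rg 13).eval s)) = (3 * c * c * c : ℕ) := by
    simp [hO.reg13]
  refine Wp.assign_seq (by rw [e17, Int.natAbs_natCast]; exact hcR) ?_ (by simp; omega)
  rw [e17]
  have e16 : (rg 13).eval s = c := hO.reg13
  rw [e16]
  refine Wp.forUp (τ₁ := 250 * n + 400) (fun j s' => ∃ ord K, HasOrd ord K s' ∧ K ≤ n ∧ c ≤ K ∧ K ≤ c + j ∧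
      (∀ i : Fin n, (i : ℕ) < c → ord i = ord₀ i) ∧ ∀ q, ∀ u ∉ firsts ord K,
        -- With truncated subtraction this is the number of turns that the pair `q` has had: `3c`
        -- when it is done, `0` when its turns are still to come.
        min (3 * c) (j - 3 * c * q) ≤ ((firsts ord K \ A).filter fun v => V q v ≤ V q u).card)
    (3 * c * c * c) (by simp) hcR (by norm_num) (by rfl) (by rfl) ?_ ?_ ?_ ?_
  · exact ⟨ord₀, c, hO.setReg.setReg.setReg, hcn, le_rfl, le_rfl, fun _ _ => rfl, by simp⟩
  · rintro j hj s₁ hf h11 h17 ⟨ord, K, hO₁, hKn, hcK, hKj, hfix, hcount⟩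
    have hW₁ : HasWt n ω s₁ := (hW.setReg (r := 16) (v := c)).setReg (r := 17)
      (v := (3 * c * c * c : ℕ)) |>.frame hf
    have hP₁ : HasPot A Q s₁ := (hP.setReg (r := 16) (v := c)).setReg (r := 17)
      (v := (3 * c * c * c : ℕ)) |>.frame hf
    have h16 : s₁.reg 16 = c := by rw [hf.reg _ (by rfl)]; simp
    have hcpos : 0 < c := by
      rcases Nat.eq_zero_or_pos c with h | h
      · rw [h] at hj; simp at hj
      · exact h
    set q := j / (3 * c) with hq
    have hqc : q / c < c := by
      rw [Nat.div_lt_iff_lt_mul hcpos, Nat.div_lt_iff_lt_mul (by omega)]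
      calc j < 3 * c * c * c := hj
        _ = _ := by ring
    have hqm : q % c < c := Nat.mod_lt _ hcpos
    have hqn : q / c < n ∧ q % c < n := ⟨by omega, by omega⟩
    have ea1 : (rg 11 / (3 * rg 16 * rg 16)).eval s₁ = (q / c : ℕ) := by
      simp only [eval_div, eval_rg, eval_mul, eval_ofNat, h11, h16]
      rw [hq, Nat.div_div_eq_div_mul]; push_cast; rfl
    have ea2 : (rg 11 / (3 * rg 16) - rg 16 * (rg 11 / (3 * rg 16 * rg 16))).eval s₁ = (q % c : ℕ) := by
      rw [eval_sub, eval_mul, ea1]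
      simp only [eval_div, eval_rg, eval_mul, eval_ofNat, h11, h16]
      have := Nat.div_add_mod q c
      have e : ((j : ℤ) / (3 * c)) = (q : ℕ) := by rw [hq]; push_cast; rfl
      have h : (c : ℤ) * ((q / c : ℕ) : ℤ) + ((q % c : ℕ) : ℤ) = q := by exact_mod_cast this
      rw [e]; linarith
    set a₁ := ord₀ ⟨q / c, hqn.1⟩ with ha₁
    set a₂ := ord₀ ⟨q % c, hqn.2⟩ with ha₂
    have hV : ∀ v, V q v = redWeight ω Q a₁ v + redWeight ω Q a₂ v := fun v => dif_pos hqn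
    have e1 : (ar 7 (rg 11 / (3 * rg 16 * rg 16))).eval s₁ = (a₁ : ℕ) := by
      rw [eval_ar, ea1, ha₁, ← hfix ⟨q / c, hqn.1⟩ hqc, ← hO₁.arr7]
    refine Wp.assign_seq (by rw [e1]; exact hb.fin_le _) ?_ (by simp)
    rw [e1]
    have e2 : (ar 7 (rg 11 / (3 * rg 16) - rg 16 * (rg 11 / (3 * rg 16 * rg 16)))).eval
        (s₁.setReg 25 (a₁ : ℕ)) = (a₂ : ℕ) := by
      have : ∀ e : Expr, e = (rg 11 / (3 * rg 16) - rg 16 * (rg 11 / (3 * rg 16 * rg 16))) →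
        e.eval (s₁.setReg 25 (a₁ : ℕ)) = e.eval s₁ := by rintro e rfl; rfl
      rw [eval_ar, this _ rfl, ea2, State.setReg_arr, ha₂, ← hfix ⟨q % c, hqn.2⟩ hqm, ← hO₁.arr7]
    refine Wp.assign_seq (by rw [e2]; exact hb.fin_le _) ?_ (by simp)
    rw [e2]
    refine Wp.seq (τ₁ := 250 * n + 20) (τ₂ := 100) (Wp.argmin (N := n) (fun p => K ≤ (p : ℕ))
      (fun p => V q (ord p)) (by simpa using hW₁.reg0) hR hb.one_le_R
      (by norm_num) (by norm_num) (by norm_num) (by norm_num) (by norm_num) (by norm_num) ?_ ?_ ?_ ?_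
      (by simp; omega)) (by simp)
    · intro p v v'
      simp only [eval_sub, eval_one, eval_lt, eval_rg, State.setReg_reg]
      simp [hO₁.reg13]
      split_ifs <;> simp <;> omega
    · intro p v v' _
      rw [eval_add, hV, eval_rE (hW₁.setReg.setReg.setReg.setReg.setReg) hP₁.setReg.setReg.setReg.setReg.setReg
        (a := a₁) (b := ord p) (by simp) (by simp [hO₁.arr7]),
        eval_rE (hW₁.setReg.setReg.setReg.setReg.setReg) hP₁.setReg.setReg.setReg.setReg.setReg
        (a := a₂) (b := ord p) (by simp) (by simp [hO₁.arr7])]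
    · intro p _
      refine hb.natAbs_le (m := 44) (j := 3) ?_
      rw [hV]
      have := hb.redWeight_le hQ a₁ (ord p)
      have := hb.redWeight_le hQ a₂ (ord p)
      omega
    · intro v v' hv
      have hO₂ : HasOrd ord K ((((((s₁.setReg 25 (a₁ : ℕ)).setReg 26 (a₂ : ℕ)).setReg 9 v).setReg 10 v').setReg 5 n)) :=
        hO₁.setReg.setReg.setReg.setReg.setReg
      refine Wp.ite (fun hne => ?_) (fun heq => ?_) (by simp)
      -- If the search finds nothing, no vertex is outside the kernel and the claim about `u` is
      -- vacuous.
      · rcases hv with ⟨rfl, hnone⟩ | ⟨p, rfl, -⟩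
        swap
        · simp at hne
        refine Wp.skip (fun _ _ => ⟨ord, K, hO₂.setReg, hKn, hcK, by omega, hfix, fun q' u hu => ?_⟩) (by simp)
        rw [mem_firsts] at hu
        exact absurd (by omega) (hnone (ord.symm u))
      · rcases hv with ⟨rfl, hnone⟩ | ⟨p, rfl, hpK, -, hmin⟩
        · simp at heq
        have hKn' : K < n := by have := p.2; omega
        refine (swapIn_spec hb hO₂ (p := p) (by simp) (by norm_num) hKn').mono (by simp) ?_
        intro s₃ _ hO₃ _ _
        refine ⟨_, _, hO₃.setReg, by omega, by omega, by omega, fun i hi => ?_, fun q' u hu => ?_⟩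
        · rw [Equiv.Perm.mul_apply, Equiv.swap_apply_of_ne_of_ne, hfix i hi]
          · intro h; rw [h] at hi; dsimp only at hi; omega
          · intro h; rw [h] at hi; omega
        · rw [firsts_swap hKn' hpK] at hu ⊢
          rw [Finset.mem_insert, not_or] at hu
          have h1 := hcount q' u hu.2
          have hpA : ord p ∉ A := by
            intro h
            have h2 := hfix ⟨(ord₀.symm (ord p) : Fin n), (ord₀.symm (ord p)).2⟩
              ((hA _).1 (by simpa using h))
            simp only [Fin.eta, Equiv.apply_symm_apply, EmbeddingLike.apply_eq_iff_eq] at h2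
            have h3 := (hA (ord₀.symm (ord p))).1 (by simpa using h)
            rw [h2] at h3; omega
          have hpF : ord p ∉ firsts ord K := by rw [mem_firsts, Equiv.symm_apply_apply]; omega
          have hsub : ((firsts ord K \ A).filter fun v => V q' v ≤ V q' u) ⊆
              ((insert (ord p) (firsts ord K) \ A).filter fun v => V q' v ≤ V q' u) := by
            refine Finset.filter_subset_filter _ (Finset.sdiff_subset_sdiff (Finset.subset_insert _ _) le_rfl)
          -- Pairs before `q` have their full share, the pair `q` gains the vertex just moved, and
          -- pairs after `q` are promised nothing yet.
          rcases lt_trichotomy q' q with hlt | heq | hgt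
          · have h2 : 3 * c * (q' + 1) ≤ j := by
              calc 3 * c * (q' + 1) ≤ 3 * c * q := Nat.mul_le_mul_left _ hlt
                _ ≤ j := Nat.mul_div_le _ _
            rw [Nat.mul_succ] at h2
            have := Finset.card_le_card hsub
            rw [min_eq_left (by omega)] at h1 ⊢
            omega
          · rw [heq] at h1 hsub ⊢
            have hle : V q (ord p) ≤ V q u := by
              have := hmin (ord.symm u) (by have := mt mem_firsts.2 hu.2; omega)
              simpa using this
            have hss : insert (ord p) ((firsts ord K \ A).filter fun v => V q v ≤ V q u) ⊆
              ((insert (ord p) (firsts ord K) \ A).filter fun v => V q v ≤ V q u) := by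
              refine Finset.insert_subset ?_ hsub
              simp [hpA, hle]
            have h2 := Finset.card_le_card hss
            rw [Finset.card_insert_of_notMem (by simp [hpF])] at h2
            omega
          · have h2 : j < 3 * c * q' := by
              calc j < 3 * c * (q + 1) := Nat.lt_mul_div_succ j (by omega)
                _ ≤ _ := Nat.mul_le_mul_left _ hgt
            rw [Nat.sub_eq_zero_of_le h2]; simp
  · rintro s₁ - - ⟨ord, K, hO₁, hKn, hcK, hKj, hfix, hcount⟩
    refine ⟨ord, K, hO₁, hKn, hKj.trans (le_of_eq (by ring)), fun v hv => ?_, fun u hu a ha a' ha' => ?_⟩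
    · have h1 := (hA (ord₀.symm v)).1 (by simpa using hv)
      have h2 := hfix _ h1
      rw [Equiv.apply_symm_apply, ← Equiv.eq_symm_apply] at h2
      rw [mem_firsts, ← h2]; omega
    · have h1 := (hA (ord₀.symm a)).1 (by simpa using ha)
      have h2 := (hA (ord₀.symm a')).1 (by simpa using ha')
      set i := ord₀.symm a with hi
      set i' := ord₀.symm a' with hi'
      have e1 : ((i' : ℕ) + c * i) / c = i := by
        rw [Nat.add_mul_div_left _ _ (by omega), Nat.div_eq_of_lt h2, zero_add]
      have e2 : ((i' : ℕ) + c * i) % c = i' := by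
        rw [Nat.add_mul_mod_self_left, Nat.mod_eq_of_lt h2]
      have hV : ∀ v, V ((i' : ℕ) + c * i) v = redWeight ω Q a v + redWeight ω Q a' v := by
        intro v
        simp only [V]
        rw [dif_pos ⟨by rw [e1]; exact i.2, by rw [e2]; exact i'.2⟩]
        simp only [e1, e2, Fin.eta]
        rw [hi, hi', Equiv.apply_symm_apply, Equiv.apply_symm_apply]
      have h3 := hcount ((i' : ℕ) + c * i) u hu
      simp only [hV] at h3
      refine le_trans (le_of_eq ?_) h3
      symm
      apply min_eq_left
      have h4 : (i' : ℕ) + c * i + 1 ≤ c * c := by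
        have := Nat.mul_le_mul_left c (Nat.succ_le_of_lt h1)
        rw [Nat.mul_succ] at this; omega
      have h5 := Nat.mul_le_mul_left (3 * c) h4
      rw [Nat.mul_succ, ← mul_assoc] at h5
      omega
  · simp only [cost_mul, cost_rg, cost_ofNat]
    have h5 : 3 * c * c * c * (250 * n + 400 + 10) ≤ 3 * n ^ 3 * (250 * n + 410) :=
      Nat.mul_le_mul_right _ hcn3
    have h6 : 3 * n ^ 3 * (250 * n + 410) = 750 * n ^ 4 + 1230 * n ^ 3 := by ring
    have h7 : 1000 * (n + 1) ^ 4 = 1000 * n ^ 4 + 4000 * n ^ 3 + 6000 * n ^ 2 + 4000 * n + 1000 := by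
      ring
    rw [h7]
    refine le_trans (Nat.add_le_add_right (h5.trans h6.le) 10) ?_
    omega

end Specs

/-! ### The program: exhaustive search -/

/-- The position after `p` in a closed tour. -/
def nextE (p : Expr) : Expr := (p + 1) * (1 - (p + 1).eq (rg 0))

/-- The cost of a pair, which is zero outside the exceptional set. -/
def restE (x y : Expr) : Expr := (1 - (1 - ar 6 x) * (1 - ar 6 y)) * rE x y

/-- Increments the number whose digits are in array `8`; register `23` holds the carry. -/
def incProg : Program :=
  .seq (.assign 23 1) (IntRAM.forUp 4 13 (.ite (rg 23)
    (.ite ((ar 8 (rg 4) + 1).lt (rg 13))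
      (.seq (.store (.addr 8 (rg 4)) (ar 8 (rg 4) + 1)) (.assign 23 0))
      (.store (.addr 8 (rg 4)) 0)) .skip))

/-- Computes the number of collisions of a tour. -/
def collProg : Program :=
  sumTo 21 5 6 ((ar 9 (fstE (rg 5))).eq (ar 9 (sndE (rg 5))) *
    (1 - (fstE (rg 5)).eq (sndE (rg 5))))

/-- Computes the cost of a tour. -/
def costProg : Program := sumTo 22 5 0 (restE (ar 9 (rg 5)) (ar 9 (nextE (rg 5))))

/-- Decodes and tests one arrangement of the kernel. -/
def tryProg : Program :=
  .seq (fill 9 4 0 (ar 7 ((rg 4).lt (rg 13) * ar 8 (rg 4) + (1 - (rg 4).lt (rg 13)) * rg 4)))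
    (.seq collProg (.seq costProg
    (.ite ((rg 21).eq 0 * (1 - (2 * rg 14).lt ((rg 0 - 1) * (rg 22 + 2 * rg 18 + 2 * rg 1))))
      (.assign 20 1) (.seq incProg (.assign 19 (rg 23))))))

/-- Tests all arrangements of the kernel. -/
def bruteProg : Program :=
  .seq (fill 8 4 13 0) (.seq (.assign 19 0) (.seq (.assign 20 0)
    (.loop (1 - rg 19 - rg 20) tryProg)))

/-! ### Correctness of the exhaustive search -/

section Specs
variable {n : ℕ} {ω : Fin n → Fin n → ℤ} {A : Finset (Fin n)}
  {Q : Fin n → ℤ} {ord : Equiv.Perm (Fin n)} {K : ℕ} {s s' : State} {R X : ℕ}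

/-- The state holds the tour `t`. -/
def HasTour (t : Fin n → Fin n) (s : State) : Prop := ∀ i : Fin n, s.arr 9 (i : ℕ) = (t i : ℕ)

theorem HasTour.frame {t : Fin n → Fin n} {p : Program} (h : HasTour t s) (hf : Frame p s s')
    (ha9 : p.writesArr 9 = false := by rfl) : HasTour t s' :=
  fun x => by rw [hf.arr _ ha9, h]

theorem HasTour.setReg {t : Fin n → Fin n} (h : HasTour t s) {r : ℕ} {v : ℤ} :
    HasTour t (s.setReg r v) := by simpa [HasTour] using h

theorem collProg_spec (hb : Bounds n ω X R) (hW : HasWt n ω s) {t : Fin n → Fin n}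
    (ht : HasTour t s) :
    Wp R collProg (60 * (n * n) + 20) s fun s' => 
      (s'.reg 21 = 0 ↔ Function.Injective t) := by
  have h0 := hW.reg0
  refine Wp.sumTo (N := n * n) (fun p => (if t p.divNat = t p.modNat then 1 else 0) *
    (1 - if p.divNat = p.modNat then 1 else 0)) 1 hW.reg6 hb.nn_le_R (by norm_num) (by norm_num)
    (by norm_num) ?_ ?_ (by simpa using hb.nn_le_R) ?_ (by simp [fstE, sndE]; omega)
  · intro p v
    have e0 : ((s.setReg 21 v).setReg 5 (p : ℕ)).reg 0 = n := h0
    have e5 : ((s.setReg 21 v).setReg 5 (p : ℕ)).reg 5 = (p : ℕ) := rfl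
    have h1 : (fstE (rg 5)).eval ((s.setReg 21 v).setReg 5 (p : ℕ)) = (p.divNat : ℕ) := by
      simp only [fstE, eval_div, eval_rg, e0, e5, divNat_div]
    have h2 : (sndE (rg 5)).eval ((s.setReg 21 v).setReg 5 (p : ℕ)) = (p.modNat : ℕ) := by
      simp only [sndE, eval_div, eval_rg, eval_sub, eval_mul, e0, e5, divNat_div, modNat_sub]
    simp only [eval_mul, eval_sub, eval_eq, eval_one, eval_ar, h1, h2, State.setReg_arr, ht _,
      Nat.cast_inj, Fin.val_inj]
  · intro p; split_ifs <;> simp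
  · simp only [State.setReg_reg]
    rw [if_neg (by norm_num), if_pos trivial, Finset.sum_eq_zero_iff_of_nonneg
      (fun p _ => by split_ifs <;> simp)]
    constructor
    · intro h x z hxz
      obtain ⟨p, rfl, rfl⟩ := exists_divNat_modNat x z
      by_contra hne
      have := h p (Finset.mem_univ p)
      simp only [hxz, hne, if_true, if_false] at this
      norm_num at this
    · intro h p _
      by_cases h1 : p.divNat = p.modNat
      · simp [h1]
      · rw [if_neg (fun h' => h1 (h h'))]; simp

/-- The carry into digit `j` is `1` exactly if `K ^ j` divides `N + 1`. After the last digit, for `N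
< K ^ K`, a carry means that all codes have been used. -/
theorem incProg_spec (hb : Bounds n ω X R) (hKn : K ≤ n) {N : ℕ} (h13 : s.reg 13 = K)
    (hd : ∀ i < K, s.arr 8 (i : ℕ) = (N / K ^ i % K : ℕ)) :
    Wp R incProg (100 * (n + 1)) s fun s' => s'.reg 23 = (if K ^ K ∣ N + 1 then 1 else 0) ∧
      ∀ i < K, s'.arr 8 (i : ℕ) = ((N + 1) / K ^ i % K : ℕ) := by
  have hR := hb.n_le_R
  refine Wp.assign_seq (by simpa using hb.one_le_R) ?_ (by simp; omega)
  refine Wp.forUp (τ₁ := 60) (fun j s' => s'.reg 23 = (if K ^ j ∣ N + 1 then 1 else 0) ∧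
    ∀ i < K, s'.arr 8 (i : ℕ) = if i < j then ((N + 1) / K ^ i % K : ℕ) else (N / K ^ i % K : ℕ)) K
    (by simpa using h13) (by omega) (by norm_num) (by rfl) (by rfl) ⟨by simp, by simpa using hd⟩ ?_ ?_
    (by simp; omega)
  · rintro j hj s₁ hf h4 h13 ⟨h23, hI⟩
    have hKpos : 0 < K := by omega
    have hmod := Nat.mod_lt (N / K ^ j) hKpos
    have hdiv : (N + 1) / K ^ j = N / K ^ j + if K ^ j ∣ N + 1 then 1 else 0 := Nat.succ_div
    have h8 := hI j hj
    rw [if_neg (lt_irrefl _)] at h8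
    have hup : ∀ v : ℕ, v = (N + 1) / K ^ j % K → ∀ i < K, (if i = j then (v : ℤ) else s₁.arr 8 (i : ℕ)) =
        ((if i < j + 1 then (N + 1) / K ^ i % K else N / K ^ i % K : ℕ) : ℤ) := by
      intro v hv i hi
      by_cases h : i = j
      · subst h; simp [hv]
      · rw [if_neg h, hI i hi]
        have : i < j ↔ i < j + 1 := by omega
        simp only [this]
    have hdvd : K ^ (j + 1) ∣ N + 1 ↔ K ^ j ∣ N + 1 ∧ K ∣ (N + 1) / K ^ j := by
      constructor
      · intro h
        have h1 : K ^ j ∣ N + 1 := (pow_dvd_pow K (by omega)).trans h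
        exact ⟨h1, (Nat.dvd_div_iff_mul_dvd h1).2 (by rwa [← pow_succ])⟩
      · rintro ⟨h1, h2⟩
        rw [pow_succ]; exact (Nat.dvd_div_iff_mul_dvd h1).1 h2
    refine Wp.ite (fun h => ?_) (fun h => ?_) (by simp)
    · have hj1 : K ^ j ∣ N + 1 := by
        by_contra hcon; simp [h23, hcon] at h
      rw [if_pos hj1] at hdiv
      have hmod' : (N + 1) / K ^ j % K = (N / K ^ j % K + 1) % K := by rw [hdiv, Nat.mod_add_mod]
      refine Wp.ite (fun h' => ?_) (fun h' => ?_) (by simp)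
      · have hlt : N / K ^ j % K + 1 < K := by
          by_contra hcon
          simp only [eval_lt, eval_add, eval_ar, eval_rg, eval_one, h4, h8, h13] at h'
          rw [if_neg (by exact_mod_cast hcon)] at h'; exact h' rfl
        rw [Nat.mod_eq_of_lt hlt] at hmod'
        refine Wp.store_seq ?_ (Wp.assign (by simp) (fun _ _ => ⟨?_, fun i hi => ?_⟩) (by simp)) (by simp)
        · simp only [eval_add, eval_ar, eval_rg, eval_one, h4, h8]; omega
        · have : ¬ K ∣ (N + 1) / K ^ j := by
            rw [Nat.dvd_iff_mod_eq_zero, hmod']; omega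
          simp [hdvd, this]
        · rw [← hup (N / K ^ j % K + 1) hmod'.symm i hi]
          simp only [eval_addr, eval_rg, eval_ar, eval_one, eval_add, h4, h8, State.setReg_arr,
            State.setMem_arr, true_and, Nat.cast_inj]
          push_cast; rfl
      · have hlt : N / K ^ j % K + 1 = K := by
          by_contra hcon
          simp only [eval_lt, eval_add, eval_ar, eval_rg, eval_one, h4, h8, h13] at h'
          rw [if_pos (by exact_mod_cast (by omega : N / K ^ j % K + 1 < K))] at h'
          exact one_ne_zero h'
        rw [hlt, Nat.mod_self] at hmod'
        refine Wp.store (by simp) (fun _ _ => ⟨?_, fun i hi => ?_⟩) (by simp)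
        · have : K ∣ (N + 1) / K ^ j := by rw [Nat.dvd_iff_mod_eq_zero, hmod']
          simp [hdvd, this, h23]
        · rw [← hup 0 hmod'.symm i hi]
          simp only [eval_addr, eval_rg, h4, State.setReg_arr,
            State.setMem_arr, true_and, Nat.cast_inj, eval_zero]
          rfl
    · have hj1 : ¬ K ^ j ∣ N + 1 := by
        intro hcon; simp [h23, hcon] at h
      rw [if_neg hj1, add_zero] at hdiv
      refine Wp.skip (fun _ _ => ⟨?_, fun i hi => ?_⟩) (by simp)
      · simp [hdvd, hj1, h23]
      · rw [← hup (N / K ^ j % K) (by rw [hdiv]) i hi]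
        simp only [State.setReg_arr]
        split_ifs with h
        · rw [h, h8]
        · rfl
  · rintro s₁ - - ⟨h23, hI⟩
    exact ⟨h23, fun i hi => by rw [hI i hi, if_pos hi]⟩

section Cost
variable [NeZero n]

theorem next_eq (i : Fin n) :
    ((i : ℕ) + 1 : ℤ) * (1 - if ((i : ℕ) + 1 : ℤ) = n then 1 else 0) = ((i + 1 : Fin n) : ℕ) := by
  have hi := i.2
  by_cases h : (i : ℕ) + 1 < n
  · rw [val_succ_of_lt h, if_neg (by omega)]; simp
  · rw [val_succ_of_eq (by omega), if_pos (by omega)]; simp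

theorem eval_nextE {p : Expr} {i : Fin n} (h0 : s.reg 0 = n) (hp : p.eval s = (i : ℕ)) :
    (nextE p).eval s = ((i + 1 : Fin n) : ℕ) := by
  rw [← next_eq]; simp [nextE, hp, h0]

theorem Bounds.restrictCost_le (hb : Bounds n ω X R) (hQ : PotLe Q X) (x y : Fin n) :
    (restrictCost A (redWeight ω Q) x y).natAbs ≤ 22 * X ^ 3 := by
  unfold restrictCost
  split_ifs
  · exact hb.redWeight_le hQ _ _
  · simp

theorem costProg_spec (hb : Bounds n ω X R) (hW : HasWt n ω s) (hP : HasPot A Q s)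
    (hQ : PotLe Q X) {t : Fin n → Fin n} (ht : HasTour t s) :
    Wp R costProg (300 * n + 20) s fun s' =>
      s'.reg 22 = tourCost (restrictCost A (redWeight ω Q)) t := by
  refine Wp.sumTo (N := n) (fun i => restrictCost A (redWeight ω Q) (t i) (t (i + 1))) (22 * X ^ 3)
    hW.reg0 hb.n_le_R (by norm_num) (by norm_num) (by norm_num) ?_ (fun i => hb.restrictCost_le hQ _ _) ?_
    (by simp [tourCost]) (by simp [restE, nextE]; omega)
  · intro i v
    have hW' : HasWt n ω ((s.setReg 22 v).setReg 5 (i : ℕ)) := hW.setReg.setReg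
    have hP' : HasPot A Q ((s.setReg 22 v).setReg 5 (i : ℕ)) := hP.setReg.setReg
    have h1 : (ar 9 (rg 5)).eval ((s.setReg 22 v).setReg 5 (i : ℕ)) = (t i : ℕ) := by
      simp [ht i]
    have h2 : (ar 9 (nextE (rg 5))).eval ((s.setReg 22 v).setReg 5 (i : ℕ)) = (t (i + 1) : ℕ) := by
      rw [eval_ar, eval_nextE hW'.reg0 (i := i) (by simp)]; simp [ht (i + 1)]
    rw [restE, eval_mul, eval_rE hW' hP' h1 h2]
    simp only [eval_sub, eval_mul, eval_one, eval_ar]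
    rw [eval_ar] at h1 h2
    rw [h1, h2, hP'.arr6, hP'.arr6, restrictCost]
    by_cases h3 : t i ∈ A <;> by_cases h4 : t (i + 1) ∈ A <;> simp [h3, h4]
  · have := hb.pow_le (j := 4); have := Nat.mul_le_mul_right (X ^ 3) hb.n_le
    have e : n * (22 * X ^ 3) = 22 * (n * X ^ 3) := by ring
    rw [pow_succ' X 3] at *; omega

/-- The state holds the data for the search. -/
structure Ready (ω : Fin n → Fin n → ℤ) (A : Finset (Fin n)) (Q : Fin n → ℤ)
    (ord : Equiv.Perm (Fin n)) (K k : ℕ) (s : State) : Prop where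
  wt : HasWt n ω s
  pot : HasPot A Q s
  ord : HasOrd ord K s
  reg1 : s.reg 1 = k
  reg14 : s.reg 14 = ∑ x, ∑ y, ω x y
  reg18 : s.reg 18 = ∑ x, Q x

variable {k : ℕ}

theorem Ready.frame {p : Program} (h : Ready ω A Q ord K k s) (hf : Frame p s s')
    (h0 : p.writesReg 0 = false := by rfl) (h1 : p.writesReg 1 = false := by rfl)
    (h6 : p.writesReg 6 = false := by rfl) (h13 : p.writesReg 13 = false := by rfl)
    (h14 : p.writesReg 14 = false := by rfl) (h18 : p.writesReg 18 = false := by rfl)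
    (a0 : p.writesArr 0 = false := by rfl) (a5 : p.writesArr 5 = false := by rfl)
    (a6 : p.writesArr 6 = false := by rfl) (a7 : p.writesArr 7 = false := by rfl) :
    Ready ω A Q ord K k s' :=
  ⟨h.wt.frame hf h0 h6 a0, h.pot.frame hf a5 a6, h.ord.frame hf h13 a7,
    by rw [hf.reg _ h1, h.reg1], by rw [hf.reg _ h14, h.reg14], by rw [hf.reg _ h18, h.reg18]⟩

/-- The acceptance condition of the search. -/
def Accepts (ω : Fin n → Fin n → ℤ) (A : Finset (Fin n)) (Q : Fin n → ℤ) (k : ℕ)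
    (t : Fin n → Fin n) : Prop :=
  ((n : ℤ) - 1) * (tourCost (restrictCost A (redWeight ω Q)) t + 2 * ∑ x, Q x + 2 * k) ≤
    2 * ∑ x, ∑ y, ω x y

/-- The tour with the code `N`. -/
def tourOf (ord : Equiv.Perm (Fin n)) (K N : ℕ) (i : Fin n) : Fin n :=
  if h : (i : ℕ) < K ∧ N / K ^ (i : ℕ) % K < n then ord ⟨_, h.2⟩ else ord i

/-- A tour that agrees with `ord` from position `K` on permutes the first `K` vertices of `ord`;
their indices are digits in base `K`. -/
theorem exists_tourOf_eq (hKn : K ≤ n) {t : Equiv.Perm (Fin n)} (ht : ∀ i : Fin n, K ≤ i → t i = ord i) :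
    ∃ N < K ^ K, tourOf ord K N = t := by
  have hd : ∀ i : Fin K, (ord.symm (t (Fin.castLE hKn i)) : ℕ) < K := by
    intro i
    -- Otherwise this vertex would also be visited at its own position in `ord`, contradicting
    -- injectivity.
    by_contra hcon
    have h1 := ht (ord.symm (t (Fin.castLE hKn i))) (by omega)
    rw [Equiv.apply_symm_apply, EmbeddingLike.apply_eq_iff_eq] at h1
    rw [h1] at hcon
    exact hcon i.2
  let N := finFunctionFinEquiv fun i : Fin K => (⟨_, hd i⟩ : Fin K)
  refine ⟨N, N.2, funext fun i => ?_⟩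
  rw [tourOf]
  by_cases hi : (i : ℕ) < K
  · have h1 : (N : ℕ) / K ^ (i : ℕ) % K = ord.symm (t i) := by
      have h2 := congrFun (finFunctionFinEquiv.symm_apply_apply
        fun i : Fin K => (⟨_, hd i⟩ : Fin K)) ⟨i, hi⟩
      exact congrArg Fin.val h2
    rw [dif_pos ⟨hi, by rw [h1]; exact Fin.is_lt _⟩]
    simp only [h1, Fin.eta, Equiv.apply_symm_apply]
  · rw [dif_neg (fun h => hi h.1), ht i (by omega)]

theorem tryProg_spec (hb : Bounds n ω X R) (hQ : PotLe Q X) (h : Ready ω A Q ord K k s) (hKn : K ≤ n)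
    {N : ℕ} (hd : ∀ i < K, s.arr 8 (i : ℕ) = (N / K ^ i % K : ℕ)) :
    Wp R tryProg (700 * (n + 1) ^ 2) s fun s' =>
      (Function.Injective (tourOf ord K N) ∧ Accepts ω A Q k (tourOf ord K N) ∧
        s'.reg 20 = 1 ∧ s'.reg 19 = s.reg 19 ∧ HasTour (tourOf ord K N) s') ∨
      (¬ (Function.Injective (tourOf ord K N) ∧ Accepts ω A Q k (tourOf ord K N)) ∧
        s'.reg 20 = s.reg 20 ∧ s'.reg 19 = (if K ^ K ∣ N + 1 then 1 else 0) ∧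
        (∀ i < K, s'.arr 8 (i : ℕ) = ((N + 1) / K ^ i % K : ℕ))) := by
  have h0 := h.wt.reg0
  refine Wp.seq' (τ₁ := 60 * n + 10) (τ₂ := 60 * (n * n) + 500 * n + 300) (I := HasTour (tourOf ord K N))
    (Wp.fill (N := n) (fun i => (tourOf ord K N i : ℕ)) h0 hb.n_le_R (by norm_num) ?_
    (fun i => hb.fin_le _) (fun s' _ _ h => h) (by simp; omega)) ?_ (by nlinarith)
  · intro i s₁ hr h4 ha _
    simp only [eval_add, eval_sub, eval_mul, eval_one, eval_lt, eval_ar, eval_rg, h4,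
      hr 13 (by norm_num), h.ord.reg13, ha 7 (by decide), ha 8 (by decide), Nat.cast_lt, tourOf]
    by_cases hi : (i : ℕ) < K
    · have hlt : N / K ^ (i : ℕ) % K < n := (Nat.mod_lt _ (by omega)).trans_le hKn
      rw [if_pos hi, dif_pos ⟨hi, hlt⟩, hd i hi]
      simpa using h.ord.arr7 ⟨_, hlt⟩
    · rw [if_neg hi, dif_neg (fun h => hi h.1)]
      simpa using h.ord.arr7 i
  · intro s₁ hf₁ ht₁
    have h₁ := h.frame hf₁
    refine (collProg_spec hb h₁.wt ht₁).seq' (τ₂ := 500 * n + 270) ?_ (by omega)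
    intro s₂ hf₂ h21
    have h₂ := h₁.frame hf₂
    have ht₂ := ht₁.frame hf₂
    refine (costProg_spec hb h₂.wt h₂.pot hQ ht₂).seq' (τ₂ := 200 * n + 250) ?_ (by omega)
    intro s₃ hf₃ h22
    have h₃ := h₂.frame hf₃
    have ht₃ := ht₂.frame hf₃
    have e21 : s₃.reg 21 = s₂.reg 21 := hf₃.reg _ (by rfl)
    have e20 : s₃.reg 20 = s.reg 20 := by
      rw [hf₃.reg _ (by rfl), hf₂.reg _ (by rfl), hf₁.reg _ (by rfl)]
    have e19 : s₃.reg 19 = s.reg 19 := by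
      rw [hf₃.reg _ (by rfl), hf₂.reg _ (by rfl), hf₁.reg _ (by rfl)]
    have hd₃ : ∀ i < K, s₃.arr 8 (i : ℕ) = (N / K ^ i % K : ℕ) := fun i hi => by
      rw [hf₃.arr _ (by rfl), hf₂.arr _ (by rfl), hf₁.arr _ (by rfl), hd i hi]
    have hc : ((rg 21).eq 0 * (1 - (2 * rg 14).lt ((rg 0 - 1) * (rg 22 + 2 * rg 18 + 2 * rg 1)))).eval s₃
        ≠ 0 ↔ Function.Injective (tourOf ord K N) ∧ Accepts ω A Q k (tourOf ord K N) := by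
      rw [← h21, ← e21, Accepts, ← not_lt]
      simp only [eval_mul, eval_eq, eval_sub, eval_lt, eval_add, eval_rg, eval_one, eval_zero,
        eval_ofNat, h₃.reg14, h₃.reg18, h₃.reg1, h22, h₃.wt.reg0]
      by_cases h5 : s₃.reg 21 = 0
      · simp only [h5, if_true, one_mul, true_and]
        split_ifs with h6 <;> simp [h6]
      · simp [h5]
    refine Wp.ite (fun hne => ?_) (fun heq => ?_) (by simp)
    · obtain ⟨h5, h6⟩ := hc.1 hne
      refine Wp.assign (by simpa using hb.one_le_R) (Or.inl ⟨h5, h6, by simp, by simp [e19], ht₃.setReg⟩)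
        (by simp)
    · have h5 := fun h => hc.2 h heq
      refine (incProg_spec hb hKn h₃.ord.reg13 hd₃).seq' (τ₂ := 2) ?_ (by simp; omega)
      rintro s₄ hf₄ ⟨h23, hd₄⟩
      refine Wp.assign ?_ (Or.inr ⟨h5, ?_, by simp [h23], by simpa using hd₄⟩) (by simp)
      · rw [eval_rg, h23]
        split_ifs <;> simp [hb.one_le_R]
      · simp [hf₄.reg 20 (by rfl), e20]

/-- The measure is the number of codes still to be tried, and it drops to `0` when a tour is
accepted. Codes that repeat a vertex are rejected by the collision count. -/
theorem bruteProg_spec (hb : Bounds n ω X R) (hQ : PotLe Q X) (h : Ready ω A Q ord K k s) (hKn : K ≤ n) :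
    Wp R bruteProg (K ^ K * (800 * (n + 1) ^ 2) + 200 * (n + 1)) s fun s' =>
      (s'.reg 20 = 1 ∧ ∃ t : Equiv.Perm (Fin n), HasTour t s' ∧ Accepts ω A Q k t) ∨
      (s'.reg 20 = 0 ∧ ∀ t : Equiv.Perm (Fin n), (∀ i : Fin n, K ≤ i → t i = ord i) →
        ¬ Accepts ω A Q k t) := by
  refine Wp.seq' (τ₁ := 21 * n + 10) (τ₂ := K ^ K * (800 * (n + 1) ^ 2) + 100)
    (I := fun s' => ∀ i : Fin K, s'.arr 8 (i : ℕ) = 0)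
    (Wp.fill (N := K) (fun _ => 0) h.ord.reg13 (hKn.trans hb.n_le_R) (by norm_num)
      (fun _ _ _ _ _ _ => by simp) (by simp) (fun s' _ _ h => h) (by simp; omega)) ?_ (by omega)
  intro s₁ hf₁ h8
  have h₁ := h.frame hf₁
  refine Wp.assign_seq (by simp) (Wp.assign_seq (by simp) ?_ (by simp)) (by simp)
  -- An empty kernel still has one code, as `0 ^ 0 = 1`.
  have hpos : 0 < K ^ K := by
    rcases Nat.eq_zero_or_pos K with rfl | h
    · simp
    · exact Nat.pow_pos h
  refine Wp.loop (τ₁ := 700 * (n + 1) ^ 2) (I := fun m s' => Ready ω A Q ord K k s' ∧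
    ((s'.reg 20 = 1 ∧ ∃ t : Equiv.Perm (Fin n), HasTour t s' ∧ Accepts ω A Q k t) ∧ s'.reg 19 = 0 ∨
      s'.reg 20 = 0 ∧ ∃ N, N + m = K ^ K ∧
        (∀ N' < N, ¬ (Function.Injective (tourOf ord K N') ∧ Accepts ω A Q k (tourOf ord K N'))) ∧
        ((s'.reg 19 = 1 ∧ m = 0) ∨ (s'.reg 19 = 0 ∧ 0 < m ∧
          ∀ i < K, s'.arr 8 (i : ℕ) = (N / K ^ i % K : ℕ))))) ?_ ?_ (K ^ K) _ ?_ ?_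
  · rintro m s₂ ⟨h₂, ⟨⟨h20, -⟩, h19⟩ | ⟨h20, N, hN, hno, ⟨h19, hm⟩ | ⟨h19, hm, hd⟩⟩⟩ he
    · simp [h20, h19] at he
    · simp [h20, h19] at he
    · refine (tryProg_spec hb hQ h₂ hKn hd).mono le_rfl ?_
      rintro s₃ hf₃ (⟨hinj, hacc, h20', h19', ht⟩ | ⟨hnot, h20', h19', hd'⟩)
      · refine ⟨0, hm, h₂.frame hf₃, Or.inl ⟨⟨h20',
          Equiv.ofBijective _ (Finite.injective_iff_bijective.1 hinj), ht, hacc⟩, by rw [h19', h19]⟩⟩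
      · refine ⟨m - 1, by omega, h₂.frame hf₃, Or.inr ⟨by rw [h20', h20], N + 1, by omega, ?_, ?_⟩⟩
        · intro N' hN'
          rcases Nat.lt_succ_iff_lt_or_eq.1 hN' with h | rfl
          · exact hno _ h
          · exact hnot
        · rcases Nat.lt_or_ge 1 m with h | h
          · refine Or.inr ⟨?_, by omega, hd'⟩
            rw [h19', if_neg]
            intro hdvd
            have := Nat.le_of_dvd (by omega) hdvd
            omega
          · refine Or.inl ⟨?_, by omega⟩
            rw [h19', if_pos]
            rw [show N + 1 = K ^ K by omega]
  · rintro m s₂ ⟨-, ⟨h1, -⟩ | ⟨h20, N, hN, hno, ⟨h19, hm⟩ | ⟨h19, hm, hd⟩⟩⟩ he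
    · exact Or.inl h1
    · refine Or.inr ⟨h20, fun t ht hacc => ?_⟩
      obtain ⟨N', hN', he'⟩ := exists_tourOf_eq hKn ht
      exact hno N' (by omega) (by rw [he']; exact ⟨t.injective, hacc⟩)
    · simp [h20, h19] at he
  · refine ⟨⟨h₁.wt.setReg.setReg, h₁.pot.setReg.setReg, h₁.ord.setReg.setReg, by simpa using h₁.reg1,
      by simpa using h₁.reg14, by simpa using h₁.reg18⟩, Or.inr ⟨by simp, 0, by simp, by simp,
      Or.inr ⟨by simp, hpos, fun i hi => ?_⟩⟩⟩
    simpa using h8 ⟨i, hi⟩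
  · simp only [cost_sub, cost_rg, cost_one, cost_zero]
    have : K ^ K * (700 * (n + 1) ^ 2 + (1 + 1 + 1 + 1 + 1) + 1) ≤ K ^ K * (800 * (n + 1) ^ 2) :=
      Nat.mul_le_mul_left _ (by nlinarith)
    omega

end Cost

end Specs

/-! ### The program: repairing and writing the tour -/

/-- Whether a vertex is not exceptional. -/
def outE (x : Expr) : Expr := 1 - ar 6 x

/-- Whether the link at the position in register `11` can be exchanged with the link at the position in
register `5`. -/
def canSwapE : Expr :=
  (1 - (rg 5).eq (rg 11)) * outE (ar 9 (rg 5)) * outE (ar 9 (nextE (rg 5))) *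
    (rE (ar 9 (rg 11)) (ar 9 (rg 5))).eq 0 *
    (rE (ar 9 (nextE (rg 11))) (ar 9 (nextE (rg 5)))).eq 0

/-- Reverses the positions between the registers `25` and `26`. -/
def revProg : Program :=
  .seq (fill 10 4 0 (ar 9 (rg 4 +
      (rg 25).lt (rg 4) * (1 - (rg 26).lt (rg 4)) * (rg 25 + 1 + rg 26 - 2 * rg 4))))
    (fill 9 4 0 (ar 10 (rg 4)))

/-- Exchanges the link at the position in register `11`. -/
def exchangeProg : Program :=
  .seq (argmin 9 10 5 0 canSwapE 0)
    (.seq (.assign 25 (rg 11 + (rg 9 - rg 11) * (rg 9).lt (rg 11)))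
    (.seq (.assign 26 (rg 11 + rg 9 - rg 25)) revProg))

/-- Exchanges all links that are not good. -/
def repairProg : Program :=
  IntRAM.forUp 11 0 (.ite
    (outE (ar 9 (rg 11)) * outE (ar 9 (nextE (rg 11))) *
      (1 - (rE (ar 9 (rg 11)) (ar 9 (nextE (rg 11)))).eq 0))
    exchangeProg .skip)

/-- Lists the vertices of a permutation with a single cycle. -/
def cycleProg : Program :=
  .seq (.assign 12 0) (.seq (IntRAM.forUp 4 0
    (.seq (.store (.addr 9 (rg 4)) (rg 12)) (.assign 12 (ar 1 (rg 12))))) (.assign 20 1))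

/-- Writes the output. -/
def outProg : Program := IntRAM.forUp 4 0 (.store (rg 4) (ar 9 (rg 4)))

/-! ### Correctness of the repair and of the output -/

section Specs
variable {n : ℕ} {ω : Fin n → Fin n → ℤ} {σ : Equiv.Perm (Fin n)} {E A : Finset (Fin n)}
  {Q : Fin n → ℤ} {s s' : State} {R X : ℕ}

theorem revProg_spec (hb : Bounds n ω X R) (h0 : s.reg 0 = n) {t : Fin n → Fin n} (ht : HasTour t s)
    {a b : Fin n} (h25 : s.reg 25 = (a : ℕ)) (h26 : s.reg 26 = (b : ℕ)) :
    Wp R revProg (100 * (n + 1)) s fun s' => HasTour (fun q => t (revPerm a b q)) s' := by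
  refine Wp.seq' (τ₁ := 60 * n + 10) (τ₂ := 40 * n + 10)
    (I := fun s' => ∀ q : Fin n, s'.arr 10 (q : ℕ) = (t (revPerm a b q) : ℕ))
    (Wp.fill (N := n) (fun q => (t (revPerm a b q) : ℕ)) h0 hb.n_le_R (by norm_num) ?_
    (fun q => hb.fin_le _) (fun s' _ _ h => h) (by simp; omega)) ?_ (by omega)
  · intro q s₁ hr h4 ha _
    have e : (rg 4 + (rg 25).lt (rg 4) * (1 - (rg 26).lt (rg 4)) *
        (rg 25 + 1 + rg 26 - 2 * rg 4)).eval s₁ = ((revPerm a b q : Fin n) : ℕ) := by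
      rw [revPerm_apply, rev]
      simp only [eval_add, eval_sub, eval_mul, eval_one, eval_lt, eval_rg, eval_ofNat, h4,
        hr 25 (by norm_num), hr 26 (by norm_num), h25, h26, Nat.cast_lt]
      split_ifs <;> simp <;> omega
    rw [eval_ar, e, ha 9 (by decide), ht]
  · intro s₁ hf₁ h₁
    have h0' : s₁.reg 0 = n := by rw [hf₁.reg _ (by rfl), h0]
    exact Wp.fill (N := n) (fun q => (t (revPerm a b q) : ℕ)) h0' hb.n_le_R (by norm_num)
      (fun q s' hr h4 ha _ => by rw [eval_ar, eval_rg, h4, ha 10 (by decide), h₁])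
      (fun q => hb.fin_le _) (fun s' _ _ h => h) (by simp; omega)

variable [NeZero n]

theorem eval_outE (hP : HasPot A Q s) {x : Expr} {a : Fin n} (hx : x.eval s = (a : ℕ)) :
    (outE x).eval s = if a ∈ A then 0 else 1 := by
  simp only [outE, eval_sub, eval_one, eval_ar, hx, hP.arr6]
  split_ifs <;> rfl

@[simp] theorem cost_outE (x : Expr) : (outE x).cost = x.cost + 9 := by simp [outE]; omega

@[simp] theorem cost_nextE (x : Expr) : (nextE x).cost = 2 * x.cost + 9 := by simp [nextE]; omega

/-- With the constant value `0`, the search for a minimum is a mere search for an admissible `j`.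
The two positions are then sorted, since a reversal needs its left end first. -/
theorem exchangeProg_spec (hb : Bounds n ω X R) (hW : HasWt n ω s) (hP : HasPot A Q s)
    {t : Fin n → Fin n} (ht : HasTour t s) {i : Fin n} (h11 : s.reg 11 = (i : ℕ))
    (hex : ∃ j, CanSwap A (redWeight ω Q) t i j) :
    Wp R exchangeProg (500 * (n + 1)) s fun s' => ∃ j, CanSwap A (redWeight ω Q) t i j ∧
      HasTour (fun q => t (revPerm (min i j) (max i j) q)) s' := by
  have hn := hb.n_le_R
  refine Wp.seq (τ₁ := 350 * n + 20) (τ₂ := 100 * (n + 1) + 50) (Wp.argmin (N := n)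
    (fun j => CanSwap A (redWeight ω Q) t i j) (fun _ => 0) hW.reg0 hb.n_le_R hb.one_le_R
    (by norm_num) (by norm_num) (by norm_num) (by norm_num) (by norm_num) (by norm_num) ?_
    (fun _ _ _ _ => rfl) (by simp) ?_ (by simp [canSwapE]; omega)) (by omega)
  · intro j v v'
    set s₁ := (((s.setReg 9 v).setReg 10 v').setReg 5 (j : ℕ)) with hs₁
    have hW₁ : HasWt n ω s₁ := hW.setReg.setReg.setReg
    have hP₁ : HasPot A Q s₁ := hP.setReg.setReg.setReg
    have ht₁ : HasTour t s₁ := ht.setReg.setReg.setReg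
    have e5 : (rg 5).eval s₁ = (j : ℕ) := rfl
    have e11 : (rg 11).eval s₁ = (i : ℕ) := h11
    have e1 : (ar 9 (rg 5)).eval s₁ = (t j : ℕ) := by rw [eval_ar, e5, ht₁]
    have e2 : (ar 9 (rg 11)).eval s₁ = (t i : ℕ) := by rw [eval_ar, e11, ht₁]
    have e3 : (ar 9 (nextE (rg 5))).eval s₁ = (t (j + 1) : ℕ) := by
      rw [eval_ar, eval_nextE hW₁.reg0 e5, ht₁]
    have e4 : (ar 9 (nextE (rg 11))).eval s₁ = (t (i + 1) : ℕ) := by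
      rw [eval_ar, eval_nextE hW₁.reg0 e11, ht₁]
    simp only [canSwapE, eval_mul, eval_sub, eval_eq, eval_one, eval_zero, eval_outE hP₁ e1,
      eval_outE hP₁ e3, eval_rE hW₁ hP₁ e2 e1, eval_rE hW₁ hP₁ e4 e3, e5, e11, Nat.cast_inj,
      Fin.val_inj, CanSwap]
    by_cases h1 : j = i <;> by_cases h2 : t j ∈ A <;> by_cases h3 : t (j + 1) ∈ A <;>
      by_cases h4 : redWeight ω Q (t i) (t j) = 0 <;>
      by_cases h5 : redWeight ω Q (t (i + 1)) (t (j + 1)) = 0 <;> simp [h1, h2, h3, h4, h5]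
  · rintro v v' (⟨-, hnone⟩ | ⟨j, rfl, hj, -, -⟩)
    · obtain ⟨j, hj⟩ := hex
      exact absurd hj (hnone j)
    set s₁ := (((s.setReg 9 (j : ℕ)).setReg 10 v').setReg 5 n) with hs₁
    have e9 : s₁.reg 9 = (j : ℕ) := rfl
    have e11 : s₁.reg 11 = (i : ℕ) := h11
    have e1 : (rg 11 + (rg 9 - rg 11) * (rg 9).lt (rg 11)).eval s₁ = ((min i j : Fin n) : ℕ) := by
      simp only [eval_add, eval_sub, eval_mul, eval_lt, eval_rg, e9, e11, Nat.cast_lt]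
      rw [Fin.coe_min]
      split_ifs <;> simp <;> omega
    refine Wp.assign_seq (by rw [e1]; exact hb.fin_le _) ?_ (by simp)
    rw [e1]
    have e2 : (rg 11 + rg 9 - rg 25).eval (s₁.setReg 25 ((min i j : Fin n) : ℕ)) =
        ((max i j : Fin n) : ℕ) := by
      simp only [eval_add, eval_sub, eval_rg, State.setReg_reg]
      rw [if_neg (by norm_num), if_neg (by norm_num), if_pos trivial, e9, e11, Fin.coe_min, Fin.coe_max]
      omega
    refine Wp.assign_seq (by rw [e2]; exact hb.fin_le _) ?_ (by simp)
    rw [e2]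
    refine (revProg_spec hb (a := min i j) (b := max i j) (t := t) hW.setReg.setReg.setReg.setReg.setReg.reg0
      ht.setReg.setReg.setReg.setReg.setReg (by simp) (by simp)).mono (by simp) ?_
    intro s₂ _ h₂
    exact ⟨j, hj, h₂⟩

/-- The links before the current position are good, and the cost of the links at `A` never changes.
Once all links are good, this cost is the full reduced cost. -/
theorem repairProg_spec (hb : Bounds n ω X R) (hsym : ∀ x y, ω x y = ω y x)
    (hW : HasWt n ω s) (hP : HasPot A Q s)
    {t : Equiv.Perm (Fin n)} (ht : HasTour t s)
    (hex : ∀ (t : Equiv.Perm (Fin n)) i, t i ∉ A → t (i + 1) ∉ A →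
      ∃ j, CanSwap A (redWeight ω Q) t i j) :
    Wp R repairProg (700 * (n + 1) ^ 2) s fun s' => ∃ t' : Equiv.Perm (Fin n), HasTour t' s' ∧
      tourCost (redWeight ω Q) t' = tourCost (restrictCost A (redWeight ω Q)) t := by
  refine Wp.forUp (τ₁ := 500 * (n + 1) + 150) (fun m s' => ∃ t' : Equiv.Perm (Fin n), HasTour t' s' ∧
      tourCost (restrictCost A (redWeight ω Q)) t' = tourCost (restrictCost A (redWeight ω Q)) t ∧
      ∀ q : Fin n, (q : ℕ) < m → Good A (redWeight ω Q) (t' q) (t' (q + 1))) n hW.reg0 hb.n_le_R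
    (by norm_num) (by rfl) (by rfl) ⟨t, ht.setReg, rfl, by simp⟩ ?_ ?_ (by nlinarith)
  · rintro m hm s₁ hf₁ h11 h0 ⟨t', ht', hcost, hgood⟩
    obtain ⟨i, rfl⟩ : ∃ i : Fin n, (i : ℕ) = m := ⟨⟨m, hm⟩, rfl⟩
    have hW₁ := hW.frame hf₁
    have hP₁ := hP.frame hf₁
    have e2 : (ar 9 (rg 11)).eval s₁ = (t' i : ℕ) := by rw [eval_ar, eval_rg, h11, ht']
    have e4 : (ar 9 (nextE (rg 11))).eval s₁ = (t' (i + 1) : ℕ) := by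
      rw [eval_ar, eval_nextE (p := rg 11) h0 h11, ht']
    have hc : (outE (ar 9 (rg 11)) * outE (ar 9 (nextE (rg 11))) *
      (1 - (rE (ar 9 (rg 11)) (ar 9 (nextE (rg 11)))).eq 0)).eval s₁ ≠ 0 ↔
        ¬ Good A (redWeight ω Q) (t' i) (t' (i + 1)) := by
      simp only [eval_mul, eval_sub, eval_eq, eval_one, eval_zero, eval_outE hP₁ e2,
        eval_outE hP₁ e4, eval_rE hW₁ hP₁ e2 e4, Good]
      by_cases h2 : t' i ∈ A <;> by_cases h3 : t' (i + 1) ∈ A <;>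
        by_cases h4 : redWeight ω Q (t' i) (t' (i + 1)) = 0 <;> simp [h2, h3, h4]
    refine Wp.ite (fun hne => ?_) (fun heq => ?_) (by simp)
    · have h1 := hc.1 hne
      rw [Good] at h1
      push Not at h1
      refine (exchangeProg_spec hb hW₁ hP₁ ht' h11 (hex t' i h1.1 h1.2.1)).mono (by simp) ?_
      rintro s₂ - ⟨j, hj, hs₂⟩ - -
      have h2 := repair_step (redWeight_comm ω hsym Q) t' h1.1 h1.2.1 hj
        (fun q hq => hgood q hq)
      exact ⟨t' * revPerm (min i j) (max i j), HasTour.setReg hs₂, h2.1.trans hcost,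
        fun q hq => h2.2 q (Fin.le_def.2 (by omega))⟩
    · refine Wp.skip (fun _ _ => ⟨t', ht'.setReg, hcost, fun q hq => ?_⟩) (by simp)
      rcases Nat.lt_succ_iff_lt_or_eq.1 hq with h | h
      · exact hgood q h
      · rw [Fin.ext h]
        by_contra hcon
        exact hc.2 hcon heq
  · rintro s₁ - - ⟨t', ht', hcost, hgood⟩
    exact ⟨t', ht', (tourCost_eq_of_good fun i => hgood i i.2).trans hcost⟩

theorem exists_perm_of_isCycleOn (hσ : σ.IsCycleOn Set.univ) :
    ∃ t : Equiv.Perm (Fin n), (∀ i : Fin n, t i = (σ ^ (i : ℕ)) 0) ∧ ∀ i, t (i + 1) = σ (t i) := by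
  have hσ' : σ.IsCycleOn ((Finset.univ : Finset (Fin n)) : Set (Fin n)) := by simpa using hσ
  have hinj : Function.Injective fun i : Fin n => (σ ^ (i : ℕ)) 0 := by
    intro i j hij
    have h := (hσ'.pow_apply_eq_pow_apply (Finset.mem_univ 0)).1 hij
    rw [Finset.card_univ, Fintype.card_fin] at h
    exact Fin.ext (Nat.ModEq.eq_of_lt_of_lt h i.2 j.2)
  refine ⟨Equiv.ofBijective _ (Finite.injective_iff_bijective.1 hinj), fun i => rfl, fun i => ?_⟩
  change (σ ^ ((i + 1 : Fin n) : ℕ)) 0 = σ ((σ ^ (i : ℕ)) 0)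
  rw [← Equiv.Perm.mul_apply, ← pow_succ']
  by_cases h : (i : ℕ) + 1 < n
  · rw [val_succ_of_lt h]
  · have h' : (i : ℕ) + 1 = n := by have := i.2; omega
    rw [val_succ_of_eq h', h', pow_zero, Equiv.Perm.one_apply,
      (hσ'.pow_apply_eq (Finset.mem_univ 0)).2 (by simp)]

theorem cycleProg_spec (hb : Bounds n ω X R) (hW : HasWt n ω s) (hS : HasSys σ E s) :
    Wp R cycleProg (100 * (n + 1)) s fun s' => s'.reg 20 = 1 ∧
      HasTour (fun i => (σ ^ (i : ℕ)) 0) s' := by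
  refine Wp.assign_seq (by simp) ?_ (by simp; omega)
  refine Wp.seq' (τ₁ := 40 * n + 10) (τ₂ := 2) (I := HasTour fun i => (σ ^ (i : ℕ)) 0) ?_
    (fun s' _ h => Wp.assign (by simpa using hb.one_le_R) ⟨by simp, h.setReg⟩ (by simp))
    (by simp; omega)
  refine Wp.forUp (τ₁ := 30) (fun m s' => s'.reg 12 = (((σ ^ m) 0 : Fin n) : ℕ) ∧
    ∀ i : Fin n, (i : ℕ) < m → s'.arr 9 (i : ℕ) = ((σ ^ (i : ℕ)) 0 : Fin n)) n hW.setReg.reg0 hb.n_le_R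
    (by norm_num) (by rfl) (by rfl) (by simp) ?_ (fun s' _ _ h i => h.2 i i.2) (by omega)
  rintro m hm s₁ hf₁ h4 h0 ⟨h12, hI⟩
  have hS₁ : HasSys σ E s₁ := (hS.setReg (r := 12) (v := 0)).frame hf₁
  refine Wp.store_seq (by rw [eval_rg, h12]; exact hb.fin_le _) (Wp.assign ?_ (fun _ _ => ⟨?_, ?_⟩) (by simp))
    (by simp)
  · simp only [eval_ar, eval_rg, eval_addr, h4, h12, State.setMem_reg, State.setMem_arr]
    simpa [hS₁.arr1] using hb.fin_le _
  · simp [h4, h12, hS₁.arr1, pow_succ']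
  · intro i hi
    simp only [eval_rg, eval_addr, h4, h12, State.setReg_arr, State.setMem_arr, true_and,
      Nat.cast_inj]
    rcases Nat.lt_succ_iff_lt_or_eq.1 hi with h | h
    · rw [if_neg (by omega), hI i h]
    · rw [if_pos h, h]

/-- The output goes to nonnegative addresses, so writing it does not disturb the tour that is still
being read. -/
theorem setMem_arr_of_nonneg {a i v : ℤ} (ha : 0 ≤ a) (hi : 0 ≤ i) (j : Fin 16) :
    (s.setMem a v).arr j i = s.arr j i := by
  have : cellAddr j i ≠ a := by unfold cellAddr; have := j.2; omega
  simp [State.arr, State.setMem_mem, this]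

theorem outProg_spec (hb : Bounds n ω X R) (h0 : s.reg 0 = n) {t : Fin n → Fin n} (ht : HasTour t s) :
    Wp R outProg (40 * (n + 1)) s fun s' => ∀ i : Fin n, s'.mem (i : ℕ) = (t i : ℕ) := by
  refine Wp.forUp (τ₁ := 20) (fun m s' => HasTour t s' ∧ ∀ i : Fin n, (i : ℕ) < m → s'.mem (i : ℕ) = (t i : ℕ))
    n h0 hb.n_le_R (by norm_num) (by rfl) (by rfl) ⟨ht.setReg, by simp⟩ ?_
    (fun s' _ _ h i => h.2 i i.2) (by omega)
  rintro m hm s₁ - h4 - ⟨ht₁, hI⟩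
  obtain ⟨q, rfl⟩ : ∃ q : Fin n, (q : ℕ) = m := ⟨⟨m, hm⟩, rfl⟩
  refine Wp.store (by simpa [h4, ht₁ q] using hb.fin_le _) (fun _ _ => ⟨fun i => ?_, fun i hi => ?_⟩) (by simp)
  · rw [State.setReg_arr, setMem_arr_of_nonneg (by simp [h4]) (by simp), ht₁]
  · change (s₁.setMem _ _).mem _ = _
    rw [State.setMem_mem]
    simp only [eval_rg, h4, Nat.cast_inj, eval_ar, ht₁ q]
    rcases Nat.lt_succ_iff_lt_or_eq.1 hi with h | h
    · rw [if_neg (by omega), hI i h]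
    · rw [if_pos h, Fin.ext h]

end Specs

/-- The search for a tour after a greedy phase that got stuck. -/
def structProg : Program :=
  .seq potProg (.seq partProg (.seq selProg (.seq bruteProg (.ite (rg 20) repairProg .skip))))

/-- The program for the travelling salesman problem below average. -/
def mainProg : Program :=
  .ite ((rg 0).lt 3) (.assign 0 0) (.seq startProg (.seq (.ite (rg 7) .skip greedyProg)
    (.seq (.ite (rg 7) structProg cycleProg)
      (.ite (rg 20) (.seq outProg (.assign 0 1)) (.assign 0 0)))))

/-! ### Correctness of the whole program -/

section Specs
variable {n : ℕ} [NeZero n] {ω : Fin n → Fin n → ℤ} {σ : Equiv.Perm (Fin n)} {E A : Finset (Fin n)}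
  {Q : Fin n → ℤ} {s s' : State} {R X k L : ℕ}

/-- Each vertex lies on two links of a tour, so the potentials contribute the same amount to every
tour. -/
theorem tourCost_redWeight (t : Equiv.Perm (Fin n)) :
    tourCost (redWeight ω Q) t + 2 * ∑ x, Q x = 2 * tourCost ω t := by
  have h1 : ∑ i, Q (t i) = ∑ x, Q x := Equiv.sum_comp t Q
  have h2 : ∑ i, Q (t (i + 1)) = ∑ x, Q x := Equiv.sum_comp ((Equiv.addRight 1).trans t) Q
  simp only [tourCost, redWeight, Finset.sum_sub_distrib, ← Finset.mul_sum, h1, h2]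
  ring

/-- There is a tour that is below average by `k`, in terms of the weight matrix. -/
def IsBelow (ω : Fin n → Fin n → ℤ) (k : ℕ) (t : Fin n → Fin n) : Prop :=
  ((n : ℤ) - 1) * (tourCost ω t + k) ≤ ∑ x, ∑ y, ω x y

/-- The conditions on the exceptional set and the potentials. -/
structure IsReduced (ω : Fin n → Fin n → ℤ) (A : Finset (Fin n)) (Q : Fin n → ℤ) : Prop where
  nonneg : ∀ x ∉ A, ∀ y ∉ A, x ≠ y → 0 ≤ redWeight ω Q x y
  exists_canSwap : ∀ (t : Equiv.Perm (Fin n)) i, t i ∉ A → t (i + 1) ∉ A →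
    ∃ j, CanSwap A (redWeight ω Q) t i j

/-- An accepted arrangement is repaired into a tour whose reduced cost is its restricted cost, so
the test is about true weights. Conversely, for a tour below average by `k`, passing to the
restricted cost and then putting the kernel first does not raise the cost, so the search meets an
accepted code. -/
theorem structProg_spec (hb : Bounds n ω X R) (hn : 3 ≤ n) (hsym : ∀ x y, ω x y = ω y x)
    (hW : HasWt n ω s) (hS : HasSys σ E s) (hs : HasSums ω σ E s) (h1 : s.reg 1 = k)
    (h14 : s.reg 14 = ∑ x, ∑ y, ω x y) (hA : ∀ x, x ∈ A ↔ (σ x ≠ x ∨ s.reg 15 ≠ 0))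
    (hred : IsReduced ω A (cutPot ω σ E A))
    (hL : ∀ K, K ≤ n → K ≤ A.card + 3 * A.card ^ 3 → K ≤ L) :
    Wp R structProg (L ^ L * (800 * (n + 1) ^ 2) + 2000 * (n + 1) ^ 4) s fun s' =>
      (s'.reg 20 = 1 ∧ ∃ t : Equiv.Perm (Fin n), HasTour t s' ∧ IsBelow ω k t) ∨
      (s'.reg 20 = 0 ∧ ∀ t : Equiv.Perm (Fin n), ¬ IsBelow ω k t) := by
  have hQ : PotLe (cutPot ω σ E A) X := hb.cutPot_le
  have h4 : 16 * (n + 1) ^ 2 ≤ (n + 1) ^ 4 := by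
    rw [show (n + 1) ^ 4 = (n + 1) ^ 2 * (n + 1) ^ 2 by ring]
    exact Nat.mul_le_mul_right _ (by nlinarith)
  have h5 : 4 * (n + 1) ≤ (n + 1) ^ 2 := by nlinarith
  refine (potProg_spec hb hW hS hs hA).seq' (τ₂ := L ^ L * (800 * (n + 1) ^ 2) + 1000 * (n + 1) ^ 4 +
    800 * (n + 1) ^ 2 + 1000 * (n + 1)) ?_ (by omega)
  rintro s₁ hf₁ ⟨hP₁, h18⟩
  have hW₁ := hW.frame hf₁
  refine (partProg_spec hb hW₁ hP₁).seq' (τ₂ := L ^ L * (800 * (n + 1) ^ 2) + 1000 * (n + 1) ^ 4 +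
    800 * (n + 1) ^ 2 + 800 * (n + 1)) ?_ (by omega)
  rintro s₂ hf₂ ⟨ord₀, hO₂, hord₀⟩
  have hW₂ := hW₁.frame hf₂
  have hP₂ := hP₁.frame hf₂
  refine (selProg_spec hb hW₂ hP₂ hQ hO₂ hord₀).seq' (τ₂ := L ^ L * (800 * (n + 1) ^ 2) +
    800 * (n + 1) ^ 2 + 800 * (n + 1)) ?_ (by omega)
  rintro s₃ hf₃ ⟨ord, K, hO₃, hKn, hKA, hker⟩
  have hready : Ready ω A (cutPot ω σ E A) ord K k s₃ := by
    refine ⟨hW₂.frame hf₃, hP₂.frame hf₃, hO₃, ?_, ?_, ?_⟩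
    · rw [hf₃.reg _ (by rfl), hf₂.reg _ (by rfl), hf₁.reg _ (by rfl), h1]
    · rw [hf₃.reg _ (by rfl), hf₂.reg _ (by rfl), hf₁.reg _ (by rfl), h14]
    · rw [hf₃.reg _ (by rfl), hf₂.reg _ (by rfl), h18]
  have hKL := hL K hKn hKA
  have hpow : K ^ K ≤ L ^ L := by
    rcases Nat.eq_zero_or_pos L with rfl | h
    · rw [Nat.le_zero.1 hKL]
    · exact (Nat.pow_le_pow_left hKL K).trans (Nat.pow_le_pow_right h hKL)
  have hpow' := Nat.mul_le_mul_right (800 * (n + 1) ^ 2) hpow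
  refine (bruteProg_spec hb hQ hready hKn).seq' (τ₂ := 700 * (n + 1) ^ 2 + 10) ?_ (by omega)
  rintro s₄ hf₄ (⟨h20, t, ht, hacc⟩ | ⟨h20, hno⟩)
  · refine Wp.ite (fun _ => ?_) (fun heq => ?_) (by simp)
    · refine (repairProg_spec hb hsym (hready.wt.frame hf₄) (hready.pot.frame hf₄) ht
        hred.exists_canSwap).mono (by simp) ?_
      rintro s₅ hf₅ ⟨t', ht', hcost⟩
      refine Or.inl ⟨by rw [hf₅.reg _ (by rfl), h20], t', ht', ?_⟩
      have h6 := tourCost_redWeight (ω := ω) (Q := cutPot ω σ E A) t'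
      rw [Accepts, ← hcost, h6] at hacc
      rw [IsBelow]
      linarith
    · simp [h20] at heq
  · refine Wp.ite (fun hne => by simp [h20] at hne) (fun _ => ?_) (by simp)
    refine Wp.skip (Or.inr ⟨h20, fun t ht => ?_⟩) (by simp)
    obtain ⟨t', ht', hord⟩ := exists_tour_kernel_first (c := restrictCost A (redWeight ω (cutPot ω σ E A)))
      hn (restrictCost_comm (redWeight_comm ω hsym _)) hker.1
      (fun x hx y hy => by simp [restrictCost, hx, hy])
      (fun u hu a ha a' ha' => by simpa [restrictCost, ha, ha'] using hker.2 u hu a ha a' ha')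
      ord (K := K) (fun i => by simp [mem_firsts]) t
    refine hno t' hord ?_
    have h6 := tourCost_redWeight (ω := ω) (Q := cutPot ω σ E A) t
    have h7 := restrictCost_tour_le (t := t) hn hred.nonneg
    rw [IsBelow] at ht
    rw [Accepts]
    have h8 : ((n : ℤ) - 1) * (tourCost (restrictCost A (redWeight ω (cutPot ω σ E A))) t' +
        2 * ∑ x, cutPot ω σ E A x + 2 * k) ≤ ((n : ℤ) - 1) * (2 * (tourCost ω t + k)) :=
      mul_le_mul_of_nonneg_left (by linarith) (by omega)
    linarith

/-- The stop occurs within `100k` merges, so `|A| ≤ 2(n - |E|) < 200k`, which is less than `n/50`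
because `n > 10000k`. This leaves enough fixed points for the potentials and enough links for the
exchanges. -/
theorem isReduced_of_isStuck (hsym : ∀ x y, ω x y = ω y x) (hps : IsPathSystem σ E)
    (hmv : (Finset.univ.filter fun v => σ v ≠ v).card + 2 * E.card ≤ 2 * n)
    (hstuck : IsStuck ω k σ E) (hkn : 10000 * k + 1 ≤ n) (hA : ∀ x, x ∈ A ↔ σ x ≠ x) :
    IsReduced ω A (cutPot ω σ E A) := by
  obtain ⟨h3, hEk, h⟩ := hstuck
  -- For `k = 0` the greedy phase cannot stop early; so `n ≥ 10001`, which pays for the additive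
  -- constants below.
  have hk : 1 ≤ k := by
    by_contra hcon
    have := Finset.card_le_univ E
    rw [Fintype.card_fin] at this
    omega
  have hAe : A = Finset.univ.filter fun v => σ v ≠ v := by ext; simp [hA]
  have hfix : (Finset.univ.filter fun v => σ v = v).card + A.card = n := by
    rw [hAe, Finset.card_filter_add_card_filter_not, Finset.card_univ, Fintype.card_fin]
  have hEn : E.card ≤ n := (Finset.card_le_univ E).trans (by simp)
  rw [← hAe] at hmv
  have hU : 3 * E.card + 30 ≤ 10 * (Finset.univ.filter fun v => σ v = v).card := by omega
  have hpot : cutPot ω σ E A = pot ω σ E := by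
    funext x
    by_cases hx : σ x = x <;> simp [cutPot, pot, hA, hx]
  rw [hpot]
  have hmem : ∀ x, x ∉ A ↔ σ x = x := fun x => by rw [hA, not_not]
  refine ⟨fun x hx y hy hxy => redWeight_pot_nonneg ω h3 h hsym hps hU ((hmem x).1 hx) ((hmem y).1 hy) hxy,
    fun t i hi hi' => exists_canSwap t i hi hi' (fun x hx => ?_) (by omega)⟩
  have h4 := card_redWeight_pot_ne_zero_le ω h3 h hsym hps hU ((hmem x).1 hx)
  simp only [hmem]
  omega

theorem isBelow_of_expWeight (hn : 3 ≤ n) (hω : ∀ x, ω x x = 0) (hE : E.card = 1)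
    (hexp : expWeight ω σ E ≤ expWeight ω 1 Finset.univ - k) {t : Equiv.Perm (Fin n)}
    (ht : ∀ i, t (i + 1) = σ (t i)) : IsBelow ω k t := by
  have h1 : tourCost ω t = ∑ v, ω v (σ v) := by
    simp only [tourCost, ht]
    exact Equiv.sum_comp t fun v => ω v (σ v)
  rw [expWeight_card_one ω hE, expWeight_one_univ ω (by simp; omega) hω, Fintype.card_fin] at hexp
  have h2 : (0 : ℚ) < n - 1 := by
    have : (3 : ℚ) ≤ n := by exact_mod_cast hn
    linarith
  rw [le_sub_iff_add_le, le_div_iff₀ h2] at hexp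
  rw [IsBelow, h1]
  have h3 : (((n : ℤ) - 1) * (∑ v, ω v (σ v) + k) : ℚ) ≤ ((∑ x, ∑ y, ω x y : ℤ) : ℚ) := by
    push_cast at hexp ⊢
    linarith
  exact_mod_cast h3

/-- The constant in `hL` covers both kinds of kernel: `K ≤ 200k + 3(200k)³` after a stop, and `K ≤ n
≤ 10000k` on a small instance. -/
theorem mainProg_spec (hb : Bounds n ω X R) (hn : 3 ≤ n) (hsym : ∀ x y, ω x y = ω y x)
    (hω : ∀ x, ω x x = 0) (h0 : s.reg 0 = n) (h1 : s.reg 1 = k)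
    (hmem : ∀ x y : Fin n, s.mem ((x : ℕ) * n + (y : ℕ)) = ω x y) (hL : 24010000 * k ^ 3 ≤ L) :
    Wp R mainProg (L ^ L * (800 * (n + 1) ^ 2) + 5000 * (n + 1) ^ 4) s fun s' =>
      (s'.reg 0 = 1 ∧ ∃ t : Equiv.Perm (Fin n), IsBelow ω k t ∧ ∀ i : Fin n, s'.mem (i : ℕ) = (t i : ℕ)) ∨
      (s'.reg 0 = 0 ∧ ∀ t : Equiv.Perm (Fin n), ¬ IsBelow ω k t) := by
  have h4 : 16 * (n + 1) ^ 2 ≤ (n + 1) ^ 4 := by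
    rw [show (n + 1) ^ 4 = (n + 1) ^ 2 * (n + 1) ^ 2 by ring]
    exact Nat.mul_le_mul_right _ (by nlinarith)
  have h5 : 4 * (n + 1) ≤ (n + 1) ^ 2 := by nlinarith
  have h6 : 4 * (n * (n + 1) ^ 2) ≤ (n + 1) ^ 4 := by
    rw [show (n + 1) ^ 4 = (n + 1) ^ 2 * (n + 1) ^ 2 by ring, ← mul_assoc]
    exact Nat.mul_le_mul_right _ (by nlinarith)
  have hk3 : k ≤ k ^ 3 := Nat.le_self_pow (by norm_num) k
  refine Wp.ite (fun hne => ?_) (fun _ => ?_) (by simp; omega)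
  · exfalso
    simp [h0] at hne
    omega
  refine (startProg_spec hb h0 h1 hmem hω).seq' (τ₂ := L ^ L * (800 * (n + 1) ^ 2) +
    3000 * (n * (n + 1) ^ 2) + 2000 * (n + 1) ^ 4 + 500 * (n + 1)) ?_ (by simp; omega)
  rintro s₁ hf₁ ⟨hW₁, hS₁, hs₁, hk₁, h14₁, h15₁, h7₁⟩
  refine Wp.seq' (τ₁ := 3000 * (n * (n + 1) ^ 2) + 10) (τ₂ := L ^ L * (800 * (n + 1) ^ 2) +
    2000 * (n + 1) ^ 4 + 300 * (n + 1)) (I := fun s' => ∃ σ E, HasSys σ E s' ∧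
      ((s'.reg 7 = 0 ∧ IsPathSystem σ E ∧ E.card = 1 ∧
          expWeight ω σ E ≤ expWeight ω 1 Finset.univ - k) ∨
        (s'.reg 7 = 1 ∧ HasSums ω σ E s' ∧ (n < 10000 * k + 1 ∨ (10000 * k + 1 ≤ n ∧ IsPathSystem σ E ∧
          (Finset.univ.filter fun v => σ v ≠ v).card + 2 * E.card ≤ 2 * n ∧ IsStuck ω k σ E)))) )
    ?_ ?_ (by omega)
  · refine Wp.ite (fun hne => ?_) (fun heq => ?_) (by simp)
    · have hlt : n < 10000 * k + 1 := by
        by_contra hcon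
        simp [h7₁, hcon] at hne
      exact Wp.skip ⟨1, Finset.univ, hS₁, Or.inr ⟨by simp [h7₁, hlt], hs₁, Or.inl hlt⟩⟩ (by simp)
    · have hge : 10000 * k + 1 ≤ n := by
        by_contra hcon
        simp [h7₁, not_le.1 hcon] at heq
      refine (greedyProg_spec hb hn hW₁ hS₁ hk₁ hge heq).mono (by simp) ?_
      rintro s₂ - ⟨σ, E, hS₂, hps, hmv, ⟨h7, hE, hexp⟩ | ⟨h7, hs₂, hst⟩⟩
      · exact ⟨σ, E, hS₂, Or.inl ⟨h7, hps, hE, hexp⟩⟩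
      · exact ⟨σ, E, hS₂, Or.inr ⟨h7, hs₂, Or.inr ⟨hge, hps, hmv, hst⟩⟩⟩
  rintro s₂ hf₂ ⟨σ, E, hS₂, hcase⟩
  have hW₂ := hW₁.frame hf₂
  have hk₂ : s₂.reg 1 = k := by rw [hf₂.reg _ (by rfl), hk₁]
  have h14₂ : s₂.reg 14 = ∑ x, ∑ y, ω x y := by rw [hf₂.reg _ (by rfl), h14₁]
  have h15₂ : s₂.reg 15 = if n < 10000 * k + 1 then 1 else 0 := by rw [hf₂.reg _ (by rfl), h15₁]
  refine Wp.seq' (τ₁ := L ^ L * (800 * (n + 1) ^ 2) + 2000 * (n + 1) ^ 4 + 100 * (n + 1) + 10)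
    (τ₂ := 40 * (n + 1) + 20) (I := fun s' => s'.reg 0 = n ∧
      ((s'.reg 20 = 1 ∧ ∃ t : Equiv.Perm (Fin n), HasTour t s' ∧ IsBelow ω k t) ∨
      (s'.reg 20 = 0 ∧ ∀ t : Equiv.Perm (Fin n), ¬ IsBelow ω k t))) ?_ ?_ (by omega)
  · refine Wp.ite (fun hne => ?_) (fun heq => ?_) (by simp)
    · rcases hcase with ⟨h7, -⟩ | ⟨h7, hs₂, hcase⟩
      · exact absurd h7 hne
      have hspec : ∃ A : Finset (Fin n), (∀ x, x ∈ A ↔ (σ x ≠ x ∨ s₂.reg 15 ≠ 0)) ∧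
          IsReduced ω A (cutPot ω σ E A) ∧ ∀ K, K ≤ n → K ≤ A.card + 3 * A.card ^ 3 → K ≤ L := by
        rcases hcase with hlt | ⟨hge, hps, hmv, hst⟩
        -- On a small instance all vertices are exceptional, so the conditions on pairs outside `A`
        -- are vacuous and the kernel is bounded by `n`.
        · refine ⟨Finset.univ, by simp [h15₂, hlt], ⟨by simp, by simp⟩, fun K hK _ => ?_⟩
          omega
        · have hA : ∀ x, x ∈ (Finset.univ.filter fun v => σ v ≠ v) ↔ σ x ≠ x := by simp
          refine ⟨Finset.univ.filter fun v => σ v ≠ v, by simp [h15₂, not_lt.2 hge],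
            isReduced_of_isStuck hsym hps hmv hst hge hA, fun K _ hK => ?_⟩
          have hEk := hst.2.1
          have hcard : (Finset.univ.filter fun v => σ v ≠ v).card ≤ 200 * k := by omega
          refine (hK.trans ?_).trans hL
          have h8 := Nat.pow_le_pow_left hcard 3
          rw [mul_pow] at h8
          omega
      obtain ⟨A, hA, hred, hKL⟩ := hspec
      refine (structProg_spec hb hn hsym hW₂ hS₂ hs₂ hk₂ h14₂ hA hred hKL).mono (by simp; omega) ?_
      intro s₃ hf₃ h
      exact ⟨by rw [hf₃.reg _ (by rfl), hW₂.reg0], h⟩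
    · rcases hcase with ⟨h7, hps, hE, hexp⟩ | ⟨h7, -⟩
      swap
      · rw [eval_rg, h7] at heq; norm_num at heq
      obtain ⟨t, ht, ht'⟩ := exists_perm_of_isCycleOn (hps.isCycleOn hE)
      refine (cycleProg_spec hb hW₂ hS₂).mono (by simp; omega) ?_
      rintro s₃ hf₃ ⟨h20, hT⟩
      refine ⟨by rw [hf₃.reg _ (by rfl), hW₂.reg0], Or.inl ⟨h20, t, fun i => ?_,
        isBelow_of_expWeight hn hω hE hexp ht'⟩⟩
      rw [hT i, ht i]
  · rintro s₃ hf₃ ⟨h0₃, ⟨h20, t, hT, hbel⟩ | ⟨h20, hno⟩⟩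
    · refine Wp.ite (fun _ => ?_) (fun heq => by simp [h20] at heq) (by simp)
      refine (outProg_spec hb h0₃ hT).seq' (τ₂ := 2) (fun s₄ _ h => ?_) (by simp)
      exact Wp.assign (by simpa using hb.one_le_R) (Or.inl ⟨by simp, t, hbel, h⟩) (by simp)
    · refine Wp.ite (fun hne => by simp [h20] at hne) (fun _ => ?_) (by simp)
      exact Wp.assign (by simp) (Or.inr ⟨by simp, hno⟩) (by simp)

end Specs

/-! ### Degenerate instances, the input state, and the final bounds -/

theorem not_belowAverage_of_lt {n : ℕ} (hn : n < 3) (w : Weighting n) (k : ℕ) :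
    ¬ ∃ (a : Fin n) (H : (K n).Walk a a), BelowAverage w k H := by
  rintro ⟨a, H, hH, -⟩
  have h1 := hH.length_eq
  have h2 := hH.isCycle.three_le_length
  rw [Fintype.card_fin] at h1
  omega

theorem input_bdd {n k : ℕ} (w : Weighting n) {R : ℕ} (hn : n ≤ R) (hk : k ≤ R) (hw : maxAbs w ≤ R) :
    (input n w k).Bdd R := by
  constructor
  · intro r
    simp only [input]
    split_ifs <;> simp [hn, hk]
  · intro a
    simp only [input]
    split_ifs with h
    · unfold entry
      split_ifs with h'
      · exact le_trans (Finset.le_sup (f := fun e => (w e).natAbs) (Finset.mem_univ _)) hw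
      · simp
    · simp

theorem input_mem {n k : ℕ} (w : Weighting n) (x y : Fin n) :
    (input n w k).mem ((x : ℕ) * n + (y : ℕ)) = wt w x y := by
  have h1 : (((x : ℕ) : ℤ) * n + (y : ℕ)).toNat = (y : ℕ) + n * x := by
    rw [← Nat.cast_mul, ← Nat.cast_add, Int.toNat_natCast]; ring
  have hn : 0 < n := x.pos
  simp only [input]
  rw [if_pos (by positivity), h1, Nat.add_mul_div_left _ _ hn, Nat.div_eq_of_lt y.2, zero_add,
    Nat.add_mul_mod_self_left, Nat.mod_eq_of_lt y.2, wt]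

theorem mul_factorial_le (m a : ℕ) (hm : 1 ≤ m) : a * m.factorial ≤ (m + a).factorial := by
  have h1 := Nat.factorial_mul_pow_le_factorial (m := m) (n := a)
  have h2 : a ≤ (m + 1) ^ a := (Nat.lt_pow_self (by omega)).le
  calc a * m.factorial ≤ (m + 1) ^ a * m.factorial := Nat.mul_le_mul_right _ h2
    _ = m.factorial * (m + 1) ^ a := mul_comm _ _
    _ ≤ _ := h1

theorem pow_self_mul_le_factorial (L : ℕ) : L ^ L * L ^ L ≤ (3 * L).factorial := by
  have h1 := Nat.factorial_mul_pow_le_factorial (m := L) (n := 2 * L)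
  have h2 : L ^ L * L ^ L ≤ (L + 1) ^ (2 * L) := by
    rw [← pow_add, ← two_mul]; exact Nat.pow_le_pow_left (by omega) _
  calc L ^ L * L ^ L ≤ (L + 1) ^ (2 * L) := h2
    _ ≤ L.factorial * (L + 1) ^ (2 * L) := Nat.le_mul_of_pos_left _ (Nat.factorial_pos _)
    _ ≤ (L + 2 * L).factorial := h1
    _ = _ := by congr 1; ring

/-- The product `L ^ L * n ^ 2` is split as at most `L ^ (2L) + n ^ 4`. The first term is below
`(3L)!`, and its constant factor `3200` is absorbed by enlarging the argument of the factorial. -/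
theorem time_le {n k c L C : ℕ} (hn : 1 ≤ n) (hL : L = c * k ^ 3) (hC : C = 3 * c + 90000) :
    L ^ L * (800 * (n + 1) ^ 2) + 5000 * (n + 1) ^ 4 ≤
      (C * k ^ 3).factorial + C * (k ^ 3 * n) + C * n ^ 7 := by
  have h1 : (n + 1) ^ 2 ≤ 4 * n ^ 2 := by nlinarith
  have h2 : (n + 1) ^ 4 ≤ 16 * n ^ 4 := by
    calc (n + 1) ^ 4 ≤ (2 * n) ^ 4 := Nat.pow_le_pow_left (by omega) 4
      _ = _ := by ring
  have h3 : n ^ 4 ≤ n ^ 7 := Nat.pow_le_pow_right hn (by norm_num)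
  have h4 : L ^ L * n ^ 2 ≤ L ^ L * L ^ L + n ^ 4 := by
    rw [show n ^ 4 = n ^ 2 * n ^ 2 by ring]
    nlinarith [Nat.mul_le_mul_left (L ^ L) (Nat.zero_le (n ^ 2)), sq_nonneg ((L : ℤ) ^ L - n ^ 2),
      Nat.zero_le (L ^ L * n ^ 2), Nat.le_total (L ^ L) (n ^ 2)]
  have h5 : L ^ L * (800 * (n + 1) ^ 2) ≤ 3200 * (L ^ L * L ^ L) + 3200 * n ^ 4 := by
    calc L ^ L * (800 * (n + 1) ^ 2) ≤ L ^ L * (800 * (4 * n ^ 2)) :=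
          Nat.mul_le_mul_left _ (Nat.mul_le_mul_left _ h1)
      _ = 3200 * (L ^ L * n ^ 2) := by ring
      _ ≤ 3200 * (L ^ L * L ^ L + n ^ 4) := Nat.mul_le_mul_left _ h4
      _ = _ := by ring
  have h6 : 3200 * (L ^ L * L ^ L) ≤ (C * k ^ 3).factorial + 3200 * n ^ 7 := by
    -- For `k = 0` there is no room inside the factorial; then `L ^ L = 1` and the term `n ^ 7`
    -- pays.
    rcases Nat.eq_zero_or_pos L with h | h
    · rw [h]
      have : 1 ≤ n ^ 7 := Nat.one_le_pow _ _ hn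
      norm_num
      omega
    · have h7 := Nat.mul_le_mul_left 3200 (pow_self_mul_le_factorial L)
      have h8 := mul_factorial_le (3 * L) 3200 (by omega)
      have hk : 1 ≤ k ^ 3 := by
        rcases Nat.eq_zero_or_pos (k ^ 3) with h' | h'
        · rw [h', mul_zero] at hL; omega
        · exact h'
      have h9 : 3 * L + 3200 ≤ C * k ^ 3 := by rw [hL, hC]; nlinarith
      have := Nat.factorial_le h9
      omega
  have h10 : 90000 * n ^ 7 ≤ C * n ^ 7 := Nat.mul_le_mul_right _ (by omega)
  have h11 : 0 ≤ C * (k ^ 3 * n) := Nat.zero_le _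
  omega

theorem computable_bound (C : ℕ) : Computable fun k => (C * k ^ 3).factorial + C * k ^ 3 + C := by
  have hf : Primrec Nat.factorial := by
    refine (Primrec.nat_rec₁ 1 (f := fun n m => (n + 1) * m) ?_).of_eq fun n => ?_
    · exact Primrec.nat_mul.comp₂ (Primrec.succ.comp₂ Primrec₂.left) Primrec₂.right
    · induction n with
      | zero => rfl
      | succ n ih => simp only [Nat.factorial_succ, ← ih]
  have hg : Primrec fun k : ℕ => C * k ^ 3 := by
    have h : Primrec fun k : ℕ => C * (k * (k * k)) :=
      Primrec.nat_mul.comp (Primrec.const C) (Primrec.nat_mul.comp Primrec.id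
        (Primrec.nat_mul.comp Primrec.id Primrec.id))
    exact h.of_eq fun k => by ring
  exact (Primrec.nat_add.comp (Primrec.nat_add.comp (hf.comp hg) hg) (Primrec.const C)).to_comp

/-- All stored values and all constants of the program are at most `R = X ^ (m + 6)`, so all
intermediate values are at most `R ^ (2 * maxCost)`, a fixed power of `X`. -/
theorem exists_runs (m : ℕ) (hm : 1000000 + mainProg.maxConst ≤ m) {n k : ℕ} (w : Weighting n)
    (hn : 1 ≤ n) {c L C : ℕ} (hc : c = 24010000) (hL : L = c * k ^ 3) (hC : C = 3 * c + 90000) :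
    ∃ (t : ℕ) (s : State),
      Runs ((maxAbs w + n + k + 1) ^ ((m + 6) * (2 * mainProg.maxCost))) mainProg (input n w k) t s ∧
      CorrectOutput w k s ∧ t ≤ (C * k ^ 3).factorial + C * (k ^ 3 * n) + C * n ^ 7 := by
  set X := maxAbs w + n + k + 1 with hX
  have hX2 : 2 ≤ X := by omega
  have hX6 : X ≤ X ^ 6 := Nat.le_self_pow (by norm_num) X
  -- Since `X ≥ 2`, the constant factor `m` is itself below the power `X ^ m`; this makes `R` a pure
  -- power of `X`.
  have hmR : m * X ^ 6 ≤ X ^ (m + 6) := by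
    rw [pow_add]
    exact Nat.mul_le_mul_right _ (Nat.lt_pow_self (by omega)).le
  have hXR : X ≤ m * X ^ 6 := hX6.trans (Nat.le_mul_of_pos_left _ (by omega))
  set R := X ^ (m + 6) with hR
  have hb : Bounds n (wt w) X R := ⟨by omega, by omega,
    fun x y => (natAbs_wt_le w x y).trans (by omega),
    (Nat.mul_le_mul_right _ (by omega)).trans hmR⟩
  have hconst : mainProg.maxConst ≤ R := by
    have : m ≤ m * X ^ 6 := Nat.le_mul_of_pos_right _ (by positivity)
    omega
  have hbdd : (input n w k).Bdd R := input_bdd w (by omega) (by omega) (by omega)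
  have main : Wp R mainProg (L ^ L * (800 * (n + 1) ^ 2) + 5000 * (n + 1) ^ 4) (input n w k)
      (CorrectOutput w k) := by
    rcases Nat.lt_or_ge n 3 with h | h
    · have h4 : 1 ≤ (n + 1) ^ 4 := Nat.one_le_pow 4 (n + 1) (by omega)
      refine Wp.ite (fun _ => ?_) (fun heq => ?_) ?_
      · exact Wp.assign (by simp) (Or.inr ⟨by simp, not_belowAverage_of_lt h w k⟩)
          (by simp; omega)
      · simp [input] at heq
        omega
      · simp
        omega
    · have : NeZero n := ⟨by omega⟩
      refine (mainProg_spec hb h (wt_comm w) (wt_self w) (k := k) (by simp [input]) (by simp [input])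
        (input_mem w) (by rw [hL, hc])).mono le_rfl ?_
      rintro s - (⟨h0, t, ht, hmem⟩ | ⟨h0, hno⟩)
      · obtain ⟨a, H, hH, hHt⟩ := exists_hamiltonianCycle h t
        refine Or.inl ⟨h0, a, H, (belowAverage_iff w h k hH hHt).2 ht, fun i hi => ?_⟩
        rw [hmem ⟨i, hi⟩, ← hHt ⟨i, hi⟩]
      · refine Or.inr ⟨h0, fun hex => ?_⟩
        obtain ⟨t, ht⟩ := (exists_belowAverage_iff w h k).1 hex
        exact hno t ht
  obtain ⟨t, s, hrun, ht, hs⟩ := main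
  have h1 := (hrun.runs (by omega) hconst le_rfl hbdd).1
  rw [hR, ← pow_mul] at h1
  exact ⟨t, s, h1, hs, ht.trans (time_le hn hL hC)⟩

end TSP

theorem theorem1 :
    ∃ (P : IntRAM.Program) (C D c : ℕ) (f : ℕ → ℕ), Computable f ∧
      ∀ (n k : ℕ) (w : TSP.Weighting n), 1 ≤ n →
        ∃ (t : ℕ) (s : IntRAM.State),
          IntRAM.Runs ((TSP.maxAbs w + n + k + 1) ^ D) P (TSP.input n w k) t s ∧
          TSP.CorrectOutput w k s ∧
          t ≤ (C * k ^ 3).factorial + C * (k ^ 3 * n) + C * n ^ 7 ∧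
          t ≤ f k * n ^ c := by
  obtain ⟨m, hm⟩ : ∃ m, 1000000 + TSP.mainProg.maxConst ≤ m := ⟨_, le_rfl⟩
  obtain ⟨c, hc⟩ : ∃ c : ℕ, c = 24010000 := ⟨_, rfl⟩
  obtain ⟨C, hC⟩ : ∃ C : ℕ, C = 3 * c + 90000 := ⟨_, rfl⟩
  refine ⟨TSP.mainProg, C, (m + 6) * (2 * TSP.mainProg.maxCost), 7,
    fun k => (C * k ^ 3).factorial + C * k ^ 3 + C, TSP.computable_bound C, fun n k w hn => ?_⟩
  obtain ⟨t, s, h1, h2, h3⟩ := TSP.exists_runs m hm (k := k) w hn hc rfl hC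
  refine ⟨t, s, h1, h2, h3, h3.trans ?_⟩
  have h4 : 1 ≤ n ^ 7 := Nat.one_le_pow _ _ hn
  have h5 : n ≤ n ^ 7 := Nat.le_self_pow (by norm_num) n
  have h6 : (C * k ^ 3).factorial ≤ (C * k ^ 3).factorial * n ^ 7 := Nat.le_mul_of_pos_right _ h4
  have h7 : C * (k ^ 3 * n) ≤ C * k ^ 3 * n ^ 7 := by
    rw [← mul_assoc]; exact Nat.mul_le_mul_left _ h5
  calc _ ≤ (C * k ^ 3).factorial * n ^ 7 + C * k ^ 3 * n ^ 7 + C * n ^ 7 := by omega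
    _ = _ := by ring
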